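/- Let $\mathcal P$ be the set of integer partitions, let $\mathsf{Sym}$ be the algebra of symmetric functions over $\mathbb C$ with complete homogeneous functions $h_n$, and for partitions $\mu\subset\lambda$ let $s_{\lambda/\mu}=\det_{1\le i,j\le \ell(\lambda)}h_{\lambda_i-i-\mu_j+j}$ be the skew Schur function and $s_\lambda=s_{\lambda/\emptyset}$. A specialization is an algebra homomorphism $\rho:\mathsf{Sym}\to\mathbb C$, $f\mapsto f(\rho)$, with generating function $H(\rho;t)=\sum_{n\ge0}h_n(\rho)t^n$; it is nonnegative if $s_{\lambda/\mu}(\rho)$ is a nonnegative real number for all $\mu\subset\lambda$. The specializations $\rho\cup\rho'$ and $s\rho$ ($s\in\mathbb C$) are given by $H(\rho\cup\rho';t)=H(\rho;t)H(\rho';t)$ and $H(s\rho;t)=H(\rho;st)$. Put $$H(\rho;\rho')=\sum_{\lambda\in\mathcal P}s_\lambda(\rho)s_\lambda(\rho'),\qquad \tilde H(\rho)=\sum_{\lambda\in\mathcal P}s_\lambda(\rho).$$ Let $N\ge0$, let $u,v\ge0$ be real, and let $\rho_1^\pm,\dots,\rho_N^\pm$ be specializations. The partition function $Z$ of the free boundary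 Schur process is the sum of the weights $$\mathcal W(\vec\lambda,\vec\mu)=u^{|\mu^{(0)}|}v^{|\mu^{(N)}|}\prod_{k=1}^N s_{\lambda^{(k)}/\mu^{(k-1)}}(\rho_k^+)\,s_{\lambda^{(k)}/\mu^{(k)}}(\rho_k^-)$$ over all sequences of partitions $\mu^{(0)}\subset\lambda^{(1)}\supset\mu^{(1)}\subset\cdots\subset\lambda^{(N)}\supset\mu^{(N)}$. Let $\rho^\pm=\rho_1^\pm\cup\cdots\cup\rho_N^\pm$ (the zero specialization, with $H(\rho^\pm;t)=1$, if $N=0$), and consider the identity $$Z=\prod_{1\le k\le\ell\le N}H(\rho_k^+;\rho_\ell^-)\;\prod_{n\ge1}\frac{\tilde H(u^{n-1}v^n\rho^+)\,\tilde H(u^nv^{n-1}\rho^-)\,H(u^{2n}\rho^+;v^{2n}\rho^-)}{1-u^nv^n}.\qquad(\ast)$$ (1) If all $\rho_k^\pm$ are nonnegative and $uv<1$, then the infinite product in $(\ast)$ converges unconditionally in $[0,\infty]$ and $(\ast)$ holds in $[0,\infty]$, all sums being taken in $[0,\infty]$. (2) For arbitrary (complex) specializations, if the series defining $Z$ converges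 absolutely, then $uv<1$, all the series $H$ and $\tilde H$ occurring in $(\ast)$ converge absolutely, the infinite product converges unconditionally, and $(\ast)$ holds in $\mathbb C$. -/

import Mathlib

open scoped ENNReal

namespace FreeBoundarySchur

/-! ### Symmetric functions -/

/-- The algebra of symmetric functions over `ℂ`: formal power series of bounded degree in
countably many variables which are invariant under every permutation of the variables. -/
noncomputable def SymFun : Subalgebra ℂ (MvPowerSeries ℕ ℂ) where
  carrier := {f | (∀ σ : Equiv.Perm ℕ, MvPowerSeries.rename σ f = f) ∧
    ∃ d : ℕ, ∀ m : ℕ →₀ ℕ, d < m.degree → MvPowerSeries.coeff m f = 0}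
  mul_mem' := by
    rintro f g ⟨hf, d, hd⟩ ⟨hg, e, he⟩
    refine ⟨fun σ => by rw [map_mul, hf, hg], d + e, fun m hm => ?_⟩
    rw [MvPowerSeries.coeff_mul]
    refine Finset.sum_eq_zero fun p hp => ?_
    have h : p.1.degree + p.2.degree = m.degree := by
      rw [← map_add, Finset.HasAntidiagonal.mem_antidiagonal.1 hp]
    rcases lt_or_ge d p.1.degree with h1 | h1
    · rw [hd _ h1, zero_mul]
    · rw [he _ (by omega), mul_zero]
  add_mem' := by
    rintro f g ⟨hf, d, hd⟩ ⟨hg, e, he⟩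
    refine ⟨fun σ => by rw [map_add, hf, hg], d + e, fun m hm => ?_⟩
    rw [map_add, hd _ (by omega), he _ (by omega), add_zero]
  algebraMap_mem' := by
    intro r
    refine ⟨fun σ => AlgHom.commutes _ r, 0, fun m hm => ?_⟩
    classical
    rw [MvPowerSeries.algebraMap_apply, MvPowerSeries.coeff_C, if_neg]
    rintro rfl
    simp at hm

/-- The formal power series with coefficient function `c`. -/
noncomputable def ofCoeff (c : (ℕ →₀ ℕ) → ℂ) : MvPowerSeries ℕ ℂ := c

theorem coeff_ofCoeff (c : (ℕ →₀ ℕ) → ℂ) (m : ℕ →₀ ℕ) :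
    MvPowerSeries.coeff m (ofCoeff c) = c m := rfl

theorem rename_eq_iff (f : MvPowerSeries ℕ ℂ) :
    (∀ σ : Equiv.Perm ℕ, MvPowerSeries.rename σ f = f) ↔
      ∀ (σ : Equiv.Perm ℕ) (m : ℕ →₀ ℕ),
        MvPowerSeries.coeff (Finsupp.equivMapDomain σ m) f = MvPowerSeries.coeff m f := by
  have key : ∀ (σ : Equiv.Perm ℕ) (m : ℕ →₀ ℕ),
      MvPowerSeries.coeff (Finsupp.equivMapDomain σ m) (MvPowerSeries.rename σ f)
        = MvPowerSeries.coeff m f := by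
    intro σ m
    have h := MvPowerSeries.coeff_embDomain_rename σ.toEmbedding f m
    rw [Finsupp.embDomain_eq_mapDomain] at h
    rw [Finsupp.equivMapDomain_eq_mapDomain]
    exact h
  constructor
  · intro h σ m
    have := key σ m
    rwa [h σ] at this
  · intro h σ
    ext m
    have h1 := key σ (Finsupp.equivMapDomain σ.symm m)
    rw [← Finsupp.equivMapDomain_trans] at h1
    have h2 := h σ.symm m
    simp only [Equiv.symm_trans_self, Finsupp.equivMapDomain_refl] at h1
    rw [h1, h2]

theorem degree_equivMapDomain {α β : Type*} (e : α ≃ β) (m : α →₀ ℕ) :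
    (Finsupp.equivMapDomain e m).degree = m.degree := by
  rw [Finsupp.equivMapDomain_eq_mapDomain, Finsupp.degree_mapDomain]

/-- The complete homogeneous symmetric function `h_n`, the sum of all monomials of degree `n`. -/
noncomputable def complete (n : ℕ) : SymFun :=
  ⟨ofCoeff fun m => if m.degree = n then 1 else 0, by
    refine ⟨(rename_eq_iff _).2 fun σ m => ?_, n, fun m hm => ?_⟩
    · simp only [coeff_ofCoeff, degree_equivMapDomain]
    · rw [coeff_ofCoeff, if_neg (by omega)]⟩

theorem coeff_complete (n : ℕ) (m : ℕ →₀ ℕ) :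
    MvPowerSeries.coeff m (complete n : MvPowerSeries ℕ ℂ) = if m.degree = n then 1 else 0 := rfl

/-- `h_n` for integer `n`, with `h_n = 0` when `n < 0`. -/
noncomputable def completeInt (n : ℤ) : SymFun :=
  if 0 ≤ n then complete n.toNat else 0

/-- The skew Schur function `s_{lam/mu}`, given by the Jacobi-Trudi determinant
`det (h_{lam_i - i - mu_j + j})` of size the length of `lam`. Partitions are Young diagrams, the
parts being the row lengths; the function is only used for `mu ≤ lam`, that is `mu ⊆ lam`. -/
noncomputable def skewSchur (lam mu : YoungDiagram) : SymFun :=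
  Matrix.det (Matrix.of fun i j : Fin (lam.colLen 0) =>
    completeInt ((lam.rowLen i : ℤ) - (i : ℤ) - (mu.rowLen j : ℤ) + (j : ℤ)))

/-- The Schur function `s_lam`. -/
noncomputable def schur (lam : YoungDiagram) : SymFun := skewSchur lam ⊥

/-! ### Specializations -/

/-- A specialization: an algebra homomorphism from symmetric functions to `ℂ`. -/
abbrev SymSpec : Type := SymFun →ₐ[ℂ] ℂ

/-- The generating function `H(ρ;t) = ∑ h_n(ρ) t^n`, as a formal power series in `t`. -/
noncomputable def genFun (ρ : SymSpec) : PowerSeries ℂ :=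
  PowerSeries.mk fun n => ρ (complete n)

/-- A specialization is nonnegative if all skew Schur functions take nonnegative real values. -/
def SymSpec.Nonneg (ρ : SymSpec) : Prop :=
  ∀ lam mu : YoungDiagram, mu ≤ lam →
    0 ≤ (ρ (skewSchur lam mu)).re ∧ (ρ (skewSchur lam mu)).im = 0

/-- The zero specialization (specialization in no variable): the constant coefficient. -/
noncomputable def zeroSpec : SymSpec where
  toFun f := MvPowerSeries.constantCoeff (f : MvPowerSeries ℕ ℂ)
  map_one' := by simp
  map_mul' := by simp
  map_zero' := by simp
  map_add' := by simp
  commutes' r := by simp [MvPowerSeries.algebraMap_apply]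

theorem prod_pow_eq (s : ℂ) (m : ℕ →₀ ℕ) : (m.prod fun _ k => s ^ k) = s ^ m.degree := by
  rw [Finsupp.prod, Finset.prod_pow_eq_pow_sum, Finsupp.degree_apply]

/-- The substitution `f(x_0, x_1, …) ↦ f(s x_0, s x_1, …)` on symmetric functions. -/
noncomputable def dilate (s : ℂ) (f : SymFun) : SymFun :=
  ⟨MvPowerSeries.rescale (fun _ => s) (f : MvPowerSeries ℕ ℂ), by
    obtain ⟨f, hf, d, hd⟩ := f
    refine ⟨(rename_eq_iff _).2 fun σ m => ?_, d, fun m hm => ?_⟩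
    · rw [MvPowerSeries.coeff_rescale, MvPowerSeries.coeff_rescale, (rename_eq_iff f).1 hf,
        prod_pow_eq, prod_pow_eq, degree_equivMapDomain]
    · rw [MvPowerSeries.coeff_rescale, hd m hm, mul_zero]⟩

/-- The scaled specialization `s ρ`, that is `f ↦ f(s x)` followed by `ρ`. -/
noncomputable def scaleSpec (s : ℂ) (ρ : SymSpec) : SymSpec where
  toFun f := ρ (dilate s f)
  map_one' := by
    rw [show dilate s 1 = 1 from Subtype.ext (by simp [dilate]), map_one]
  map_mul' f g := by
    rw [show dilate s (f * g) = dilate s f * dilate s g from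
      Subtype.ext (by simp [dilate]), map_mul]
  map_zero' := by
    rw [show dilate s 0 = 0 from Subtype.ext (by simp [dilate]), map_zero]
  map_add' f g := by
    rw [show dilate s (f + g) = dilate s f + dilate s g from
      Subtype.ext (by simp [dilate]), map_add]
  commutes' r := by
    rw [show dilate s (algebraMap ℂ SymFun r) = algebraMap ℂ SymFun r from Subtype.ext (by
      ext m
      classical
      simp only [dilate, Subalgebra.coe_algebraMap, MvPowerSeries.algebraMap_apply,
        MvPowerSeries.coeff_rescale, MvPowerSeries.coeff_C]
      split_ifs with h
      · simp [h]
      · simp)]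
    exact ρ.commutes r

/-- The exponent of the monomial `x^a y^b`, for the splitting of the variables into the two
infinite families `x_i = X_{2i}` and `y_i = X_{2i+1}`. -/
noncomputable def join : (ℕ →₀ ℕ) × (ℕ →₀ ℕ) ≃+ (ℕ →₀ ℕ) :=
  Finsupp.sumFinsuppAddEquivProdFinsupp.symm.trans
    (Finsupp.domCongr Equiv.natSumNatEquivNat)

theorem join_map (σ τ : Equiv.Perm ℕ) (a b : ℕ →₀ ℕ) :
    join (Finsupp.equivMapDomain σ a, Finsupp.equivMapDomain τ b) =
      Finsupp.equivMapDomain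
        ((Equiv.natSumNatEquivNat.symm.trans (Equiv.sumCongr σ τ)).trans
          Equiv.natSumNatEquivNat) (join (a, b)) := by
  ext i
  obtain ⟨j, rfl⟩ := Equiv.natSumNatEquivNat.surjective i
  rcases j with j | j <;> simp [join, Finsupp.equivMapDomain_apply]

theorem degree_join (a b : ℕ →₀ ℕ) : (join (a, b)).degree = a.degree + b.degree := by
  have h : join (a, b) = join (a, 0) + join (0, b) := by
    rw [← map_add]; simp
  have h1 : join (a, 0) = Finsupp.mapDomain (fun n => 2 * n) a := by
    ext i
    obtain ⟨j, rfl⟩ := Equiv.natSumNatEquivNat.surjective i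
    rcases j with j | j
    · simp only [join, AddEquiv.trans_apply, Finsupp.domCongr_apply,
        Finsupp.equivMapDomain_apply, Equiv.symm_apply_apply]
      simp only [Equiv.natSumNatEquivNat_apply, Sum.elim_inl]
      rw [Finsupp.mapDomain_apply (fun x y h => by simpa using h)]
      simp
    · simp only [join, AddEquiv.trans_apply, Finsupp.domCongr_apply,
        Finsupp.equivMapDomain_apply, Equiv.symm_apply_apply]
      simp only [Equiv.natSumNatEquivNat_apply, Sum.elim_inr]
      rw [Finsupp.mapDomain_of_notMem_range _ _ (by rintro ⟨x, hx⟩; simp only at hx; omega)]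
      simp
  have h2 : join (0, b) = Finsupp.mapDomain (fun n => 2 * n + 1) b := by
    ext i
    obtain ⟨j, rfl⟩ := Equiv.natSumNatEquivNat.surjective i
    rcases j with j | j
    · simp only [join, AddEquiv.trans_apply, Finsupp.domCongr_apply,
        Finsupp.equivMapDomain_apply, Equiv.symm_apply_apply]
      simp only [Equiv.natSumNatEquivNat_apply, Sum.elim_inl]
      rw [Finsupp.mapDomain_of_notMem_range _ _ (by rintro ⟨x, hx⟩; simp only at hx; omega)]
      simp
    · simp only [join, AddEquiv.trans_apply, Finsupp.domCongr_apply,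
        Finsupp.equivMapDomain_apply, Equiv.symm_apply_apply]
      simp only [Equiv.natSumNatEquivNat_apply, Sum.elim_inr]
      rw [Finsupp.mapDomain_apply (fun x y h => by simpa using h)]
      simp
  rw [h, map_add, h1, h2, Finsupp.degree_mapDomain, Finsupp.degree_mapDomain]

/-- Writing a symmetric function as `f(x, y)`, the coefficient of `y^b`: a symmetric function
of `x`. -/
noncomputable def slice (f : SymFun) (b : ℕ →₀ ℕ) : SymFun :=
  ⟨ofCoeff fun a => MvPowerSeries.coeff (join (a, b)) (f : MvPowerSeries ℕ ℂ), by
    obtain ⟨f, hf, d, hd⟩ := f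
    refine ⟨(rename_eq_iff _).2 fun σ m => ?_, d, fun m hm => ?_⟩
    · have h := join_map σ (Equiv.refl ℕ) m b
      rw [Finsupp.equivMapDomain_refl] at h
      rw [coeff_ofCoeff, coeff_ofCoeff, h, (rename_eq_iff f).1 hf]
    · rw [coeff_ofCoeff]
      exact hd _ (by rw [degree_join]; omega)⟩

theorem coeff_slice (f : SymFun) (a b : ℕ →₀ ℕ) :
    MvPowerSeries.coeff a (slice f b : MvPowerSeries ℕ ℂ) =
      MvPowerSeries.coeff (join (a, b)) (f : MvPowerSeries ℕ ℂ) := rfl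

theorem slice_mul (f g : SymFun) (b : ℕ →₀ ℕ) :
    slice (f * g) b =
      ∑ p ∈ Finset.HasAntidiagonal.antidiagonal b, slice f p.1 * slice g p.2 := by
  apply Subtype.ext
  ext a
  rw [AddSubmonoidClass.coe_finsetSum, map_sum, coeff_slice]
  simp only [MulMemClass.coe_mul, MvPowerSeries.coeff_mul, coeff_slice]
  rw [Finset.sum_sigma']
  refine Finset.sum_nbij'
    (fun q => ⟨((join.symm q.1).2, (join.symm q.2).2), ((join.symm q.1).1, (join.symm q.2).1)⟩)
    (fun q => (join (q.2.1, q.1.1), join (q.2.2, q.1.2))) ?_ ?_ ?_ ?_ ?_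
  · rintro ⟨p, q⟩ h
    rw [Finset.HasAntidiagonal.mem_antidiagonal] at h
    have h' := congrArg join.symm h
    simp only [map_add, AddEquiv.symm_apply_apply] at h'
    simp only [Finset.mem_sigma, Finset.HasAntidiagonal.mem_antidiagonal]
    exact ⟨congrArg Prod.snd h', congrArg Prod.fst h'⟩
  · rintro ⟨⟨p, q⟩, ⟨r, s⟩⟩ h
    simp only [Finset.mem_sigma, Finset.HasAntidiagonal.mem_antidiagonal] at h ⊢
    rw [← map_add, Prod.mk_add_mk, h.1, h.2]
  · rintro ⟨p, q⟩ _
    simp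
  · rintro ⟨⟨p, q⟩, ⟨r, s⟩⟩ _
    simp
  · rintro ⟨p, q⟩ _
    simp

/-- Writing a symmetric function as `f(x, y)` and applying `ρ` to the variables `x`: a symmetric
function of `y`. -/
noncomputable def partialSpec (ρ : SymSpec) (f : SymFun) : SymFun :=
  ⟨ofCoeff fun b => ρ (slice f b), by
    obtain ⟨f, hf, d, hd⟩ := f
    refine ⟨(rename_eq_iff _).2 fun σ b => ?_, d, fun b hb => ?_⟩
    · rw [coeff_ofCoeff, coeff_ofCoeff]
      congr 1
      apply Subtype.ext
      ext a
      have h := join_map (Equiv.refl ℕ) σ a b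
      rw [Finsupp.equivMapDomain_refl] at h
      rw [coeff_slice, coeff_slice, h, (rename_eq_iff f).1 hf]
    · rw [coeff_ofCoeff]
      convert map_zero ρ
      apply Subtype.ext
      ext a
      rw [coeff_slice, ZeroMemClass.coe_zero, map_zero]
      exact hd _ (by rw [degree_join]; omega)⟩

theorem coeff_partialSpec (ρ : SymSpec) (f : SymFun) (b : ℕ →₀ ℕ) :
    MvPowerSeries.coeff b (partialSpec ρ f : MvPowerSeries ℕ ℂ) = ρ (slice f b) := rfl

theorem partialSpec_mul (ρ : SymSpec) (f g : SymFun) :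
    partialSpec ρ (f * g) = partialSpec ρ f * partialSpec ρ g := by
  apply Subtype.ext
  ext b
  rw [coeff_partialSpec, slice_mul, map_sum, MulMemClass.coe_mul, MvPowerSeries.coeff_mul]
  simp only [map_mul, coeff_partialSpec]

theorem partialSpec_add (ρ : SymSpec) (f g : SymFun) :
    partialSpec ρ (f + g) = partialSpec ρ f + partialSpec ρ g := by
  apply Subtype.ext
  ext b
  rw [AddMemClass.coe_add, map_add, coeff_partialSpec, coeff_partialSpec, coeff_partialSpec,
    ← map_add]
  rfl

theorem partialSpec_algebraMap (ρ : SymSpec) (r : ℂ) :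
    partialSpec ρ (algebraMap ℂ SymFun r) = algebraMap ℂ SymFun r := by
  classical
  apply Subtype.ext
  ext b
  have h : slice (algebraMap ℂ SymFun r) b = if b = 0 then algebraMap ℂ SymFun r else 0 := by
    apply Subtype.ext
    ext a
    rw [coeff_slice, Subalgebra.coe_algebraMap, MvPowerSeries.algebraMap_apply,
      MvPowerSeries.coeff_C]
    simp only [EmbeddingLike.map_eq_zero_iff, Prod.mk_eq_zero]
    by_cases hb : b = 0
    · simp [hb, MvPowerSeries.algebraMap_apply, MvPowerSeries.coeff_C]
    · simp [hb]
  rw [coeff_partialSpec, h, Subalgebra.coe_algebraMap, MvPowerSeries.algebraMap_apply,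
    MvPowerSeries.coeff_C]
  by_cases hb : b = 0
  · simp [hb]
  · simp [hb]

/-- The union `ρ ∪ ρ'`: write a symmetric function as `f(x, y)` with two infinite families of
variables, then apply `ρ` to `x` and `ρ'` to `y`. -/
noncomputable def unionSpec (ρ ρ' : SymSpec) : SymSpec where
  toFun f := ρ' (partialSpec ρ f)
  map_one' := by
    have h := partialSpec_algebraMap ρ 1
    rw [map_one] at h
    rw [h, map_one]
  map_mul' f g := by rw [partialSpec_mul, map_mul]
  map_zero' := by
    have h := partialSpec_algebraMap ρ 0
    rw [map_zero] at h
    rw [h, map_zero]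
  map_add' f g := by rw [partialSpec_add, map_add]
  commutes' r := by
    rw [partialSpec_algebraMap]
    exact ρ'.commutes r

/-- The union `ρ_1 ∪ ⋯ ∪ ρ_N`; the zero specialization when `N = 0`. -/
noncomputable def iUnionSpec : {N : ℕ} → (Fin N → SymSpec) → SymSpec
  | 0, _ => zeroSpec
  | _ + 1, ρ => unionSpec (ρ 0) (iUnionSpec fun k => ρ k.succ)

/-- `H(s ρ; t) = H(ρ; s t)`. -/
theorem genFun_scaleSpec (s : ℂ) (ρ : SymSpec) :
    genFun (scaleSpec s ρ) = PowerSeries.rescale s (genFun ρ) := by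
  ext n
  rw [PowerSeries.coeff_rescale, genFun, genFun, PowerSeries.coeff_mk, PowerSeries.coeff_mk]
  change ρ (dilate s (complete n)) = _
  have h : dilate s (complete n) = s ^ n • complete n := by
    apply Subtype.ext
    ext m
    rw [SetLike.val_smul, map_smul, coeff_complete, dilate, MvPowerSeries.coeff_rescale,
      prod_pow_eq, coeff_complete, smul_eq_mul]
    split_ifs with hm
    · rw [hm]
    · simp
  rw [h, map_smul, smul_eq_mul]

/-- `H(ρ ∪ ρ'; t) = H(ρ; t) H(ρ'; t)`. -/
theorem genFun_unionSpec (ρ ρ' : SymSpec) :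
    genFun (unionSpec ρ ρ') = genFun ρ * genFun ρ' := by
  ext n
  rw [PowerSeries.coeff_mul]
  simp only [genFun, PowerSeries.coeff_mk]
  change ρ' (partialSpec ρ (complete n)) = _
  have h : partialSpec ρ (complete n) =
      ∑ p ∈ Finset.HasAntidiagonal.antidiagonal n, ρ (complete p.1) • complete p.2 := by
    apply Subtype.ext
    ext b
    rw [AddSubmonoidClass.coe_finsetSum, map_sum, coeff_partialSpec]
    simp only [SetLike.val_smul, map_smul, coeff_complete, smul_eq_mul]
    by_cases hb : b.degree ≤ n
    · rw [Finset.sum_eq_single (n - b.degree, b.degree)]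
      · rw [if_pos rfl, mul_one]
        congr 1
        apply Subtype.ext
        ext a
        rw [coeff_slice, coeff_complete, coeff_complete, degree_join]
        congr 1
        exact propext ⟨fun h => by omega, fun h => by omega⟩
      · rintro ⟨i, j⟩ hij hne
        rw [Finset.HasAntidiagonal.mem_antidiagonal] at hij
        simp only at hij ⊢
        rw [if_neg, mul_zero]
        rintro rfl
        exact hne (by rw [Prod.mk.injEq]; exact ⟨by omega, rfl⟩)
      · intro hn
        exact absurd (Finset.HasAntidiagonal.mem_antidiagonal.2 (by simp only; omega)) hn
    · rw [Finset.sum_eq_zero]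
      · convert map_zero ρ
        apply Subtype.ext
        ext a
        rw [coeff_slice, coeff_complete, degree_join, ZeroMemClass.coe_zero, map_zero,
          if_neg (by omega)]
      · rintro ⟨i, j⟩ hij
        rw [Finset.HasAntidiagonal.mem_antidiagonal] at hij
        simp only at hij ⊢
        rw [if_neg (by omega), mul_zero]
  rw [h, map_sum]
  simp only [map_smul, smul_eq_mul]

/-- `H(0; t) = 1` for the zero specialization. -/
theorem genFun_zeroSpec : genFun zeroSpec = 1 := by
  ext n
  rw [genFun, PowerSeries.coeff_mk, PowerSeries.coeff_one]
  change MvPowerSeries.coeff (0 : ℕ →₀ ℕ) (complete n : MvPowerSeries ℕ ℂ) = _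
  rw [coeff_complete, map_zero]
  congr 1
  exact propext eq_comm

/-- `H(ρ_1 ∪ ⋯ ∪ ρ_N; t) = ∏ H(ρ_k; t)`. -/
theorem genFun_iUnionSpec {N : ℕ} (ρ : Fin N → SymSpec) :
    genFun (iUnionSpec ρ) = ∏ k, genFun (ρ k) := by
  induction N with
  | zero => simp [iUnionSpec, genFun_zeroSpec]
  | succ N ih => rw [iUnionSpec, genFun_unionSpec, ih, Fin.prod_univ_succ]

/-! ### The quantities `H(ρ;ρ')` and `H̃(ρ)`

In each case there is a complex version and a version with values in `[0,∞]`; the latter is meant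
for nonnegative specializations, where every term is a nonnegative real number. -/

/-- The terms of the series `H(ρ;ρ') = ∑ s_lam(ρ) s_lam(ρ')` over all partitions. -/
noncomputable def cauchyTerm (ρ ρ' : SymSpec) (lam : YoungDiagram) : ℂ :=
  ρ (schur lam) * ρ' (schur lam)

/-- The terms of the series `H̃(ρ) = ∑ s_lam(ρ)` over all partitions. -/
noncomputable def littlewoodTerm (ρ : SymSpec) (lam : YoungDiagram) : ℂ :=
  ρ (schur lam)

noncomputable def cauchyH (ρ ρ' : SymSpec) : ℂ := ∑' lam, cauchyTerm ρ ρ' lam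

noncomputable def littlewoodH (ρ : SymSpec) : ℂ := ∑' lam, littlewoodTerm ρ lam

noncomputable def cauchyHInf (ρ ρ' : SymSpec) : ℝ≥0∞ :=
  ∑' lam, ENNReal.ofReal (cauchyTerm ρ ρ' lam).re

noncomputable def littlewoodHInf (ρ : SymSpec) : ℝ≥0∞ :=
  ∑' lam, ENNReal.ofReal (littlewoodTerm ρ lam).re

/-! ### The free boundary Schur process -/

/-- Sequences of partitions
`mu⁽⁰⁾ ⊆ lam⁽¹⁾ ⊇ mu⁽¹⁾ ⊆ ⋯ ⊇ mu⁽ᴺ⁻¹⁾ ⊆ lam⁽ᴺ⁾ ⊇ mu⁽ᴺ⁾`;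
here `lam k` stands for `lam⁽ᵏ⁺¹⁾` and `mu k` for `mu⁽ᵏ⁾`. -/
structure PartitionSeq (N : ℕ) where
  lam : Fin N → YoungDiagram
  mu : Fin (N + 1) → YoungDiagram
  left_le : ∀ k : Fin N, mu k.castSucc ≤ lam k
  right_le : ∀ k : Fin N, mu k.succ ≤ lam k

/-- The weight
`u^|mu⁽⁰⁾| v^|mu⁽ᴺ⁾| ∏ s_{lam⁽ᵏ⁾/mu⁽ᵏ⁻¹⁾}(ρ_k⁺) s_{lam⁽ᵏ⁾/mu⁽ᵏ⁾}(ρ_k⁻)` of a sequence. -/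
noncomputable def weight {N : ℕ} (u v : ℝ) (ρp ρm : Fin N → SymSpec)
    (S : PartitionSeq N) : ℂ :=
  (u : ℂ) ^ (S.mu 0).card * (v : ℂ) ^ (S.mu (Fin.last N)).card *
    ∏ k : Fin N, (ρp k (skewSchur (S.lam k) (S.mu k.castSucc)) *
      ρm k (skewSchur (S.lam k) (S.mu k.succ)))

/-- The partition function, as a complex series over all sequences. -/
noncomputable def partitionFunction {N : ℕ} (u v : ℝ) (ρp ρm : Fin N → SymSpec) : ℂ :=
  ∑' S, weight u v ρp ρm S

/-- The partition function in `[0,∞]`, for nonnegative weights. -/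
noncomputable def partitionFunctionInf {N : ℕ} (u v : ℝ) (ρp ρm : Fin N → SymSpec) :
    ℝ≥0∞ :=
  ∑' S, ENNReal.ofReal (weight u v ρp ρm S).re

/-- The `n`-th factor (`n ≥ 1`) of the infinite product:
`H̃(u^{n-1} v^n ρ⁺) H̃(u^n v^{n-1} ρ⁻) H(u^{2n} ρ⁺; v^{2n} ρ⁻) / (1 - u^n v^n)`. -/
noncomputable def reflectionFactor (u v : ℝ) (ρp ρm : SymSpec) (n : ℕ) : ℂ :=
  littlewoodH (scaleSpec ((u : ℂ) ^ (n - 1) * (v : ℂ) ^ n) ρp) *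
    littlewoodH (scaleSpec ((u : ℂ) ^ n * (v : ℂ) ^ (n - 1)) ρm) *
    cauchyH (scaleSpec ((u : ℂ) ^ (2 * n)) ρp) (scaleSpec ((v : ℂ) ^ (2 * n)) ρm) /
    (1 - (u : ℂ) ^ n * (v : ℂ) ^ n)

/-- The same factor in `[0,∞]`, for nonnegative specializations and `u v < 1`. -/
noncomputable def reflectionFactorInf (u v : ℝ) (ρp ρm : SymSpec) (n : ℕ) : ℝ≥0∞ :=
  littlewoodHInf (scaleSpec ((u : ℂ) ^ (n - 1) * (v : ℂ) ^ n) ρp) *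
    littlewoodHInf (scaleSpec ((u : ℂ) ^ n * (v : ℂ) ^ (n - 1)) ρm) *
    cauchyHInf (scaleSpec ((u : ℂ) ^ (2 * n)) ρp) (scaleSpec ((v : ℂ) ^ (2 * n)) ρm) /
    ENNReal.ofReal (1 - u ^ n * v ^ n)

end FreeBoundarySchur

open FreeBoundarySchur

/-!
The partition function is a matrix element of a product of vertex operators. For a power series `H`
with constant term one, the numbers `sk H lam mu` (skew Schur functions of the specialization with
generating function `H`) are minors of a Toeplitz matrix, so that by the Cauchy–Binet formula
`sk (H * H') lam mu = ∑ nu, sk H lam nu * sk H' nu mu` (`sk_mul`). They are the matrix coefficients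
of a creation operator, which enlarges diagrams, and of its transpose, an annihilation operator. The
vector `ket u = ∑ lam, u ^ |lam| lam` and the linear form `bra v : lam ↦ v ^ |lam|` represent the two
free boundaries, and the partition function is obtained by applying alternately creation and
annihilation operators to `ket u` and then `bra v` (`bra_wordOp_ket_eq_finsum`).

Three relations evaluate it. Exchanging an annihilation and a creation operator costs a factor
`H(ρ;ρ')` (the skew Cauchy identity, `downOp_mul_upOp`), and either boundary reflects operators of
one kind into operators of the other kind at the cost of a factor `H̃(ρ)` (the skew Littlewood
identity, `downOp_ket` and `bra_upOp`). Moving all annihilation operators to the right produces the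
finite product. Then the remaining operators are reflected again and again at the two boundaries;
every round produces two factors `H̃` and one factor `H` of the infinite product, and two rounds scale
the specializations by `(u v) ^ 2`, so that in the limit only `∑ lam, (u v) ^ |lam|` is left, the
product of the factors `1 / (1 - (u v) ^ n)`. The relations need only be proved up to a constant,
which is found on the empty diagram. Modulo terms of high degree every `H` is a finite product of
series `∑ x ^ n t ^ n`; by multiplicativity it is enough to treat one variable, where the skew
functions are supported on horizontal strips and the relations follow from a local bijection
(`localRule`).

There are no convergence questions in this computation: `u`, `v` and all specializations are scaled
by a variable `t` with `t ^ K = 0`, which makes the operators nilpotent and the iteration finite.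
This gives the identity of formal power series in `t` `coeff_gradedSeries_weight`. It remains to put
`t = 1`. For nonnegative specializations all coefficients are nonnegative and this is monotone
convergence (`mass_eq_mul_iSup`). In the complex case, absolute convergence of the partition function
is restricted to suitable families of sequences of partitions: constant sequences give `u v < 1`,
sequences with one plateau give the series `H(ρ_k⁺;ρ_l⁻)`, and sequences with trivial steps of one
kind give `H̃(v ρ⁺)` and `H̃(u ρ⁻)`. The other series are dominated by these, the `n`-th factor of the
infinite product is `1 + O((u v) ^ n)` in the `ℓ¹`-norm, and dominated convergence applies
(`evalOne_eq_mul_tprod`).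
-/

/-! ### Young diagrams described by their row lengths -/

namespace FreeBoundarySchur

theorem rowLen_eq_zero {lam : YoungDiagram} {i : ℕ} (h : lam.colLen 0 ≤ i) :
    lam.rowLen i = 0 := by
  by_contra h0
  have : (i, 0) ∈ lam := YoungDiagram.mem_iff_lt_rowLen.2 (Nat.pos_of_ne_zero h0)
  rw [YoungDiagram.mem_iff_lt_colLen] at this
  omega

theorem colLen_le_of_rowLen_eq_zero {lam : YoungDiagram} {n : ℕ} (h : lam.rowLen n = 0) :
    lam.colLen 0 ≤ n := by
  by_contra h0
  have : (n, 0) ∈ lam := YoungDiagram.mem_iff_lt_colLen.2 (by omega)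
  rw [YoungDiagram.mem_iff_lt_rowLen] at this
  omega

theorem le_iff_rowLen_le {mu lam : YoungDiagram} :
    mu ≤ lam ↔ ∀ i, mu.rowLen i ≤ lam.rowLen i := by
  constructor
  · intro h i
    by_contra hlt
    have h1 : (i, lam.rowLen i) ∈ mu := YoungDiagram.mem_iff_lt_rowLen.2 (by omega)
    have h2 : (i, lam.rowLen i) ∈ lam := h h1
    rw [YoungDiagram.mem_iff_lt_rowLen] at h2
    omega
  · rintro h ⟨i, j⟩ hc
    have hc' : (i, j) ∈ mu := hc
    change (i, j) ∈ lam
    rw [YoungDiagram.mem_iff_lt_rowLen] at hc' ⊢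
    exact hc'.trans_le (h i)

theorem ext_rowLen {lam mu : YoungDiagram} (h : ∀ i, lam.rowLen i = mu.rowLen i) : lam = mu :=
  le_antisymm (le_iff_rowLen_le.2 fun i => (h i).le) (le_iff_rowLen_le.2 fun i => (h i).ge)

theorem colLen_mono {mu lam : YoungDiagram} (h : mu ≤ lam) : mu.colLen 0 ≤ lam.colLen 0 := by
  apply colLen_le_of_rowLen_eq_zero
  have := le_iff_rowLen_le.1 h (lam.colLen 0)
  rw [rowLen_eq_zero le_rfl] at this
  omega

theorem card_eq_sum_rowLen (lam : YoungDiagram) {n : ℕ} (hn : lam.colLen 0 ≤ n) :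
    lam.card = ∑ i ∈ Finset.range n, lam.rowLen i := by
  have h : ∀ c ∈ lam.cells, c.1 ∈ Finset.range n := by
    rintro ⟨i, j⟩ hc
    rw [Finset.mem_range]
    have h1 : (i, 0) ∈ lam := lam.up_left_mem le_rfl (Nat.zero_le j) hc
    rw [YoungDiagram.mem_iff_lt_colLen] at h1
    exact h1.trans_le hn
  rw [YoungDiagram.card, Finset.card_eq_sum_card_fiberwise h]
  refine Finset.sum_congr rfl fun i _ => ?_
  rw [YoungDiagram.rowLen_eq_card]
  rfl

theorem card_mono {mu lam : YoungDiagram} (h : mu ≤ lam) : mu.card ≤ lam.card :=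
  Finset.card_le_card h

theorem card_eq_zero_iff {lam : YoungDiagram} : lam.card = 0 ↔ lam = ⊥ := by
  constructor
  · intro h
    apply le_antisymm _ bot_le
    intro c hc
    rw [YoungDiagram.card, Finset.card_eq_zero] at h
    have : c ∈ lam.cells := hc
    simp [h] at this
  · rintro rfl
    rfl

@[simp]
theorem card_bot : (⊥ : YoungDiagram).card = 0 := rfl

@[simp]
theorem rowLen_bot (i : ℕ) : (⊥ : YoungDiagram).rowLen i = 0 := by
  by_contra h
  have : (i, 0) ∈ (⊥ : YoungDiagram) := YoungDiagram.mem_iff_lt_rowLen.2 (Nat.pos_of_ne_zero h)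
  exact YoungDiagram.notMem_bot _ this

@[simp]
theorem colLen_bot : (⊥ : YoungDiagram).colLen 0 = 0 :=
  Nat.le_zero.1 (colLen_le_of_rowLen_eq_zero (rowLen_bot 0))

/-- The Young diagram whose row lengths are a given antitone sequence vanishing from `n` on. -/
def ofRows (f : ℕ → ℕ) (hf : Antitone f) (n : ℕ) (_hn : f n = 0) : YoungDiagram where
  cells := (Finset.range n).biUnion fun i => {i} ×ˢ Finset.range (f i)
  isLowerSet := by
    rintro ⟨i, j⟩ ⟨i', j'⟩ ⟨h1, h2⟩ h
    simp only [Finset.coe_biUnion, Set.mem_iUnion, Finset.mem_coe, Finset.mem_product,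
      Finset.mem_singleton, Finset.mem_range] at h ⊢ h1 h2
    obtain ⟨k, hk, rfl, hj⟩ := h
    refine ⟨i', by omega, rfl, ?_⟩
    have := hf h1
    omega

@[simp]
theorem rowLen_ofRows (f : ℕ → ℕ) (hf : Antitone f) (n : ℕ) (hn : f n = 0) (i : ℕ) :
    (ofRows f hf n hn).rowLen i = f i := by
  have key : ∀ j, j < (ofRows f hf n hn).rowLen i ↔ j < f i := by
    intro j
    rw [← YoungDiagram.mem_iff_lt_rowLen, ← YoungDiagram.mem_cells]
    simp only [ofRows, Finset.mem_biUnion, Finset.mem_product, Finset.mem_singleton,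
      Finset.mem_range]
    constructor
    · rintro ⟨k, _, rfl, h⟩
      exact h
    · intro h
      refine ⟨i, ?_, rfl, h⟩
      by_contra hi
      have := hf (not_lt.1 hi)
      omega
  have h1 := key (f i)
  have h2 := key ((ofRows f hf n hn).rowLen i)
  omega

theorem finite_card_le (n : ℕ) : {lam : YoungDiagram | lam.card ≤ n}.Finite := by
  apply Set.Finite.of_finite_image (f := YoungDiagram.cells)
  · refine ((Finset.range n ×ˢ Finset.range n).powerset.finite_toSet).subset ?_
    rintro _ ⟨lam, hlam, rfl⟩
    rw [Finset.mem_coe, Finset.mem_powerset]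
    rintro ⟨i, j⟩ hc
    have hl : lam.card ≤ n := hlam
    rw [Finset.mem_product, Finset.mem_range, Finset.mem_range]
    constructor
    · have : (Finset.range (i + 1) ×ˢ {j}).card ≤ lam.cells.card := by
        apply Finset.card_le_card
        rintro ⟨a, b⟩ h
        simp only [Finset.mem_product, Finset.mem_range, Finset.mem_singleton] at h
        exact lam.up_left_mem (by omega) (by omega) hc
      rw [Finset.card_product] at this
      simp only [Finset.card_range, Finset.card_singleton, mul_one] at this
      exact lt_of_lt_of_le (Nat.lt_of_succ_le this) hl
    · have : ({i} ×ˢ Finset.range (j + 1)).card ≤ lam.cells.card := by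
        apply Finset.card_le_card
        rintro ⟨a, b⟩ h
        simp only [Finset.mem_product, Finset.mem_range, Finset.mem_singleton] at h
        exact lam.up_left_mem (by omega) (by omega) hc
      rw [Finset.card_product] at this
      simp only [Finset.card_range, Finset.card_singleton, one_mul] at this
      exact lt_of_lt_of_le (Nat.lt_of_succ_le this) hl
  · intro a _ b _ h
    exact YoungDiagram.ext h

theorem finite_Iic (lam : YoungDiagram) : (Set.Iic lam).Finite :=
  (finite_card_le lam.card).subset fun _ h => card_mono h

/-- The interval `[mu, lam]` of Young diagrams, as a finite set. -/
noncomputable def between (mu lam : YoungDiagram) : Finset YoungDiagram :=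
  ((finite_Iic lam).subset (Set.Icc_subset_Iic_self (a := mu))).toFinset

@[simp]
theorem mem_between {mu lam nu : YoungDiagram} : nu ∈ between mu lam ↔ mu ≤ nu ∧ nu ≤ lam := by
  simp [between]

end FreeBoundarySchur

/-! ### Minors of Toeplitz matrices -/

namespace FreeBoundarySchur

open PowerSeries Finset

variable {R : Type*} [CommRing R]

/-- The coefficient of a power series at an integer, zero at negative integers. -/
noncomputable def coeffInt (H : R⟦X⟧) (n : ℤ) : R :=
  if 0 ≤ n then coeff n.toNat H else 0

theorem coeffInt_of_neg (H : R⟦X⟧) {n : ℤ} (h : n < 0) : coeffInt H n = 0 :=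
  if_neg (by omega)

theorem coeffInt_natCast (H : R⟦X⟧) (n : ℕ) : coeffInt H n = coeff n H := by
  simp [coeffInt]

/-- The minor of the Toeplitz matrix `(h_{y - x})` with rows `x` and columns `y`. -/
noncomputable def minor (H : R⟦X⟧) {n : ℕ} (x y : Fin n → ℤ) : R :=
  Matrix.det (Matrix.of fun i j => coeffInt H (y j - x i))

/-- The strictly increasing sequence `i - lam_i` encoding a Young diagram. -/
def pos (lam : YoungDiagram) (i : ℕ) : ℤ := (i : ℤ) - (lam.rowLen i : ℤ)

theorem strictMono_pos (lam : YoungDiagram) : StrictMono (pos lam) := by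
  refine strictMono_nat_of_lt_succ fun i => ?_
  have := lam.rowLen_anti i (i + 1) (by omega)
  simp only [pos]
  push_cast
  omega

/-- The value of the skew Schur function `s_{lam/mu}` at the specialization whose generating
function is `H`. -/
noncomputable def sk (H : R⟦X⟧) (lam mu : YoungDiagram) : R :=
  minor H (fun i : Fin (lam.colLen 0) => pos lam i) (fun i : Fin (lam.colLen 0) => pos mu i)

theorem apply_skewSchur (ρ : SymSpec) (lam mu : YoungDiagram) :
    ρ (skewSchur lam mu) = sk (genFun ρ) lam mu := by
  rw [skewSchur, AlgHom.map_det, sk, minor]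
  congr 1
  ext i j
  simp only [AlgHom.mapMatrix_apply, Matrix.map_apply, Matrix.of_apply]
  rw [show (lam.rowLen i : ℤ) - (i : ℤ) - (mu.rowLen j : ℤ) + (j : ℤ) = pos mu j - pos lam i by
    simp only [pos]; ring, completeInt, coeffInt]
  by_cases h0 : 0 ≤ pos mu j - pos lam i
  · rw [if_pos h0, if_pos h0, genFun, coeff_mk]
  · rw [if_neg h0, if_neg h0, map_zero]

theorem minor_succ_of_zero (H : R⟦X⟧) (hH : constantCoeff H = 1) {n : ℕ} (x y : ℕ → ℤ)
    (hy : StrictMono y) (h : x n = y n) :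
    minor H (fun i : Fin (n + 1) => x i) (fun i : Fin (n + 1) => y i) =
      minor H (fun i : Fin n => x i) (fun i : Fin n => y i) := by
  rw [minor, Matrix.det_succ_row _ (Fin.last n), Fin.sum_univ_castSucc, Finset.sum_eq_zero]
  · simp only [Fin.val_last, Matrix.of_apply, h, sub_self, zero_add, Even.neg_pow ⟨n, rfl⟩,
      one_pow, one_mul]
    rw [show coeffInt H 0 = 1 by simpa using (coeffInt_natCast H 0).trans (by simpa using hH),
      one_mul, minor]
    congr 1
    ext i j
    simp
  · intro j _
    have hj : y j < y n := hy j.2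
    simp only [Fin.val_last, Fin.val_castSucc, Matrix.of_apply]
    rw [coeffInt_of_neg _ (by omega), mul_zero, zero_mul]

theorem minor_eq_sk (H : R⟦X⟧) (hH : constantCoeff H = 1) {lam mu : YoungDiagram} (hle : mu ≤ lam)
    {n : ℕ} (hn : lam.colLen 0 ≤ n) :
    minor H (fun i : Fin n => pos lam i) (fun i : Fin n => pos mu i) = sk H lam mu := by
  induction n, hn using Nat.le_induction with
  | base => rfl
  | succ n hn ih =>
    rw [minor_succ_of_zero H hH _ _ (strictMono_pos mu), ih]
    rw [pos, pos, rowLen_eq_zero hn, rowLen_eq_zero ((colLen_mono hle).trans hn)]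

/-- A Toeplitz minor vanishes as soon as it has a block of zeros meeting the diagonal. -/
theorem minor_eq_zero (H : R⟦X⟧) {n : ℕ} (x y : Fin n → ℤ) (hx : Monotone x) (hy : Monotone y)
    (k : Fin n) (hk : y k < x k) : minor H x y = 0 := by
  rw [minor, Matrix.det_apply]
  refine Finset.sum_eq_zero fun σ _ => ?_
  -- some column `j ≤ k` is sent to a row `σ j ≥ k`, since `k + 1` columns do not fit into `k` rows
  obtain ⟨j, hj, hσ⟩ : ∃ j ≤ k, k ≤ σ j := by
    by_contra! h
    have h1 : (Finset.Iic k).card ≤ (Finset.Iio k).card :=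
      Finset.card_le_card_of_injOn σ (fun j hj => by
        simpa using h j (by simpa using hj)) σ.injective.injOn
    simp at h1
  rw [Finset.prod_eq_zero (Finset.mem_univ j), smul_zero]
  rw [Matrix.of_apply, coeffInt_of_neg]
  have := hx hσ
  have := hy hj
  omega

/-- Toeplitz minors are homogeneous, and depend on the first coefficients only. -/
theorem minor_eq_pow_mul (H H' : R⟦X⟧) (a : R) {n : ℕ} (x y : Fin n → ℤ) (N : ℕ)
    (hN : ∑ i, y i - ∑ i, x i = N) (h : ∀ m ≤ N, coeff m H' = a ^ m * coeff m H) :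
    minor H' x y = a ^ N * minor H x y := by
  rw [minor, minor, Matrix.det_apply, Matrix.det_apply, Finset.mul_sum]
  refine Finset.sum_congr rfl fun σ _ => ?_
  rw [mul_smul_comm]
  congr 1
  simp only [Matrix.of_apply]
  by_cases hσ : ∀ i, 0 ≤ y i - x (σ i)
  · have hsum : ∑ i, (y i - x (σ i)) = N := by
      rw [Finset.sum_sub_distrib, Equiv.sum_comp σ x, hN]
    have hsum' : ∑ i, (y i - x (σ i)).toNat = N := by
      have : ((∑ i, (y i - x (σ i)).toNat : ℕ) : ℤ) = N := by
        rw [← hsum]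
        push_cast
        exact Finset.sum_congr rfl fun i _ => Int.toNat_of_nonneg (hσ i)
      exact_mod_cast this
    rw [← hsum', ← Finset.prod_pow_eq_pow_sum, ← Finset.prod_mul_distrib]
    refine Finset.prod_congr rfl fun i _ => ?_
    rw [coeffInt, coeffInt, if_pos (hσ i), if_pos (hσ i), h]
    rw [← hsum']
    exact Finset.single_le_sum (f := fun i => (y i - x (σ i)).toNat) (fun _ _ => Nat.zero_le _)
      (Finset.mem_univ i)
  · push Not at hσ
    obtain ⟨i, hi⟩ := hσ
    rw [Finset.prod_eq_zero (Finset.mem_univ i) (coeffInt_of_neg H' hi),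
      Finset.prod_eq_zero (Finset.mem_univ i) (coeffInt_of_neg H hi), mul_zero]

theorem sum_pos (lam : YoungDiagram) {n : ℕ} (hn : lam.colLen 0 ≤ n) :
    ∑ i : Fin n, pos lam i = ∑ i : Fin n, (i : ℤ) - lam.card := by
  simp only [pos]
  rw [Finset.sum_sub_distrib, card_eq_sum_rowLen lam hn, Finset.sum_range]
  push_cast
  rfl

theorem sk_eq_pow_mul (H H' : R⟦X⟧) (a : R) {lam mu : YoungDiagram} (hle : mu ≤ lam)
    (h : ∀ m ≤ lam.card - mu.card, coeff m H' = a ^ m * coeff m H) :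
    sk H' lam mu = a ^ (lam.card - mu.card) * sk H lam mu := by
  refine minor_eq_pow_mul H H' a _ _ _ ?_ h
  rw [sum_pos lam le_rfl, sum_pos mu (colLen_mono hle)]
  have := card_mono hle
  push_cast [this]
  ring

theorem sk_congr {H H' : R⟦X⟧} {lam mu : YoungDiagram} (hle : mu ≤ lam)
    (h : ∀ m ≤ lam.card - mu.card, coeff m H' = coeff m H) : sk H' lam mu = sk H lam mu := by
  rw [sk_eq_pow_mul H H' 1 hle fun m hm => by rw [h m hm]; ring, one_pow, one_mul]

theorem minor_pos_eq_zero (H : R⟦X⟧) {lam mu : YoungDiagram} {n : ℕ} (hmu : mu.colLen 0 ≤ n)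
    (hle : ¬ mu ≤ lam) :
    minor H (fun i : Fin n => pos lam i) (fun i : Fin n => pos mu i) = 0 := by
  rw [le_iff_rowLen_le] at hle
  push Not at hle
  obtain ⟨k, hk⟩ := hle
  have hkn : k < n := by
    by_contra h
    rw [rowLen_eq_zero (hmu.trans (not_lt.1 h))] at hk
    omega
  refine minor_eq_zero H _ _ (fun i j h => (strictMono_pos lam).monotone h)
    (fun i j h => (strictMono_pos mu).monotone h) ⟨k, hkn⟩ ?_
  simp only [pos]
  omega

theorem sk_self (H : R⟦X⟧) (hH : constantCoeff H = 1) (lam : YoungDiagram) : sk H lam lam = 1 := by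
  have h := sk_eq_pow_mul (1 : R⟦X⟧) H 1 (le_refl lam) (by
    intro m hm
    obtain rfl : m = 0 := by omega
    simpa using hH)
  rw [h, one_pow, one_mul, sk, minor]
  convert Matrix.det_one (n := Fin (lam.colLen 0)) (R := R)
  ext i j
  rw [Matrix.of_apply, Matrix.one_apply]
  by_cases hij : i = j
  · subst hij
    simpa using coeffInt_natCast (1 : R⟦X⟧) 0
  · rw [if_neg hij, coeffInt]
    split_ifs with h0
    · rw [coeff_one, if_neg]
      have : pos lam i ≠ pos lam j := fun h => hij (Fin.ext ((strictMono_pos lam).injective h))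
      omega
    · rfl

/-- The Cauchy–Binet formula for Toeplitz minors. -/
theorem minor_mul (H H' : R⟦X⟧) {n : ℕ} (x y : Fin n → ℤ) (S : Finset ℤ)
    (hS : ∀ i j z, x i ≤ z → z ≤ y j → z ∈ S) :
    minor (H * H') x y = ∑ z ∈ (Fintype.piFinset fun _ : Fin n => S) with StrictMono z,
      minor H x z * minor H' z y := by
  classical
  have hentry : ∀ i j, coeffInt (H * H') (y j - x i) =
      ∑ z ∈ S, coeffInt H (z - x i) * coeffInt H' (y j - z) := by
    intro i j
    by_cases h : 0 ≤ y j - x i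
    · rw [coeffInt, if_pos h, coeff_mul]
      refine Finset.sum_of_injOn (fun p : ℕ × ℕ => x i + (p.1 : ℤ)) ?_ ?_ ?_ ?_
      · rintro ⟨a, b⟩ hab ⟨c, d⟩ hcd he
        simp only [Finset.mem_coe, HasAntidiagonal.mem_antidiagonal] at hab hcd he
        rw [Prod.mk.injEq]
        omega
      · rintro ⟨a, b⟩ hab
        simp only [Finset.mem_coe, HasAntidiagonal.mem_antidiagonal] at hab ⊢
        exact hS i j _ (by omega) (by omega)
      · intro z _ hz
        by_cases h1 : z - x i < 0
        · rw [coeffInt_of_neg _ h1, zero_mul]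
        · by_cases h2 : y j - z < 0
          · rw [coeffInt_of_neg H' h2, mul_zero]
          · exact absurd ⟨((z - x i).toNat, (y j - z).toNat), by
              simp only [Finset.mem_coe, HasAntidiagonal.mem_antidiagonal]; omega, by simp only; omega⟩ hz
      · rintro ⟨a, b⟩ hab
        rw [HasAntidiagonal.mem_antidiagonal] at hab
        simp only at hab ⊢
        rw [show x i + (a : ℤ) - x i = (a : ℕ) by ring, coeffInt_natCast,
          show y j - (x i + (a : ℤ)) = (b : ℕ) by omega, coeffInt_natCast]
    · rw [coeffInt_of_neg _ (by omega), Finset.sum_eq_zero]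
      intro z _
      by_cases h1 : z - x i < 0
      · rw [coeffInt_of_neg _ h1, zero_mul]
      · rw [coeffInt_of_neg H' (by omega), mul_zero]
  -- expand the determinant row by row
  have hexp : minor (H * H') x y = ∑ f ∈ Fintype.piFinset fun _ : Fin n => S,
      (∏ i, coeffInt H (f i - x i)) * minor H' f y := by
    have h1 : (Matrix.of fun i j => coeffInt (H * H') (y j - x i)) =
        fun i => ∑ z ∈ S, coeffInt H (z - x i) • fun j => coeffInt H' (y j - z) := by
      ext i j
      simp [hentry]
    rw [minor, h1]
    change (Matrix.detRowAlternating (n := Fin n) (R := R)).toMultilinearMap _ = _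
    rw [MultilinearMap.map_sum_finset]
    refine Finset.sum_congr rfl fun f _ => ?_
    rw [MultilinearMap.map_smul_univ]
    rfl
  have hperm : ∀ (z : Fin n → ℤ) (σ : Equiv.Perm (Fin n)),
      minor H' (z ∘ σ) y = (Equiv.Perm.sign σ : ℤ) • minor H' z y := by
    intro z σ
    have := Matrix.det_permute σ (Matrix.of fun i j => coeffInt H' (y j - z i))
    rw [zsmul_eq_mul]
    exact this
  have hinj : ∀ f : Fin n → ℤ, ¬ Function.Injective f → minor H' f y = 0 := by
    intro f hf
    rw [Function.Injective] at hf
    push Not at hf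
    obtain ⟨i, j, hij, hne⟩ := hf
    exact Matrix.det_zero_of_row_eq hne (by ext k; simp [hij])
  rw [hexp, ← Finset.sum_filter_of_ne (p := fun f => Function.Injective f)
    (fun f _ hne => by
      by_contra hf
      exact hne (by rw [hinj f hf, mul_zero]))]
  have hrhs : ∀ z : Fin n → ℤ, minor H x z * minor H' z y =
      ∑ σ : Equiv.Perm (Fin n),
        (∏ i, coeffInt H ((z ∘ σ) i - x i)) * minor H' (z ∘ σ) y := by
    intro z
    rw [minor, ← Matrix.det_transpose, Matrix.det_apply, Finset.sum_mul]
    refine Finset.sum_congr rfl fun σ _ => ?_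
    rw [hperm z σ, mul_smul_comm, smul_mul_assoc]
    rfl
  simp_rw [hrhs]
  rw [← Finset.sum_product']
  symm
  refine Finset.sum_bij (fun p _ => p.1 ∘ p.2) ?_ ?_ ?_ ?_
  · rintro ⟨z, σ⟩ h
    simp only [mem_product, mem_filter, Fintype.mem_piFinset, mem_univ, and_true] at h ⊢
    exact ⟨fun i => h.1 _, h.2.injective.comp σ.injective⟩
  · rintro ⟨z, σ⟩ h ⟨z', σ'⟩ h' heq
    simp only [mem_product, mem_filter, mem_univ, and_true] at h h' heq
    have hr : Set.range z = Set.range z' := by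
      rw [← σ.surjective.range_comp z, heq, σ'.surjective.range_comp]
    obtain rfl : z = z' := (h.2.range_inj h'.2).1 hr
    congr 1
    ext i
    exact congrArg Fin.val (h.2.injective (congrFun heq i))
  · intro f hf
    simp only [mem_filter, Fintype.mem_piFinset] at hf
    refine ⟨(f ∘ Tuple.sort f, (Tuple.sort f)⁻¹), ?_, ?_⟩
    · simp only [mem_product, mem_filter, Fintype.mem_piFinset, mem_univ, and_true]
      exact ⟨fun i => hf.1 _, (Tuple.monotone_sort f).strictMono_of_injective
        (hf.2.comp (Tuple.sort f).injective)⟩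
    · ext i
      simp
  · rintro ⟨z, σ⟩ _
    rfl

/-- The branching rule `s_{lam/mu}(ρ ∪ ρ') = ∑ s_{lam/nu}(ρ) s_{nu/mu}(ρ')`. -/
theorem sk_mul (H H' : R⟦X⟧) (hH : constantCoeff H = 1) (hH' : constantCoeff H' = 1)
    {lam mu : YoungDiagram} (hle : mu ≤ lam) :
    sk (H * H') lam mu = ∑ nu ∈ between mu lam, sk H lam nu * sk H' nu mu := by
  classical
  set n := lam.colLen 0 with hn
  rw [sk, minor_mul H H' _ _ (Finset.Icc (pos lam 0) (n - 1))]
  · symm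
    refine Finset.sum_of_injOn (fun nu => fun i : Fin n => pos nu i) ?_ ?_ ?_ ?_
    · intro nu h nu' h' heq
      simp only [Finset.mem_coe, mem_between] at h h'
      refine ext_rowLen fun i => ?_
      by_cases hi : i < n
      · have := congrFun heq ⟨i, hi⟩
        simp only [pos] at this
        omega
      · rw [rowLen_eq_zero ((colLen_mono h.2).trans (not_lt.1 hi)),
          rowLen_eq_zero ((colLen_mono h'.2).trans (not_lt.1 hi))]
    · intro nu h
      simp only [Finset.mem_coe, mem_between] at h
      simp only [Finset.coe_filter, Set.mem_ofPred_eq, Fintype.mem_piFinset, Finset.mem_Icc]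
      refine ⟨fun i => ⟨?_, ?_⟩, fun i j hij => strictMono_pos nu hij⟩
      · have h1 := le_iff_rowLen_le.1 h.2 0
        have h2 := nu.rowLen_anti 0 i (Nat.zero_le _)
        simp only [pos]
        omega
      · have := i.2
        simp only [pos]
        omega
    · intro z hz hnot
      simp only [mem_filter, Fintype.mem_piFinset, Finset.mem_Icc] at hz
      obtain ⟨hz1, hz2⟩ := hz
      -- a strictly increasing sequence bounded by `n - 1` comes from a Young diagram
      have hle' : ∀ i : Fin n, z i ≤ i := by
        intro i
        have key : ∀ m : ℕ, ∀ i : Fin n, (i : ℕ) + m = n - 1 → z i ≤ i := by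
          intro m
          induction m with
          | zero => intro i hi; have := (hz1 i).2; have := i.2; omega
          | succ m ih =>
            intro i hi
            have h1 := ih ⟨i + 1, by omega⟩ (by simp only; omega)
            have h2 : z i < z ⟨i + 1, by omega⟩ := hz2 (Fin.mk_lt_mk.2 (Nat.lt_succ_self _))
            simp only at h1
            push_cast at h1
            omega
        exact key (n - 1 - i) i (by have := i.2; omega)
      let f : ℕ → ℕ := fun i => if h : i < n then ((i : ℤ) - z ⟨i, h⟩).toNat else 0
      have hf : Antitone f := by
        refine antitone_nat_of_succ_le fun i => ?_
        simp only [f]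
        by_cases h1 : i + 1 < n
        · rw [dif_pos h1, dif_pos (by omega)]
          have h2 : z ⟨i, by omega⟩ < z ⟨i + 1, h1⟩ := hz2 (Fin.mk_lt_mk.2 (Nat.lt_succ_self _))
          push_cast
          omega
        · rw [dif_neg h1]
          exact Nat.zero_le _
      have hfn : f n = 0 := by simp [f]
      set nu := ofRows f hf n hfn with hnu
      have hpos : (fun i : Fin n => pos nu i) = z := by
        ext i
        have := hle' i
        simp only [pos, hnu, rowLen_ofRows, f, i.2, dif_pos, Fin.eta]
        omega
      have hnun : nu.colLen 0 ≤ n := colLen_le_of_rowLen_eq_zero (by rw [hnu, rowLen_ofRows, hfn])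
      by_cases h1 : nu ≤ lam
      · by_cases h2 : mu ≤ nu
        · exact absurd ⟨nu, by simp [h1, h2], hpos⟩ hnot
        · rw [← hpos, minor_pos_eq_zero H' (colLen_mono hle) h2, mul_zero]
      · rw [← hpos, minor_pos_eq_zero H hnun h1, zero_mul]
    · intro nu h
      rw [mem_between] at h
      rw [minor_eq_sk H' hH' h.1 (colLen_mono h.2), minor_eq_sk H hH h.2 le_rfl]
  · intro i j z h1 h2
    rw [Finset.mem_Icc]
    have h3 := (strictMono_pos lam).monotone (Nat.zero_le i)
    have := j.2
    simp only [pos] at h1 h2 h3 ⊢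
    omega

/-- `mu` interlaces with `lam`, that is, `lam/mu` is a horizontal strip. -/
def IsStrip (lam mu : YoungDiagram) : Prop :=
  ∀ i, mu.rowLen i ≤ lam.rowLen i ∧ lam.rowLen (i + 1) ≤ mu.rowLen i

theorem IsStrip.le {lam mu : YoungDiagram} (h : IsStrip lam mu) : mu ≤ lam :=
  le_iff_rowLen_le.2 fun i => (h i).1

open Classical in
/-- In a single variable, only horizontal strips contribute. -/
theorem sk_single (x : R) {lam mu : YoungDiagram} (hle : mu ≤ lam) :
    sk (PowerSeries.mk fun n => x ^ n) lam mu =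
      if IsStrip lam mu then x ^ (lam.card - mu.card) else 0 := by
  set H : R⟦X⟧ := PowerSeries.mk fun n => x ^ n with hH
  have hc : ∀ n : ℤ, 0 ≤ n → coeffInt H n = x ^ n.toNat := by
    intro n hn
    rw [coeffInt, if_pos hn, hH, coeff_mk]
  have hle' := le_iff_rowLen_le.1 hle
  split_ifs with hs
  · -- the matrix is upper triangular
    rw [sk, minor, Matrix.det_of_isUpperTriangular]
    · have : ∀ i : Fin (lam.colLen 0), (Matrix.of fun i j : Fin (lam.colLen 0) =>
          coeffInt H (pos mu j - pos lam i)) i i = x ^ (lam.rowLen i - mu.rowLen i) := by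
        intro i
        have := hle' i
        rw [Matrix.of_apply, hc _ (by simp only [pos]; omega)]
        congr 1
        simp only [pos]
        omega
      rw [Finset.prod_congr rfl fun i _ => this i, Finset.prod_pow_eq_pow_sum,
        card_eq_sum_rowLen lam le_rfl, card_eq_sum_rowLen mu (colLen_mono hle),
        ← Finset.sum_tsub_distrib _ (fun i _ => hle' i), Finset.sum_range]
    · intro i j hij
      have hij' : (j : ℕ) < i := hij
      rw [Matrix.of_apply, coeffInt_of_neg]
      have h1 := (hs j).2
      have h2 := (strictMono_pos lam).monotone (show (j : ℕ) + 1 ≤ i by omega)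
      simp only [pos] at h2 ⊢
      push_cast at h2
      omega
  · -- at the first violation of interlacing, two consecutive rows are proportional
    have hex : ∃ i, mu.rowLen i < lam.rowLen (i + 1) := by
      by_contra! h
      exact hs fun i => ⟨hle' i, h i⟩
    let i := Nat.find hex
    have hi : mu.rowLen i < lam.rowLen (i + 1) := Nat.find_spec hex
    have hmin : ∀ j < i, lam.rowLen (j + 1) ≤ mu.rowLen j :=
      fun j hj => not_lt.1 (Nat.find_min hex hj)
    have hin : i + 1 < lam.colLen 0 := by
      by_contra h
      rw [rowLen_eq_zero (not_lt.1 h)] at hi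
      omega
    set M : Matrix (Fin (lam.colLen 0)) (Fin (lam.colLen 0)) R :=
      Matrix.of fun i j => coeffInt H (pos mu j - pos lam i) with hM
    let a : Fin (lam.colLen 0) := ⟨i, by omega⟩
    let b : Fin (lam.colLen 0) := ⟨i + 1, hin⟩
    have hne : a ≠ b := by simp [a, b]
    have hp : pos lam i < pos lam (i + 1) := strictMono_pos lam (Nat.lt_succ_self i)
    have hrow : M a = x ^ (pos lam (i + 1) - pos lam i).toNat • M b := by
      ext j
      simp only [hM, Matrix.of_apply, Pi.smul_apply, smul_eq_mul, a, b]
      by_cases hj : (j : ℕ) < i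
      · have h1 := hmin j hj
        have h2 := (strictMono_pos lam).monotone (show (j : ℕ) + 1 ≤ i by omega)
        rw [coeffInt_of_neg, coeffInt_of_neg, mul_zero]
        all_goals
          simp only [pos] at h2 hp ⊢
          push_cast at h2 hp ⊢
          omega
      · have h1 := (strictMono_pos mu).monotone (not_lt.1 hj)
        have h2 : 0 ≤ pos mu j - pos lam (i + 1) := by
          simp only [pos] at h1 ⊢
          push_cast
          omega
        rw [hc _ h2, hc _ (by omega), ← pow_add]
        congr 1
        omega
    have hup : M = M.updateRow a (x ^ (pos lam (i + 1) - pos lam i).toNat • M b) := by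
      rw [← hrow, Matrix.updateRow_eq_self]
    change M.det = 0
    rw [hup, Matrix.det_updateRow_smul, Matrix.det_zero_of_row_eq hne, mul_zero]
    rw [Matrix.updateRow_self, Matrix.updateRow_ne hne.symm]

end FreeBoundarySchur

/-! ### The local bijection between interlacing diagrams -/

namespace FreeBoundarySchur

section Finsum

variable {A : Type*} [CommRing A]

theorem finsum_eq_finsum_subtype {α M : Type*} [AddCommMonoid M] {f : α → M} {s : Set α}
    (h : Function.support f ⊆ s) : ∑ᶠ i, f i = ∑ᶠ i : s, f i := by
  rw [finsum_set_coe_eq_finsum_mem, ← finsum_mem_univ]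
  exact finsum_mem_inter_support_eq' f _ _ fun x hx => by simp [h hx]

theorem finite_support_mul_prod {α β : Type*} {f : α → A} {g : β → A}
    (hf : (Function.support f).Finite) (hg : (Function.support g).Finite) :
    (Function.support fun p : α × β => f p.1 * g p.2).Finite := by
  refine (hf.prod hg).subset fun p hp => ⟨fun h => hp ?_, fun h => hp ?_⟩
  · simp only [h, zero_mul]
  · simp only [h, mul_zero]

theorem finsum_prod_mul {α β : Type*} {f : α → A} {g : β → A}
    (hf : (Function.support f).Finite) (hg : (Function.support g).Finite) :
    ∑ᶠ p : α × β, f p.1 * g p.2 = (∑ᶠ a, f a) * ∑ᶠ b, g b := by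
  rw [finsum_curry _ (finite_support_mul_prod hf hg), finsum_mul' _ _ hf]
  exact finsum_congr fun a => (mul_finsum' g (f a) hg).symm

theorem finite_support_pow {x : A} (hx : IsNilpotent x) :
    (Function.support fun k : ℕ => x ^ k).Finite := by
  obtain ⟨K, hK⟩ := hx
  refine (Set.finite_lt_nat K).subset fun k hk => ?_
  by_contra h
  exact hk (pow_eq_zero_of_le (not_lt.1 h) hK)

theorem finite_support_pow_card {x : A} (hx : IsNilpotent x) (c : YoungDiagram → A) :
    (Function.support fun lam : YoungDiagram => c lam * x ^ lam.card).Finite := by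
  obtain ⟨K, hK⟩ := hx
  refine (finite_card_le K).subset fun lam hlam => ?_
  by_contra h
  refine hlam ?_
  simp only
  rw [pow_eq_zero_of_le (le_of_not_ge h) hK, mul_zero]

end Finsum

/-- The row lengths of the lower diagram in the local rule. -/
def lowerRows (lam mu nu : YoungDiagram) (i : ℕ) : ℕ :=
  min (lam.rowLen i) (mu.rowLen i) + max (lam.rowLen (i + 1)) (mu.rowLen (i + 1)) -
    nu.rowLen (i + 1)

/-- The row lengths of the upper diagram in the local rule. -/
def upperRows (lam mu kappa : YoungDiagram) (k : ℕ) : ℕ → ℕ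
  | 0 => max (lam.rowLen 0) (mu.rowLen 0) + k
  | i + 1 => min (lam.rowLen i) (mu.rowLen i) + max (lam.rowLen (i + 1)) (mu.rowLen (i + 1)) -
      kappa.rowLen i

theorem antitone_lowerRows {lam mu nu : YoungDiagram} (h : IsStrip nu lam) (h' : IsStrip nu mu) :
    Antitone (lowerRows lam mu nu) := by
  refine antitone_nat_of_succ_le fun i => ?_
  have := h i
  have := h' i
  have := h (i + 1)
  have := h' (i + 1)
  have := h (i + 1 + 1)
  have := h' (i + 1 + 1)
  simp only [lowerRows]
  omega

theorem lowerRows_eq_zero {lam mu nu : YoungDiagram} :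
    lowerRows lam mu nu (max (lam.colLen 0) (mu.colLen 0)) = 0 := by
  rw [lowerRows, rowLen_eq_zero (le_max_left _ _), rowLen_eq_zero (lam := lam) (by omega),
    rowLen_eq_zero (lam := mu) (i := _ + 1) (by omega)]
  omega

theorem antitone_upperRows {lam mu kappa : YoungDiagram} (k : ℕ) (h : IsStrip lam kappa)
    (h' : IsStrip mu kappa) : Antitone (upperRows lam mu kappa k) := by
  refine antitone_nat_of_succ_le fun i => ?_
  cases i with
  | zero =>
    have := h 0
    have := h' 0
    simp only [upperRows]
    omega
  | succ i =>
    have := h i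
    have := h' i
    have := h (i + 1)
    have := h' (i + 1)
    simp only [upperRows]
    omega

theorem upperRows_eq_zero {lam mu kappa : YoungDiagram} (k : ℕ) :
    upperRows lam mu kappa k (max (lam.colLen 0) (mu.colLen 0) + 1) = 0 := by
  rw [upperRows, rowLen_eq_zero (le_max_left _ _), rowLen_eq_zero (lam := lam) (by omega),
    rowLen_eq_zero (lam := mu) (i := _ + 1) (by omega)]
  omega

/-- Diagrams interlacing from above with both `lam` and `mu` correspond to pairs of a natural
number and a diagram interlacing from below with both. In each corner the interval of allowed
values of `nu_{i+1}` is the interval of allowed values of `kappa_i`, and it is reversed. -/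
noncomputable def localRule (lam mu : YoungDiagram) :
    {nu : YoungDiagram | IsStrip nu lam ∧ IsStrip nu mu} ≃
      ℕ × {kappa : YoungDiagram | IsStrip lam kappa ∧ IsStrip mu kappa} where
  toFun nu :=
    (nu.1.rowLen 0 - max (lam.rowLen 0) (mu.rowLen 0),
      ⟨ofRows (lowerRows lam mu nu.1) (antitone_lowerRows nu.2.1 nu.2.2) _ lowerRows_eq_zero, by
      constructor
      all_goals
        intro i
        rw [rowLen_ofRows, lowerRows]
        have := nu.2.1 (i + 1)
        have := nu.2.2 (i + 1)
        have := nu.2.1 i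
        have := nu.2.2 i
        omega⟩)
  invFun p :=
    ⟨ofRows (upperRows lam mu p.2.1 p.1) (antitone_upperRows p.1 p.2.2.1 p.2.2.2) _
        (upperRows_eq_zero p.1), by
      constructor
      all_goals
        intro i
        rw [rowLen_ofRows, rowLen_ofRows]
        have := p.2.2.1 i
        have := p.2.2.2 i
        cases i with
        | zero => simp only [upperRows]; omega
        | succ i =>
          have := p.2.2.1 i
          have := p.2.2.2 i
          simp only [upperRows]
          omega⟩
  left_inv nu := by
    refine Subtype.ext (ext_rowLen fun i => ?_)
    rw [rowLen_ofRows]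
    cases i with
    | zero =>
      have := nu.2.1 0
      have := nu.2.2 0
      simp only [upperRows]
      omega
    | succ i =>
      have := nu.2.1 (i + 1)
      have := nu.2.2 (i + 1)
      have := nu.2.1 i
      have := nu.2.2 i
      simp only [upperRows, rowLen_ofRows, lowerRows]
      omega
  right_inv p := by
    refine Prod.ext ?_ (Subtype.ext (ext_rowLen fun i => ?_))
    · simp only [rowLen_ofRows, upperRows]
      omega
    · have := p.2.2.1 i
      have := p.2.2.2 i
      simp only [rowLen_ofRows, upperRows, lowerRows]
      omega

theorem card_localRule (lam mu : YoungDiagram)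
    (nu : {nu : YoungDiagram | IsStrip nu lam ∧ IsStrip nu mu}) :
    nu.1.card + (localRule lam mu nu).2.1.card =
      (localRule lam mu nu).1 + lam.card + mu.card := by
  set n := max (lam.colLen 0) (mu.colLen 0) with hn
  have hnu : nu.1.colLen 0 ≤ n + 1 := by
    apply colLen_le_of_rowLen_eq_zero
    have := (nu.2.1 n).2
    rw [rowLen_eq_zero (le_max_left _ _)] at this
    omega
  have hk : (localRule lam mu nu).2.1.colLen 0 ≤ n :=
    (colLen_mono ((localRule lam mu nu).2.2.1).le).trans (le_max_left _ _)
  rw [card_eq_sum_rowLen nu.1 hnu, card_eq_sum_rowLen _ hk,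
    card_eq_sum_rowLen lam (n := n + 1) (by omega), card_eq_sum_rowLen mu (n := n) (le_max_right _ _),
    Finset.sum_range_succ', Finset.sum_range_succ']
  have h0 : nu.1.rowLen 0 = max (lam.rowLen 0) (mu.rowLen 0) + (localRule lam mu nu).1 := by
    have h := nu.2.1 0
    have h' := nu.2.2 0
    simp only [localRule, Equiv.coe_fn_mk]
    omega
  have h1 : ∀ i ∈ Finset.range n, nu.1.rowLen (i + 1) + (localRule lam mu nu).2.1.rowLen i =
      min (lam.rowLen i) (mu.rowLen i) + max (lam.rowLen (i + 1)) (mu.rowLen (i + 1)) := by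
    intro i _
    have h1 := nu.2.1 (i + 1)
    have h1' := nu.2.2 (i + 1)
    have h := nu.2.1 i
    have h' := nu.2.2 i
    simp only [localRule, Equiv.coe_fn_mk, rowLen_ofRows, lowerRows]
    omega
  have h2 := Finset.sum_congr rfl h1
  rw [Finset.sum_add_distrib, Finset.sum_add_distrib] at h2
  have h3 : ∑ i ∈ Finset.range n, min (lam.rowLen i) (mu.rowLen i) +
      ∑ i ∈ Finset.range n, max (lam.rowLen i) (mu.rowLen i) =
      ∑ i ∈ Finset.range n, lam.rowLen i + ∑ i ∈ Finset.range n, mu.rowLen i := by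
    rw [← Finset.sum_add_distrib, ← Finset.sum_add_distrib]
    exact Finset.sum_congr rfl fun i _ => min_add_max _ _
  have h4 := Finset.sum_range_succ (fun i => max (lam.rowLen i) (mu.rowLen i)) n
  rw [Finset.sum_range_succ', rowLen_eq_zero (lam := lam) (i := n) (by omega),
    rowLen_eq_zero (lam := mu) (i := n) (by omega)] at h4
  have h5 := Finset.sum_range_succ (fun i => lam.rowLen i) n
  rw [Finset.sum_range_succ', rowLen_eq_zero (lam := lam) (i := n) (by omega)] at h5
  omega

variable {A : Type*} [CommRing A]

open Classical in
/-- The value at the single variable `x` of the skew Schur function of `lam/mu`. -/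
noncomputable def stripTerm (x : A) (lam mu : YoungDiagram) : A :=
  if IsStrip lam mu then x ^ (lam.card - mu.card) else 0

theorem stripTerm_of_not {x : A} {lam mu : YoungDiagram} (h : ¬ IsStrip lam mu) :
    stripTerm x lam mu = 0 := if_neg h

theorem stripTerm_of {x : A} {lam mu : YoungDiagram} (h : IsStrip lam mu) :
    stripTerm x lam mu = x ^ (lam.card - mu.card) := if_pos h

/-- The skew Cauchy identity in one variable on each side. -/
theorem finsum_stripTerm_mul {x : A} (y : A) (hx : IsNilpotent x) (lam mu : YoungDiagram) :
    ∑ᶠ nu, stripTerm x nu mu * stripTerm y nu lam =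
      (∑ᶠ k : ℕ, (x * y) ^ k) * ∑ᶠ kappa, stripTerm x lam kappa * stripTerm y mu kappa := by
  have hsub : (Function.support fun kappa => stripTerm x lam kappa * stripTerm y mu kappa) ⊆
      {kappa : YoungDiagram | IsStrip lam kappa ∧ IsStrip mu kappa} := by
    intro kappa h
    constructor
    · by_contra h'
      exact h (by simp only [stripTerm_of_not h', zero_mul])
    · by_contra h'
      exact h (by simp only [stripTerm_of_not h', mul_zero])
  have hfin : {kappa : YoungDiagram | IsStrip lam kappa ∧ IsStrip mu kappa}.Finite :=
    (finite_Iic lam).subset fun kappa h => h.1.le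
  have := hfin.to_subtype
  rw [finsum_eq_finsum_subtype hsub,
    finsum_eq_finsum_subtype (s := {nu : YoungDiagram | IsStrip nu lam ∧ IsStrip nu mu}),
    ← finsum_prod_mul, ← finsum_comp_equiv (localRule lam mu)]
  · refine finsum_congr fun nu => ?_
    have hcard := card_localRule lam mu nu
    have h1 := card_mono nu.2.1.le
    have h2 := card_mono nu.2.2.le
    have h3 := card_mono (localRule lam mu nu).2.2.1.le
    have h4 := card_mono (localRule lam mu nu).2.2.2.le
    rw [stripTerm_of nu.2.2, stripTerm_of nu.2.1, stripTerm_of (localRule lam mu nu).2.2.1,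
      stripTerm_of (localRule lam mu nu).2.2.2, mul_pow, mul_mul_mul_comm, ← pow_add, ← pow_add]
    congr 2 <;> omega
  · exact finite_support_pow ((Commute.all x y).isNilpotent_mul_right hx)
  · exact Set.toFinite _
  · intro nu h
    constructor
    · by_contra h'
      exact h (by simp only [stripTerm_of_not h', mul_zero])
    · by_contra h'
      exact h (by simp only [stripTerm_of_not h', zero_mul])

/-- The skew Littlewood identity in one variable. -/
theorem finsum_stripTerm {x : A} (hx : IsNilpotent x) (mu : YoungDiagram) :
    ∑ᶠ nu, stripTerm x nu mu = (∑ᶠ k : ℕ, x ^ k) * ∑ᶠ kappa, stripTerm x mu kappa := by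
  have h := finsum_stripTerm_mul 1 hx mu mu
  rw [mul_one] at h
  have h1 : ∀ lam mu : YoungDiagram, stripTerm x lam mu * stripTerm 1 lam mu =
      stripTerm x lam mu := by
    intro lam mu
    by_cases hs : IsStrip lam mu
    · rw [stripTerm_of hs, stripTerm_of hs, one_pow, mul_one]
    · rw [stripTerm_of_not hs, zero_mul]
  simp only [h1] at h
  exact h

/-! ### The generating function of partitions -/

/-- A diagram with at most `m + 1` rows is a number of full columns next to a diagram with at most
`m` rows. -/
noncomputable def fullColumns (m : ℕ) :
    {lam : YoungDiagram | lam.colLen 0 ≤ m + 1} ≃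
      ℕ × {lam : YoungDiagram | lam.colLen 0 ≤ m} where
  toFun lam := (lam.1.rowLen m, ⟨ofRows (fun i => lam.1.rowLen i - lam.1.rowLen m)
    (show Antitone _ from fun i j h => Nat.sub_le_sub_right (lam.1.rowLen_anti i j h) _)
    m (Nat.sub_self _),
    colLen_le_of_rowLen_eq_zero ((rowLen_ofRows _ _ _ _ _).trans (Nat.sub_self _))⟩)
  invFun p := ⟨ofRows (fun i => if i ≤ m then p.2.1.rowLen i + p.1 else 0)
    (show Antitone _ from fun i j h => by
      have := p.2.1.rowLen_anti i j h
      split_ifs <;> omega) (m + 1) (if_neg (by omega)),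
    colLen_le_of_rowLen_eq_zero ((rowLen_ofRows _ _ _ _ _).trans (if_neg (by omega)))⟩
  left_inv lam := by
    refine Subtype.ext (ext_rowLen fun i => ?_)
    simp only [rowLen_ofRows]
    split_ifs with h
    · have := lam.1.rowLen_anti i m h
      omega
    · have h1 : lam.1.colLen 0 ≤ m + 1 := lam.2
      rw [rowLen_eq_zero (by omega)]
  right_inv p := by
    have h1 : p.2.1.colLen 0 ≤ m := p.2.2
    refine Prod.ext ?_ (Subtype.ext (ext_rowLen fun i => ?_))
    · simp only [rowLen_ofRows, le_refl, if_true]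
      rw [rowLen_eq_zero h1, zero_add]
    · simp only [rowLen_ofRows, le_refl, if_true]
      rw [rowLen_eq_zero h1]
      split_ifs with h
      · omega
      · rw [rowLen_eq_zero (by omega)]
        omega

theorem card_fullColumns (m : ℕ) (lam : {lam : YoungDiagram | lam.colLen 0 ≤ m + 1}) :
    lam.1.card = (m + 1) * (fullColumns m lam).1 + (fullColumns m lam).2.1.card := by
  have h1 : lam.1.colLen 0 ≤ m + 1 := lam.2
  have h2 : (fullColumns m lam).2.1.colLen 0 ≤ m := (fullColumns m lam).2.2
  rw [card_eq_sum_rowLen lam.1 h1, card_eq_sum_rowLen _ (h2.trans (Nat.le_succ m))]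
  have : ∀ i ∈ Finset.range (m + 1), lam.1.rowLen i =
      (fullColumns m lam).1 + (fullColumns m lam).2.1.rowLen i := by
    intro i hi
    have := lam.1.rowLen_anti i m (by simpa [Nat.lt_succ_iff] using hi)
    simp only [fullColumns, Equiv.coe_fn_mk, rowLen_ofRows]
    omega
  rw [Finset.sum_congr rfl this, Finset.sum_add_distrib, Finset.sum_const, Finset.card_range,
    smul_eq_mul]

/-- The generating function of partitions, at a nilpotent argument. -/
theorem finsum_pow_card {q : A} {M : ℕ} (hq : q ^ M = 0) :
    ∑ᶠ lam : YoungDiagram, q ^ lam.card =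
      ∏ n ∈ Finset.range M, ∑ᶠ k : ℕ, (q ^ (n + 1)) ^ k := by
  have hnil : IsNilpotent q := ⟨M, hq⟩
  have key : ∀ m : ℕ, ∑ᶠ lam : {lam : YoungDiagram | lam.colLen 0 ≤ m}, q ^ lam.1.card =
      ∏ n ∈ Finset.range m, ∑ᶠ k : ℕ, (q ^ (n + 1)) ^ k := by
    intro m
    induction m with
    | zero =>
      rw [Finset.prod_range_zero, finsum_eq_single _ ⟨⊥, by simp⟩]
      · simp
      · rintro ⟨lam, hlam⟩ hne
        refine absurd (Subtype.ext (ext_rowLen fun i => ?_)) hne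
        have h1 : lam.colLen 0 ≤ 0 := hlam
        change lam.rowLen i = _
        rw [rowLen_eq_zero (by omega), rowLen_bot]
    | succ m ih =>
      rw [Finset.prod_range_succ, ← ih, mul_comm, ← finsum_prod_mul,
        ← finsum_comp_equiv (fullColumns m)]
      · refine finsum_congr fun lam => ?_
        rw [card_fullColumns, pow_add, pow_mul]
      · exact finite_support_pow (hnil.pow_succ m)
      · have := (finite_support_pow_card hnil fun _ => 1).preimage
          (Subtype.val_injective (p := fun lam : YoungDiagram => lam.colLen 0 ≤ m)).injOn
        simp only [one_mul] at this
        exact this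
  rw [← key M]
  refine finsum_eq_finsum_subtype fun lam hlam => ?_
  by_contra h
  refine hlam ?_
  have h1 : ¬ lam.colLen 0 ≤ M := h
  refine pow_eq_zero_of_le ?_ hq
  -- a diagram with more than `M` rows has more than `M` cells
  rw [card_eq_sum_rowLen lam le_rfl]
  calc M ≤ ∑ i ∈ Finset.range (lam.colLen 0), 1 := by simp; omega
    _ ≤ _ := Finset.sum_le_sum fun i hi => by
      have : (i, 0) ∈ lam := YoungDiagram.mem_iff_lt_colLen.2 (Finset.mem_range.1 hi)
      exact YoungDiagram.mem_iff_lt_rowLen.1 this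

end FreeBoundarySchur

/-! ### Vertex operators with nilpotent arguments -/

namespace FreeBoundarySchur

open PowerSeries

variable {A : Type*} [CommRing A]

open Classical in
/-- A finitely supported function, as a formal combination of Young diagrams; zero if the support
is infinite. -/
noncomputable def vec (f : YoungDiagram → A) : YoungDiagram →₀ A :=
  if h : (Function.support f).Finite then Finsupp.ofSupportFinite f h else 0

theorem vec_apply {f : YoungDiagram → A} (h : (Function.support f).Finite) (lam : YoungDiagram) :
    vec f lam = f lam := by
  rw [vec, dif_pos h]
  rfl

/-- The operator whose matrix is `f`; only meaningful if the columns of `f` are finitely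
supported. -/
noncomputable def matOp (f : YoungDiagram → YoungDiagram → A) :
    Module.End A (YoungDiagram →₀ A) :=
  Finsupp.linearCombination A fun mu => vec fun lam => f lam mu

/-- The columns of a matrix are finitely supported. -/
def ColFinite (f : YoungDiagram → YoungDiagram → A) : Prop :=
  ∀ mu, (Function.support fun lam => f lam mu).Finite

theorem matOp_apply {f : YoungDiagram → YoungDiagram → A} (hf : ColFinite f)
    (w : YoungDiagram →₀ A) (lam : YoungDiagram) :
    matOp f w lam = ∑ᶠ mu, f lam mu * w mu := by
  rw [matOp, Finsupp.linearCombination_apply, Finsupp.sum, Finsupp.finsetSum_apply,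
    finsum_eq_sum_of_support_subset (s := w.support)]
  · refine Finset.sum_congr rfl fun mu _ => ?_
    rw [Finsupp.smul_apply, vec_apply (hf mu), smul_eq_mul, mul_comm]
  · intro mu hmu
    rw [Finset.mem_coe, Finsupp.mem_support_iff]
    intro h
    exact hmu (by simp only [h, mul_zero])

theorem matOp_single {f : YoungDiagram → YoungDiagram → A} (hf : ColFinite f)
    (lam mu : YoungDiagram) : matOp f (Finsupp.single mu 1) lam = f lam mu := by
  rw [matOp, Finsupp.linearCombination_single, one_smul, vec_apply (hf mu)]

theorem end_ext {S T : Module.End A (YoungDiagram →₀ A)}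
    (h : ∀ lam mu, S (Finsupp.single mu 1) lam = T (Finsupp.single mu 1) lam) : S = T := by
  refine Finsupp.lhom_ext' fun mu => LinearMap.ext_ring ?_
  exact Finsupp.ext fun lam => h lam mu

theorem matOp_mul_single {f g : YoungDiagram → YoungDiagram → A} (hf : ColFinite f)
    (hg : ColFinite g) (lam mu : YoungDiagram) :
    (matOp f * matOp g) (Finsupp.single mu 1) lam = ∑ᶠ nu, f lam nu * g nu mu := by
  rw [Module.End.mul_apply, matOp_apply hf]
  exact finsum_congr fun nu => by rw [matOp_single hg]

/-- The vector `∑ u ^ |lam| lam`. -/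
noncomputable def ket (u : A) : YoungDiagram →₀ A := vec fun lam => u ^ lam.card

/-- The linear form `lam ↦ v ^ |lam|`. -/
noncomputable def bra (v : A) : (YoungDiagram →₀ A) →ₗ[A] A :=
  Finsupp.linearCombination A fun lam => v ^ lam.card

theorem ket_apply {u : A} (hu : IsNilpotent u) (lam : YoungDiagram) : ket u lam = u ^ lam.card :=
  vec_apply (by simpa using finite_support_pow_card hu fun _ => 1) lam

theorem bra_apply (v : A) (w : YoungDiagram →₀ A) :
    bra v w = ∑ᶠ lam, w lam * v ^ lam.card := by
  rw [bra, Finsupp.linearCombination_apply, Finsupp.sum,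
    finsum_eq_sum_of_support_subset (s := w.support)]
  · rfl
  · intro mu hmu
    rw [Finset.mem_coe, Finsupp.mem_support_iff]
    intro h
    exact hmu (by simp only [h, zero_mul])

variable [Algebra ℂ A]

open Classical in
/-- The value `a ^ |lam/mu| s_{lam/mu}` of a skew Schur function at a specialization scaled by `a`,
extended by zero to all pairs of diagrams. -/
noncomputable def skTerm (H : ℂ⟦X⟧) (a : A) (lam mu : YoungDiagram) : A :=
  if mu ≤ lam then algebraMap ℂ A (sk H lam mu) * a ^ (lam.card - mu.card) else 0

theorem skTerm_of_not {H : ℂ⟦X⟧} {a : A} {lam mu : YoungDiagram} (h : ¬ mu ≤ lam) :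
    skTerm H a lam mu = 0 := if_neg h

theorem skTerm_of_le {H : ℂ⟦X⟧} {a : A} {lam mu : YoungDiagram} (h : mu ≤ lam) :
    skTerm H a lam mu = algebraMap ℂ A (sk H lam mu) * a ^ (lam.card - mu.card) := if_pos h

theorem skTerm_bot {H : ℂ⟦X⟧} {a : A} {lam : YoungDiagram} :
    skTerm H a lam ⊥ = algebraMap ℂ A (sk H lam ⊥) * a ^ lam.card := by
  rw [skTerm_of_le bot_le, card_bot, Nat.sub_zero]

theorem skTerm_self {H : ℂ⟦X⟧} (hH : constantCoeff H = 1) {a : A} (lam : YoungDiagram) :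
    skTerm H a lam lam = 1 := by
  rw [skTerm_of_le le_rfl, sk_self H hH, map_one, Nat.sub_self, pow_zero, mul_one]

theorem skTerm_mul {H H' : ℂ⟦X⟧} (hH : constantCoeff H = 1) (hH' : constantCoeff H' = 1) (a : A)
    (lam mu : YoungDiagram) :
    ∑ᶠ nu, skTerm H a lam nu * skTerm H' a nu mu = skTerm (H * H') a lam mu := by
  rw [finsum_eq_sum_of_support_subset (s := between mu lam)]
  · by_cases h : mu ≤ lam
    · rw [skTerm_of_le h, sk_mul H H' hH hH' h, map_sum, Finset.sum_mul]
      refine Finset.sum_congr rfl fun nu hnu => ?_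
      rw [mem_between] at hnu
      have h1 := card_mono hnu.1
      have h2 := card_mono hnu.2
      rw [skTerm_of_le hnu.1, skTerm_of_le hnu.2, map_mul,
        show lam.card - mu.card = (lam.card - nu.card) + (nu.card - mu.card) by omega, pow_add]
      ring
    · rw [skTerm_of_not h, Finset.sum_eq_zero]
      intro nu hnu
      rw [mem_between] at hnu
      exact absurd (hnu.1.trans hnu.2) h
  · intro nu hnu
    rw [Finset.mem_coe, mem_between]
    constructor
    · by_contra h
      exact hnu (by simp only [skTerm_of_not h, mul_zero])
    · by_contra h
      exact hnu (by simp only [skTerm_of_not h, zero_mul])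

theorem skTerm_congr {H H' : ℂ⟦X⟧} {a : A} {K : ℕ} (ha : a ^ K = 0)
    (h : ∀ m ≤ K, coeff m H = coeff m H') : skTerm H a = skTerm H' a := by
  ext lam mu
  by_cases hle : mu ≤ lam
  · rw [skTerm_of_le hle, skTerm_of_le hle]
    by_cases hK : lam.card - mu.card ≤ K
    · rw [sk_congr hle fun m hm => h m (hm.trans hK)]
    · rw [pow_eq_zero_of_le (by omega) ha, mul_zero, mul_zero]
  · rw [skTerm_of_not hle, skTerm_of_not hle]

theorem skTerm_single (x : ℂ) (a : A) :
    skTerm (PowerSeries.mk fun n => x ^ n) a = stripTerm (algebraMap ℂ A x * a) := by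
  ext lam mu
  by_cases hle : mu ≤ lam
  · rw [skTerm_of_le hle, sk_single x hle]
    by_cases hs : IsStrip lam mu
    · rw [if_pos hs, stripTerm_of hs, mul_pow, map_pow]
    · rw [if_neg hs, stripTerm_of_not hs, map_zero, zero_mul]
  · rw [skTerm_of_not hle, stripTerm_of_not fun hs => hle hs.le]

theorem skTerm_one (a : A) (lam mu : YoungDiagram) [Decidable (lam = mu)] :
    skTerm 1 a lam mu = if lam = mu then 1 else 0 := by
  have h1 : (1 : ℂ⟦X⟧) = PowerSeries.mk fun n => (0 : ℂ) ^ n := by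
    ext n
    rw [coeff_one, coeff_mk]
    split_ifs with h
    · rw [h, pow_zero]
    · rw [zero_pow h]
  split_ifs with h
  · subst h
    exact skTerm_self (by simp) lam
  · rw [h1, skTerm_single, map_zero, zero_mul]
    by_cases hs : IsStrip lam mu
    · rw [stripTerm_of hs]
      refine zero_pow fun h0 => h ?_
      refine (YoungDiagram.ext (Finset.eq_of_subset_of_card_le hs.le ?_)).symm
      change lam.card ≤ mu.card
      omega
    · rw [stripTerm_of_not hs]

theorem skTerm_zero {H : ℂ⟦X⟧} (hH : constantCoeff H = 1) :
    skTerm H (0 : A) = skTerm 1 (0 : A) := by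
  ext lam mu
  by_cases hle : mu ≤ lam
  · by_cases hcard : lam.card - mu.card = 0
    · obtain rfl : mu = lam := YoungDiagram.ext
        (Finset.eq_of_subset_of_card_le hle (Nat.sub_eq_zero_iff_le.1 hcard))
      rw [skTerm_self hH, skTerm_self (by simp)]
    · rw [skTerm_of_le hle, skTerm_of_le hle, zero_pow hcard, mul_zero, mul_zero]
  · rw [skTerm_of_not hle, skTerm_of_not hle]

theorem colFinite_up (H : ℂ⟦X⟧) {a : A} (ha : IsNilpotent a) : ColFinite (skTerm H a) := by
  obtain ⟨K, hK⟩ := ha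
  refine fun mu => (finite_card_le (mu.card + K)).subset fun lam hlam => ?_
  by_contra h
  have h1 : ¬ lam.card ≤ mu.card + K := h
  refine hlam ?_
  by_cases hle : mu ≤ lam
  · simp only
    rw [skTerm_of_le hle, pow_eq_zero_of_le (by omega) hK, mul_zero]
  · exact skTerm_of_not hle

theorem colFinite_down (H : ℂ⟦X⟧) (b : A) : ColFinite fun mu lam => skTerm H b lam mu := by
  refine fun lam => (finite_Iic lam).subset fun mu hmu => ?_
  by_contra h
  exact hmu (skTerm_of_not h)

/-- The creation operator: `mu` is sent to the sum of all `lam` containing it, weighted by the skew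
Schur functions. -/
noncomputable def upOp (H : ℂ⟦X⟧) (a : A) : Module.End A (YoungDiagram →₀ A) :=
  matOp (skTerm H a)

/-- The annihilation operator: `lam` is sent to the sum of all `mu` contained in it, weighted by
the skew Schur functions. -/
noncomputable def downOp (H : ℂ⟦X⟧) (b : A) : Module.End A (YoungDiagram →₀ A) :=
  matOp fun mu lam => skTerm H b lam mu

theorem upOp_single (H : ℂ⟦X⟧) {a : A} (ha : IsNilpotent a) (lam mu : YoungDiagram) :
    upOp H a (Finsupp.single mu 1) lam = skTerm H a lam mu :=
  matOp_single (colFinite_up H ha) lam mu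

theorem downOp_single (H : ℂ⟦X⟧) (b : A) (lam mu : YoungDiagram) :
    downOp H b (Finsupp.single lam 1) mu = skTerm H b lam mu :=
  matOp_single (colFinite_down H b) mu lam

theorem upOp_mul {H H' : ℂ⟦X⟧} (hH : constantCoeff H = 1) (hH' : constantCoeff H' = 1) {a : A}
    (ha : IsNilpotent a) : upOp H a * upOp H' a = upOp (H * H') a := by
  refine end_ext fun lam mu => ?_
  rw [upOp, upOp, matOp_mul_single (colFinite_up H ha) (colFinite_up H' ha), skTerm_mul hH hH',
    upOp, matOp_single (colFinite_up _ ha)]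

theorem downOp_mul {H H' : ℂ⟦X⟧} (hH : constantCoeff H = 1) (hH' : constantCoeff H' = 1) (b : A) :
    downOp H b * downOp H' b = downOp (H * H') b := by
  refine end_ext fun mu lam => ?_
  rw [downOp, downOp, matOp_mul_single (colFinite_down H b) (colFinite_down H' b), downOp,
    matOp_single (colFinite_down _ b), mul_comm H H', ← skTerm_mul hH' hH]
  exact finsum_congr fun nu => mul_comm _ _

theorem upOp_one (a : A) (ha : IsNilpotent a) : upOp 1 a = 1 := by
  classical
  refine end_ext fun lam mu => ?_
  rw [upOp, matOp_single (colFinite_up _ ha), skTerm_one, Module.End.one_apply,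
    Finsupp.single_apply]
  simp only [eq_comm]

theorem downOp_one (b : A) : downOp 1 b = 1 := by
  classical
  refine end_ext fun lam mu => ?_
  rw [downOp, matOp_single (colFinite_down _ b), skTerm_one, Module.End.one_apply,
    Finsupp.single_apply]

/-! ### Generating functions as products of geometric series -/

theorem mk_pow_mul_one_sub (x : ℂ) :
    (PowerSeries.mk fun n => x ^ n) * (1 - C x * X : ℂ⟦X⟧) = 1 := by
  ext n
  rw [mul_sub, mul_one, ← mul_assoc, map_sub, coeff_mk]
  cases n with
  | zero => simp
  | succ n =>
    rw [coeff_succ_mul_X, coeff_mul_C, coeff_mk, coeff_one, if_neg (by omega), pow_succ, sub_self]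

/-- Modulo any power of the variable, a power series over `ℂ` with constant coefficient one is the
generating function of a finite set of variables. -/
theorem exists_prod_geometric (H : ℂ⟦X⟧) (hH : constantCoeff H = 1) (K : ℕ) :
    ∃ s : Multiset ℂ, ∀ m ≤ K,
      coeff m H = coeff m (s.map fun x => (PowerSeries.mk fun n => x ^ n : ℂ⟦X⟧)).prod := by
  have hH0 : constantCoeff H ≠ 0 := by rw [hH]; exact one_ne_zero
  -- truncate `1 / H`, and factor the resulting polynomial
  set P : Polynomial ℂ := trunc (K + 1) H⁻¹ with hP
  have hP0 : P.eval 0 = 1 := by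
    rw [← Polynomial.coeff_zero_eq_eval_zero, hP, coeff_trunc, if_pos (by omega)]
    simp [hH]
  have hPne : P ≠ 0 := by
    rintro h
    rw [h, Polynomial.eval_zero] at hP0
    exact zero_ne_one hP0
  have hroot : ∀ r ∈ P.roots, r ≠ 0 := by
    rintro r hr rfl
    rw [Polynomial.mem_roots hPne, Polynomial.IsRoot, hP0] at hr
    exact one_ne_zero hr
  have hfac := (IsAlgClosed.splits P).eq_prod_roots
  have hev := congrArg (Polynomial.eval 0) hfac
  rw [hP0, Polynomial.eval_mul, Polynomial.eval_C, Polynomial.eval_multiset_prod,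
    Multiset.map_map] at hev
  simp only [Function.comp_apply, Polynomial.eval_sub, Polynomial.eval_X, Polynomial.eval_C,
    zero_sub] at hev
  have hfac' : P = (P.roots.map fun r => 1 - Polynomial.C r⁻¹ * Polynomial.X).prod := by
    have h1 : (P.roots.map fun r => Polynomial.X - Polynomial.C r) =
        P.roots.map fun r => Polynomial.C (-r) * (1 - Polynomial.C r⁻¹ * Polynomial.X) := by
      refine Multiset.map_congr rfl fun r hr => ?_
      rw [mul_sub, mul_one, ← mul_assoc, ← Polynomial.C_mul, neg_mul,
        mul_inv_cancel₀ (hroot r hr), Polynomial.C_neg, Polynomial.C_neg, Polynomial.C_1]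
      ring
    have h2 : P.roots.map (fun r => Polynomial.C (-r)) =
        (P.roots.map fun r => -r).map Polynomial.C := by
      rw [Multiset.map_map]
      rfl
    conv_lhs => rw [hfac, h1, Multiset.prod_map_mul, h2, Multiset.prod_hom, ← mul_assoc,
      ← Polynomial.C_mul, ← hev, Polynomial.C_1, one_mul]
  refine ⟨P.roots.map fun r => r⁻¹, ?_⟩
  set G : ℂ⟦X⟧ := ((P.roots.map fun r => r⁻¹).map fun x =>
    (PowerSeries.mk fun n => x ^ n : ℂ⟦X⟧)).prod with hG
  have hGP : G * (P : ℂ⟦X⟧) = 1 := by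
    have h1 : (P : ℂ⟦X⟧) = (P.roots.map fun r => (1 - C r⁻¹ * X : ℂ⟦X⟧)).prod := by
      conv_lhs => rw [hfac']
      rw [← Polynomial.coeToPowerSeries.ringHom_apply, map_multiset_prod, Multiset.map_map]
      congr 1
      refine Multiset.map_congr rfl fun r _ => ?_
      simp [Polynomial.coeToPowerSeries.ringHom_apply]
    rw [h1, hG, Multiset.map_map, ← Multiset.prod_map_mul]
    refine Multiset.prod_eq_one fun x hx => ?_
    obtain ⟨r, _, rfl⟩ := Multiset.mem_map.1 hx
    exact mk_pow_mul_one_sub r⁻¹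
  have hdvd : (X : ℂ⟦X⟧) ^ (K + 1) ∣ (P : ℂ⟦X⟧) - H⁻¹ := by
    rw [X_pow_dvd_iff]
    intro m hm
    rw [map_sub, hP, Polynomial.coeff_coe, coeff_trunc, if_pos hm, sub_self]
  have hdiff : H - G = G * H * ((P : ℂ⟦X⟧) - H⁻¹) := by
    have h2 : H * H⁻¹ = 1 := PowerSeries.mul_inv_cancel H hH0
    linear_combination (-H) * hGP + G * h2
  intro m hm
  have := X_pow_dvd_iff.1 (hdiff ▸ hdvd.mul_left (G * H)) m (by omega)
  rwa [map_sub, sub_eq_zero] at this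

end FreeBoundarySchur

/-! ### Commutation and reflection relations -/

namespace FreeBoundarySchur

open PowerSeries

variable {A : Type*} [CommRing A] [Algebra ℂ A]

/-- The generating function of a finite set of variables. -/
noncomputable def varsGen (s : Multiset ℂ) : ℂ⟦X⟧ :=
  (s.map fun x => (PowerSeries.mk fun n => x ^ n : ℂ⟦X⟧)).prod

theorem constantCoeff_mk_pow (x : ℂ) :
    constantCoeff (PowerSeries.mk fun n => x ^ n : ℂ⟦X⟧) = 1 := by
  rw [← coeff_zero_eq_constantCoeff_apply, coeff_mk, pow_zero]

theorem varsGen_zero : varsGen 0 = 1 := by simp [varsGen]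

theorem varsGen_cons (x : ℂ) (s : Multiset ℂ) :
    varsGen (x ::ₘ s) = (PowerSeries.mk fun n => x ^ n) * varsGen s := by
  simp [varsGen]

theorem constantCoeff_varsGen (s : Multiset ℂ) : constantCoeff (varsGen s) = 1 := by
  induction s using Multiset.induction_on with
  | empty => simp [varsGen_zero]
  | cons x s ih => rw [varsGen_cons, map_mul, ih, constantCoeff_mk_pow, mul_one]

theorem constantCoeff_mul_eq_one {H H' : ℂ⟦X⟧} (hH : constantCoeff H = 1)
    (hH' : constantCoeff H' = 1) : constantCoeff (H * H') = 1 := by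
  rw [map_mul, hH, hH', mul_one]

/-- The value at `z` of the generating function `∑ s_lam(H) s_lam(H') z ^ |lam|`. -/
noncomputable def cauchyAt (H H' : ℂ⟦X⟧) (z : A) : A :=
  ∑ᶠ lam : YoungDiagram, algebraMap ℂ A (sk H lam ⊥ * sk H' lam ⊥) * z ^ lam.card

/-- The value at `z` of the generating function `∑ s_lam(H) z ^ |lam|`. -/
noncomputable def littlewoodAt (H : ℂ⟦X⟧) (z : A) : A :=
  ∑ᶠ lam : YoungDiagram, algebraMap ℂ A (sk H lam ⊥) * z ^ lam.card

theorem cauchyAt_comm (H H' : ℂ⟦X⟧) (z : A) : cauchyAt H H' z = cauchyAt H' H z := by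
  simp only [cauchyAt, mul_comm]

/-- The constant in a commutation relation is found on the empty diagram. -/
theorem eq_cauchyAt {H H' : ℂ⟦X⟧} (hH : constantCoeff H = 1) (hH' : constantCoeff H' = 1) {a b c : A}
    (ha : IsNilpotent a) (h : downOp H b * upOp H' a = c • (upOp H' a * downOp H b)) :
    c = cauchyAt H H' (a * b) := by
  have h1 := DFunLike.congr_fun (LinearMap.congr_fun h (Finsupp.single ⊥ 1)) ⊥
  rw [downOp, upOp, matOp_mul_single (colFinite_down H b) (colFinite_up H' ha),
    LinearMap.smul_apply, Finsupp.smul_apply,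
    matOp_mul_single (colFinite_up H' ha) (colFinite_down H b),
    finsum_eq_single (fun nu => skTerm H' a ⊥ nu * skTerm H b ⊥ nu) ⊥, skTerm_self hH,
    skTerm_self hH', mul_one, smul_eq_mul, mul_one] at h1
  · rw [← h1]
    refine finsum_congr fun nu => ?_
    rw [skTerm_bot, skTerm_bot, map_mul, mul_pow]
    ring
  · intro nu hnu
    rw [skTerm_of_not, zero_mul]
    exact fun hle => hnu (le_antisymm hle bot_le)

/-- The skew Cauchy identity. Both sides depend only on finitely many coefficients of `H` and `H'`,
so that these may be replaced by products of geometric series; the operators are multiplicative,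
and for geometric series the identity is the local rule. The constant need not be followed through
this reduction. -/
theorem downOp_mul_upOp {H H' : ℂ⟦X⟧} (hH : constantCoeff H = 1) (hH' : constantCoeff H' = 1)
    {a b : A} (ha : IsNilpotent a) (hb : IsNilpotent b) :
    downOp H b * upOp H' a = cauchyAt H H' (a * b) • (upOp H' a * downOp H b) := by
  have hsingle : ∀ x y : ℂ, ∃ c : A,
      downOp (PowerSeries.mk fun n => x ^ n) b * upOp (PowerSeries.mk fun n => y ^ n) a =
        c • (upOp (PowerSeries.mk fun n => y ^ n) a *
          downOp (PowerSeries.mk fun n => x ^ n) b) := by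
    intro x y
    refine ⟨∑ᶠ k : ℕ, (algebraMap ℂ A y * a * (algebraMap ℂ A x * b)) ^ k,
      end_ext fun lam mu => ?_⟩
    rw [LinearMap.smul_apply, Finsupp.smul_apply, downOp, upOp,
      matOp_mul_single (colFinite_down _ b) (colFinite_up _ ha),
      matOp_mul_single (colFinite_up _ ha) (colFinite_down _ b), skTerm_single, skTerm_single,
      smul_eq_mul, ← finsum_stripTerm_mul (algebraMap ℂ A x * b)
        ((Commute.all _ _).isNilpotent_mul_left ha)]
    exact finsum_congr fun nu => mul_comm _ _
  have hleft : ∀ (s : Multiset ℂ) (y : ℂ), ∃ c : A,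
      downOp (varsGen s) b * upOp (PowerSeries.mk fun n => y ^ n) a =
        c • (upOp (PowerSeries.mk fun n => y ^ n) a * downOp (varsGen s) b) := by
    intro s y
    induction s using Multiset.induction_on with
    | empty => exact ⟨1, by rw [varsGen_zero, downOp_one, one_mul, mul_one, one_smul]⟩
    | cons x s ih =>
      obtain ⟨c, hc⟩ := hsingle x y
      obtain ⟨d, hd⟩ := ih
      refine ⟨c * d, ?_⟩
      rw [varsGen_cons, ← downOp_mul (constantCoeff_mk_pow x) (constantCoeff_varsGen s), mul_assoc,
        hd, mul_smul_comm, ← mul_assoc, hc, smul_mul_assoc, mul_assoc, smul_smul, mul_comm d c]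
  have hboth : ∀ s t : Multiset ℂ, ∃ c : A,
      downOp (varsGen s) b * upOp (varsGen t) a =
        c • (upOp (varsGen t) a * downOp (varsGen s) b) := by
    intro s t
    induction t using Multiset.induction_on with
    | empty => exact ⟨1, by rw [varsGen_zero, upOp_one a ha, one_mul, mul_one, one_smul]⟩
    | cons y t ih =>
      obtain ⟨c, hc⟩ := hleft s y
      obtain ⟨d, hd⟩ := ih
      refine ⟨c * d, ?_⟩
      rw [varsGen_cons, ← upOp_mul (constantCoeff_mk_pow y) (constantCoeff_varsGen t) ha,
        ← mul_assoc, hc, smul_mul_assoc, mul_assoc, hd, mul_smul_comm, smul_smul, mul_assoc]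
  obtain ⟨Ka, hKa⟩ := id ha
  obtain ⟨Kb, hKb⟩ := hb
  obtain ⟨s, hs⟩ := exists_prod_geometric H hH Kb
  obtain ⟨t, ht⟩ := exists_prod_geometric H' hH' Ka
  obtain ⟨c, hc⟩ := hboth s t
  have h1 : downOp H b = downOp (varsGen s) b := by rw [downOp, downOp, skTerm_congr hKb hs]; rfl
  have h2 : upOp H' a = upOp (varsGen t) a := by rw [upOp, upOp, skTerm_congr hKa ht]; rfl
  rw [← h1, ← h2] at hc
  rw [hc, eq_cauchyAt hH hH' ha hc]

theorem cauchyAt_mul {H₁ H₂ H' : ℂ⟦X⟧} (h₁ : constantCoeff H₁ = 1) (h₂ : constantCoeff H₂ = 1)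
    (hH' : constantCoeff H' = 1) {a b : A} (ha : IsNilpotent a) (hb : IsNilpotent b) :
    cauchyAt (H₁ * H₂) H' (a * b) = cauchyAt H₁ H' (a * b) * cauchyAt H₂ H' (a * b) := by
  rw [cauchyAt_comm, cauchyAt_comm H₁, cauchyAt_comm H₂]
  refine (eq_cauchyAt hH' (constantCoeff_mul_eq_one h₁ h₂) ha (b := b) ?_).symm
  rw [← upOp_mul h₁ h₂ ha, ← mul_assoc, downOp_mul_upOp hH' h₁ ha hb, smul_mul_assoc, mul_assoc,
    downOp_mul_upOp hH' h₂ ha hb, mul_smul_comm, smul_smul, mul_assoc]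

theorem cauchyAt_one_left {H' : ℂ⟦X⟧} (hH' : constantCoeff H' = 1) {a : A} (b : A)
    (ha : IsNilpotent a) : cauchyAt 1 H' (a * b) = 1 := by
  rw [← eq_cauchyAt (c := (1 : A)) (by simp) hH' ha]
  rw [downOp_one, one_mul, mul_one, one_smul]

/-- Reflection at the vector `ket u`: annihilation operators turn into creation operators, by the
skew Littlewood identity. As for the skew Cauchy identity, one variable is enough, and the constant
is found on the empty diagram. -/
theorem downOp_ket {H : ℂ⟦X⟧} (hH : constantCoeff H = 1) {u b : A} (hu : IsNilpotent u)
    (hb : IsNilpotent b) :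
    downOp H b (ket u) = littlewoodAt H (u * b) • upOp H (u ^ 2 * b) (ket u) := by
  have hub : IsNilpotent (u * b) := (Commute.all _ _).isNilpotent_mul_left hb
  have hu2b : IsNilpotent (u ^ 2 * b) := (Commute.all _ _).isNilpotent_mul_left hb
  have hsingle : ∀ x : ℂ, ∃ c : A, downOp (PowerSeries.mk fun n => x ^ n) b (ket u) =
      c • upOp (PowerSeries.mk fun n => x ^ n) (u ^ 2 * b) (ket u) := by
    intro x
    set z : A := algebraMap ℂ A x * b * u with hz
    have hznil : IsNilpotent z := (Commute.all _ _).isNilpotent_mul_left hu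
    refine ⟨∑ᶠ k : ℕ, z ^ k, Finsupp.ext fun mu => ?_⟩
    rw [Finsupp.smul_apply, smul_eq_mul, downOp, upOp, matOp_apply (colFinite_down _ b),
      matOp_apply (colFinite_up _ hu2b), skTerm_single, skTerm_single]
    have h1 : ∀ lam, stripTerm (algebraMap ℂ A x * b) lam mu * ket u lam =
        u ^ mu.card * stripTerm z lam mu := by
      intro lam
      by_cases hs : IsStrip lam mu
      · rw [stripTerm_of hs, stripTerm_of hs, ket_apply hu, hz, mul_pow _ u,
          ← Nat.sub_add_cancel (card_mono hs.le), pow_add, Nat.add_sub_cancel]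
        ring
      · rw [stripTerm_of_not hs, stripTerm_of_not hs, zero_mul, mul_zero]
    have h2 : ∀ kappa, stripTerm (algebraMap ℂ A x * (u ^ 2 * b)) mu kappa * ket u kappa =
        u ^ mu.card * stripTerm z mu kappa := by
      intro kappa
      by_cases hs : IsStrip mu kappa
      · rw [stripTerm_of hs, stripTerm_of hs, ket_apply hu, hz,
          ← Nat.sub_add_cancel (card_mono hs.le), pow_add, Nat.add_sub_cancel]
        ring
      · rw [stripTerm_of_not hs, stripTerm_of_not hs, zero_mul, mul_zero]
    have hf1 : (Function.support fun lam => stripTerm z lam mu).Finite := by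
      have := colFinite_up (PowerSeries.mk fun n => (x : ℂ) ^ n)
        (a := b * u) ((Commute.all _ _).isNilpotent_mul_left hu) mu
      rwa [skTerm_single, ← mul_assoc] at this
    have hf2 : (Function.support fun kappa => stripTerm z mu kappa).Finite := by
      have := colFinite_down (PowerSeries.mk fun n => (x : ℂ) ^ n) (b * u) mu
      simp only [skTerm_single, ← mul_assoc] at this
      exact this
    simp only [h1, h2]
    rw [← mul_finsum' _ _ hf1, ← mul_finsum' _ _ hf2, finsum_stripTerm hznil]
    ring
  have hvars : ∀ s : Multiset ℂ, ∃ c : A, downOp (varsGen s) b (ket u) =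
      c • upOp (varsGen s) (u ^ 2 * b) (ket u) := by
    intro s
    induction s using Multiset.induction_on with
    | empty => exact ⟨1, by rw [varsGen_zero, downOp_one, upOp_one _ hu2b, one_smul]⟩
    | cons x s ih =>
      obtain ⟨c, hc⟩ := hsingle x
      obtain ⟨d, hd⟩ := ih
      have hx := constantCoeff_mk_pow x
      have hs := constantCoeff_varsGen s
      refine ⟨d * (cauchyAt (PowerSeries.mk fun n => x ^ n) (varsGen s) (u ^ 2 * b * b) * c), ?_⟩
      rw [varsGen_cons, ← downOp_mul hx hs, Module.End.mul_apply, hd, map_smul,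
        ← Module.End.mul_apply, downOp_mul_upOp hx hs hu2b hb, LinearMap.smul_apply,
        Module.End.mul_apply, hc, map_smul, ← Module.End.mul_apply, upOp_mul hs hx hu2b,
        smul_smul, smul_smul, mul_comm (varsGen s), mul_assoc]
  obtain ⟨K, hK⟩ := id hb
  obtain ⟨s, hs⟩ := exists_prod_geometric H hH K
  obtain ⟨c, hc⟩ := hvars s
  have h1 : downOp H b = downOp (varsGen s) b := by rw [downOp, downOp, skTerm_congr hK hs]; rfl
  have h2 : upOp H (u ^ 2 * b) = upOp (varsGen s) (u ^ 2 * b) := by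
    rw [upOp, upOp, skTerm_congr (by rw [mul_pow, hK, mul_zero]) hs]; rfl
  rw [← h1, ← h2] at hc
  have h3 := DFunLike.congr_fun hc ⊥
  rw [downOp, upOp, Finsupp.smul_apply, matOp_apply (colFinite_down _ b),
    matOp_apply (colFinite_up _ hu2b),
    finsum_eq_single (fun nu => skTerm H (u ^ 2 * b) ⊥ nu * ket u nu) ⊥, skTerm_self hH,
    ket_apply hu, card_bot, pow_zero, mul_one, smul_eq_mul, mul_one] at h3
  · rw [hc, ← h3]
    congr 1
    refine finsum_congr fun lam => ?_
    rw [skTerm_bot, ket_apply hu, mul_pow]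
    ring
  · intro nu hnu
    rw [skTerm_of_not, zero_mul]
    exact fun hle => hnu (le_antisymm hle bot_le)

/-- Reflection at the linear form `bra v`: creation operators turn into annihilation operators, by
the skew Littlewood identity. -/
theorem bra_upOp {H : ℂ⟦X⟧} (hH : constantCoeff H = 1) (v : A) {a : A} (ha : IsNilpotent a) :
    bra v ∘ₗ upOp H a = littlewoodAt H (v * a) • (bra v ∘ₗ downOp H (v ^ 2 * a)) := by
  have hv2a : IsNilpotent (v ^ 2 * a) := (Commute.all _ _).isNilpotent_mul_left ha
  have hsingle : ∀ x : ℂ, ∃ c : A, bra v ∘ₗ upOp (PowerSeries.mk fun n => x ^ n) a =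
      c • (bra v ∘ₗ downOp (PowerSeries.mk fun n => x ^ n) (v ^ 2 * a)) := by
    intro x
    set z : A := algebraMap ℂ A x * (a * v) with hz
    have hznil : IsNilpotent z :=
      (Commute.all _ _).isNilpotent_mul_left ((Commute.all _ _).isNilpotent_mul_right ha)
    refine ⟨∑ᶠ k : ℕ, z ^ k, Finsupp.lhom_ext' fun mu => LinearMap.ext_ring ?_⟩
    simp only [LinearMap.comp_apply, LinearMap.smul_apply, Finsupp.lsingle_apply, smul_eq_mul,
      bra_apply, downOp_single, upOp_single _ ha, skTerm_single]
    have h1 : ∀ lam, stripTerm (algebraMap ℂ A x * a) lam mu * v ^ lam.card =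
        v ^ mu.card * stripTerm z lam mu := by
      intro lam
      by_cases hs : IsStrip lam mu
      · rw [stripTerm_of hs, stripTerm_of hs, hz,
          ← Nat.sub_add_cancel (card_mono hs.le), pow_add, Nat.add_sub_cancel]
        ring
      · rw [stripTerm_of_not hs, stripTerm_of_not hs, zero_mul, mul_zero]
    have h2 : ∀ kappa, stripTerm (algebraMap ℂ A x * (v ^ 2 * a)) mu kappa * v ^ kappa.card =
        v ^ mu.card * stripTerm z mu kappa := by
      intro kappa
      by_cases hs : IsStrip mu kappa
      · rw [stripTerm_of hs, stripTerm_of hs, hz,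
          ← Nat.sub_add_cancel (card_mono hs.le), pow_add, Nat.add_sub_cancel]
        ring
      · rw [stripTerm_of_not hs, stripTerm_of_not hs, zero_mul, mul_zero]
    have hf1 : (Function.support fun lam => stripTerm z lam mu).Finite := by
      have := colFinite_up (PowerSeries.mk fun n => (x : ℂ) ^ n)
        (a := a * v) ((Commute.all _ _).isNilpotent_mul_right ha) mu
      rwa [skTerm_single] at this
    have hf2 : (Function.support fun kappa => stripTerm z mu kappa).Finite := by
      have := colFinite_down (PowerSeries.mk fun n => (x : ℂ) ^ n) (a * v) mu
      simp only [skTerm_single] at this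
      exact this
    simp only [h1, h2]
    rw [← mul_finsum' _ _ hf1, ← mul_finsum' _ _ hf2, finsum_stripTerm hznil]
    ring
  have hvars : ∀ s : Multiset ℂ, ∃ c : A, bra v ∘ₗ upOp (varsGen s) a =
      c • (bra v ∘ₗ downOp (varsGen s) (v ^ 2 * a)) := by
    intro s
    induction s using Multiset.induction_on with
    | empty => exact ⟨1, by rw [varsGen_zero, downOp_one, upOp_one _ ha, one_smul]⟩
    | cons x s ih =>
      obtain ⟨c, hc⟩ := hsingle x
      obtain ⟨d, hd⟩ := ih
      have hx := constantCoeff_mk_pow x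
      have hs := constantCoeff_varsGen s
      refine ⟨c * (cauchyAt (PowerSeries.mk fun n => x ^ n) (varsGen s) (a * (v ^ 2 * a)) * d), ?_⟩
      rw [varsGen_cons, ← upOp_mul hx hs ha, Module.End.mul_eq_comp, ← LinearMap.comp_assoc, hc,
        LinearMap.smul_comp, LinearMap.comp_assoc, ← Module.End.mul_eq_comp,
        downOp_mul_upOp hx hs ha hv2a, LinearMap.comp_smul, Module.End.mul_eq_comp,
        ← LinearMap.comp_assoc, hd, LinearMap.smul_comp, LinearMap.comp_assoc,
        ← Module.End.mul_eq_comp, downOp_mul hs hx, smul_smul, smul_smul, mul_comm (varsGen s),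
        mul_assoc]
  obtain ⟨K, hK⟩ := id ha
  obtain ⟨s, hs⟩ := exists_prod_geometric H hH K
  obtain ⟨c, hc⟩ := hvars s
  have h1 : upOp H a = upOp (varsGen s) a := by rw [upOp, upOp, skTerm_congr hK hs]; rfl
  have h2 : downOp H (v ^ 2 * a) = downOp (varsGen s) (v ^ 2 * a) := by
    rw [downOp, downOp, skTerm_congr (by rw [mul_pow, hK, mul_zero]) hs]; rfl
  rw [← h1, ← h2] at hc
  have h3 := LinearMap.congr_fun hc (Finsupp.single ⊥ 1)
  simp only [LinearMap.comp_apply, LinearMap.smul_apply, smul_eq_mul, bra_apply, downOp_single,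
    upOp_single H ha] at h3
  rw [finsum_eq_single (fun nu => skTerm H (v ^ 2 * a) ⊥ nu * v ^ nu.card) ⊥, skTerm_self hH,
    card_bot, pow_zero, mul_one, mul_one] at h3
  · rw [hc, ← h3]
    congr 1
    refine finsum_congr fun lam => ?_
    rw [skTerm_bot, mul_pow]
    ring
  · intro nu hnu
    rw [skTerm_of_not, zero_mul]
    exact fun hle => hnu (le_antisymm hle bot_le)

end FreeBoundarySchur

/-! ### The product formula with nilpotent arguments -/

namespace FreeBoundarySchur

open PowerSeries

variable {A : Type*} [CommRing A] [Algebra ℂ A]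

theorem constantCoeff_prod_eq_one {ι : Type*} (s : Finset ι) {H : ι → ℂ⟦X⟧}
    (hH : ∀ k, constantCoeff (H k) = 1) : constantCoeff (∏ k ∈ s, H k) = 1 := by
  rw [map_prod]
  exact Finset.prod_eq_one fun k _ => hH k

/-- The transfer operator of the process: alternately creation and annihilation operators. -/
noncomputable def wordOp : {N : ℕ} → (Fin N → ℂ⟦X⟧) → (Fin N → ℂ⟦X⟧) → A → A →
    Module.End A (YoungDiagram →₀ A)
  | 0, _, _, _, _ => 1
  | N + 1, Hp, Hm, a, b => downOp (Hm (Fin.last N)) b * upOp (Hp (Fin.last N)) a *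
      wordOp (fun k : Fin N => Hp k.castSucc) (fun k : Fin N => Hm k.castSucc) a b

theorem prod_pairs_succ {M : Type*} [CommMonoid M] {N : ℕ}
    (f : Fin (N + 1) → Fin (N + 1) → M) :
    ∏ p : Fin (N + 1) × Fin (N + 1) with p.1 ≤ p.2, f p.1 p.2 =
      (∏ p : Fin N × Fin N with p.1 ≤ p.2, f p.1.castSucc p.2.castSucc) *
        ∏ k, f k (Fin.last N) := by
  simp only [Finset.prod_filter, Fintype.prod_prod_type_right]
  rw [Fin.prod_univ_castSucc]
  congr 1
  · refine Finset.prod_congr rfl fun l _ => ?_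
    rw [Fin.prod_univ_castSucc, if_neg (by simp [Fin.le_def]), mul_one]
    rfl
  · exact Finset.prod_congr rfl fun k _ => if_pos (Fin.le_last k)

theorem cauchyAt_prod {ι : Type*} (s : Finset ι) {H : ι → ℂ⟦X⟧} {H' : ℂ⟦X⟧}
    (hH : ∀ k, constantCoeff (H k) = 1) (hH' : constantCoeff H' = 1) {a b : A}
    (ha : IsNilpotent a) (hb : IsNilpotent b) :
    cauchyAt (∏ k ∈ s, H k) H' (a * b) = ∏ k ∈ s, cauchyAt (H k) H' (a * b) := by
  classical
  induction s using Finset.induction_on with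
  | empty => rw [Finset.prod_empty, Finset.prod_empty, cauchyAt_one_left hH' b ha]
  | insert k s hk ih =>
    rw [Finset.prod_insert hk, Finset.prod_insert hk,
      cauchyAt_mul (hH k) (constantCoeff_prod_eq_one s hH) hH' ha hb, ih]

/-- Moving all annihilation operators to the right. -/
theorem wordOp_eq {N : ℕ} {Hp Hm : Fin N → ℂ⟦X⟧} (hp : ∀ k, constantCoeff (Hp k) = 1)
    (hm : ∀ k, constantCoeff (Hm k) = 1) {a b : A} (ha : IsNilpotent a) (hb : IsNilpotent b) :
    wordOp Hp Hm a b =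
      (∏ p : Fin N × Fin N with p.1 ≤ p.2, cauchyAt (Hp p.1) (Hm p.2) (a * b)) •
        (upOp (∏ k, Hp k) a * downOp (∏ k, Hm k) b) := by
  induction N with
  | zero =>
    rw [Finset.univ_eq_empty, Finset.filter_empty, Finset.prod_empty, one_smul,
      Finset.univ_eq_empty, Finset.prod_empty, Finset.prod_empty, upOp_one a ha, downOp_one,
      one_mul, wordOp]
  | succ N ih =>
    have hP := constantCoeff_prod_eq_one Finset.univ fun k : Fin N => hp k.castSucc
    have hM := constantCoeff_prod_eq_one Finset.univ fun k : Fin N => hm k.castSucc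
    rw [wordOp, ih (fun k => hp _) (fun k => hm _), mul_smul_comm, mul_assoc,
      ← mul_assoc (upOp (Hp (Fin.last N)) a), upOp_mul (hp _) hP ha, ← mul_assoc,
      mul_comm (Hp (Fin.last N)), ← Fin.prod_univ_castSucc,
      downOp_mul_upOp (hm _) (constantCoeff_prod_eq_one Finset.univ hp) ha hb, smul_mul_assoc,
      mul_assoc, downOp_mul (hm _) hM, mul_comm (Hm (Fin.last N)), ← Fin.prod_univ_castSucc,
      smul_smul, cauchyAt_comm, cauchyAt_prod Finset.univ hp (hm _) ha hb,
      prod_pairs_succ fun k l => cauchyAt (Hp k) (Hm l) (a * b)]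

/-- The factor produced by the `n + 1`-st pair of reflections: the constants of the two reflections
and of the exchange of the reflected operators. -/
noncomputable def reflectAt (H H' : ℂ⟦X⟧) (u v a b : A) (n : ℕ) : A :=
  littlewoodAt H (u ^ n * v ^ (n + 1) * a) * littlewoodAt H' (u ^ (n + 1) * v ^ n * b) *
    cauchyAt H H' ((u * v) ^ (2 * (n + 1)) * (a * b))

/-- Reflecting all operators once at either boundary, the two families exchange their roles. -/
theorem bra_upOp_downOp_ket_step {H H' : ℂ⟦X⟧} (hH : constantCoeff H = 1)
    (hH' : constantCoeff H' = 1) {u a b : A} (v : A) (hu : IsNilpotent u) (ha : IsNilpotent a)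
    (hb : IsNilpotent b) :
    bra v (upOp H a (downOp H' b (ket u))) =
      littlewoodAt H (v * a) * littlewoodAt H' (u * b) * cauchyAt H H' ((u * v) ^ 2 * (a * b)) *
        bra v (upOp H' (u ^ 2 * b) (downOp H (v ^ 2 * a) (ket u))) := by
  have hub : IsNilpotent (u ^ 2 * b) := (Commute.all _ _).isNilpotent_mul_left hb
  have hva : IsNilpotent (v ^ 2 * a) := (Commute.all _ _).isNilpotent_mul_left ha
  have h1 := fun w => LinearMap.congr_fun (bra_upOp hH v ha) w
  simp only [LinearMap.comp_apply, LinearMap.smul_apply] at h1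
  rw [downOp_ket hH' hu hb, map_smul, map_smul, h1, ← Module.End.mul_apply (downOp H _),
    downOp_mul_upOp hH hH' hub hva, LinearMap.smul_apply, map_smul, Module.End.mul_apply,
    smul_eq_mul, smul_eq_mul, smul_eq_mul,
    show u ^ 2 * b * (v ^ 2 * a) = (u * v) ^ 2 * (a * b) by ring]
  ring

/-- Since one round of reflections exchanges the two families, the rounds are taken in pairs, after
which both families are scaled by `(u * v) ^ 2`. -/
theorem bra_upOp_downOp_ket {H H' : ℂ⟦X⟧} (hH : constantCoeff H = 1) (hH' : constantCoeff H' = 1)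
    {u a b : A} (v : A) (hu : IsNilpotent u) (ha : IsNilpotent a) (hb : IsNilpotent b) (M : ℕ) :
    bra v (upOp H a (downOp H' b (ket u))) =
      (∏ n ∈ Finset.range (2 * M), reflectAt H H' u v a b n) *
        bra v (upOp H ((u * v) ^ (2 * M) * a) (downOp H' ((u * v) ^ (2 * M) * b) (ket u))) := by
  induction M with
  | zero => simp
  | succ M ih =>
    set q := (u * v) ^ (2 * M) with hq
    have hqa : IsNilpotent (q * a) := (Commute.all _ _).isNilpotent_mul_left ha
    have hqb : IsNilpotent (q * b) := (Commute.all _ _).isNilpotent_mul_left hb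
    have hub : IsNilpotent (u ^ 2 * (q * b)) := (Commute.all _ _).isNilpotent_mul_left hqb
    have hva : IsNilpotent (v ^ 2 * (q * a)) := (Commute.all _ _).isNilpotent_mul_left hqa
    rw [ih, bra_upOp_downOp_ket_step hH hH' v hu hqa hqb,
      bra_upOp_downOp_ket_step hH' hH v hu hub hva, show 2 * (M + 1) = 2 * M + 1 + 1 by ring,
      Finset.prod_range_succ, Finset.prod_range_succ, reflectAt, reflectAt, cauchyAt_comm H' H,
      show v * (q * a) = u ^ (2 * M) * v ^ (2 * M + 1) * a by rw [hq]; ring,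
      show u * (q * b) = u ^ (2 * M + 1) * v ^ (2 * M) * b by rw [hq]; ring,
      show (u * v) ^ 2 * (q * a * (q * b)) = (u * v) ^ (2 * (2 * M + 1)) * (a * b) by
        rw [hq]; ring,
      show v * (u ^ 2 * (q * b)) = u ^ (2 * M + 1 + 1) * v ^ (2 * M + 1) * b by rw [hq]; ring,
      show u * (v ^ 2 * (q * a)) = u ^ (2 * M + 1) * v ^ (2 * M + 1 + 1) * a by rw [hq]; ring,
      show (u * v) ^ 2 * (u ^ 2 * (q * b) * (v ^ 2 * (q * a))) =
        (u * v) ^ (2 * (2 * M + 1 + 1)) * (a * b) by rw [hq]; ring,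
      show u ^ 2 * (v ^ 2 * (q * a)) = (u * v) ^ (2 * M + 1 + 1) * a by rw [hq]; ring,
      show v ^ 2 * (u ^ 2 * (q * b)) = (u * v) ^ (2 * M + 1 + 1) * b by rw [hq]; ring]
    ring

theorem upOp_zero {H : ℂ⟦X⟧} (hH : constantCoeff H = 1) : upOp H (0 : A) = 1 := by
  rw [upOp, skTerm_zero hH]
  exact upOp_one 0 IsNilpotent.zero

theorem downOp_zero {H : ℂ⟦X⟧} (hH : constantCoeff H = 1) : downOp H (0 : A) = 1 := by
  rw [downOp, skTerm_zero hH]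
  exact downOp_one 0

/-- The product formula for the free boundary Schur process, with nilpotent parameters. -/
theorem bra_wordOp_ket {N : ℕ} {Hp Hm : Fin N → ℂ⟦X⟧} (hp : ∀ k, constantCoeff (Hp k) = 1)
    (hm : ∀ k, constantCoeff (Hm k) = 1) {u a b : A} (v : A) (hu : IsNilpotent u)
    (ha : IsNilpotent a) (hb : IsNilpotent b) {M : ℕ} (hM : (u * v) ^ (2 * M) = 0) :
    bra v (wordOp Hp Hm a b (ket u)) =
      (∏ p : Fin N × Fin N with p.1 ≤ p.2, cauchyAt (Hp p.1) (Hm p.2) (a * b)) *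
        ∏ n ∈ Finset.range (2 * M), (reflectAt (∏ k, Hp k) (∏ k, Hm k) u v a b n *
          ∑ᶠ k : ℕ, ((u * v) ^ (n + 1)) ^ k) := by
  have hP := constantCoeff_prod_eq_one Finset.univ hp
  have hQ := constantCoeff_prod_eq_one Finset.univ hm
  rw [wordOp_eq hp hm ha hb, LinearMap.smul_apply, map_smul, Module.End.mul_apply, smul_eq_mul,
    bra_upOp_downOp_ket hP hQ v hu ha hb M, hM, zero_mul, zero_mul, upOp_zero hP, downOp_zero hQ,
    Module.End.one_apply, Module.End.one_apply, bra_apply, Finset.prod_mul_distrib,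
    ← finsum_pow_card hM]
  congr 2
  exact finsum_congr fun lam => by rw [ket_apply hu, mul_pow]

end FreeBoundarySchur

/-! ### Generating series of graded families -/

namespace FreeBoundarySchur

open PowerSeries

section Graded

variable {ι : Type*}

/-- Only finitely many indices of the family have a bounded degree. -/
def FiniteDegree (deg : ι → ℕ) : Prop := ∀ d, {i | deg i ≤ d}.Finite

theorem FiniteDegree.finite_fiber {deg : ι → ℕ} (h : FiniteDegree deg) (d : ℕ) :
    Finite {i // deg i = d} :=
  ((h d).subset fun _ hi => le_of_eq hi).to_subtype

/-- The generating series of the family `w`, where the index `i` has degree `deg i`. -/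
noncomputable def gradedSeries (deg : ι → ℕ) (w : ι → ℂ) : ℂ⟦X⟧ :=
  PowerSeries.mk fun d => ∑ᶠ i : {i // deg i = d}, w i

theorem coeff_gradedSeries (deg : ι → ℕ) (w : ι → ℂ) (d : ℕ) :
    coeff d (gradedSeries deg w) = ∑ᶠ i : {i // deg i = d}, w i := by
  rw [gradedSeries, coeff_mk]

/-- The ring of power series truncated at order `K`. -/
abbrev Trunc (K : ℕ) : Type := ℂ⟦X⟧ ⧸ Ideal.span {(X : ℂ⟦X⟧) ^ K}

/-- The class of the variable in the truncated ring. -/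
noncomputable def truncVar (K : ℕ) : Trunc K := Ideal.Quotient.mk _ X

theorem truncVar_pow (K : ℕ) : truncVar K ^ K = 0 := by
  rw [truncVar, ← map_pow, Ideal.Quotient.eq_zero_iff_mem]
  exact Ideal.mem_span_singleton_self _

theorem isNilpotent_truncVar (K : ℕ) : IsNilpotent (truncVar K) := ⟨K, truncVar_pow K⟩

theorem mk_eq_mk_iff {K : ℕ} {p q : ℂ⟦X⟧} :
    (Ideal.Quotient.mk _ p : Trunc K) = Ideal.Quotient.mk _ q ↔
      ∀ d < K, coeff d p = coeff d q := by
  rw [Ideal.Quotient.eq, Ideal.mem_span_singleton, X_pow_dvd_iff]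
  simp only [map_sub, sub_eq_zero]

theorem mk_gradedSeries {deg : ι → ℕ} (h : FiniteDegree deg) (w : ι → ℂ) (K : ℕ) :
    (Ideal.Quotient.mk _ (gradedSeries deg w) : Trunc K) =
      ∑ᶠ i, algebraMap ℂ (Trunc K) (w i) * truncVar K ^ deg i := by
  classical
  rw [finsum_eq_sum_of_support_subset (s := (h K).toFinset)]
  · have h1 : ∑ i ∈ (h K).toFinset, algebraMap ℂ (Trunc K) (w i) * truncVar K ^ deg i =
        Ideal.Quotient.mk _ (∑ i ∈ (h K).toFinset, C (w i) * X ^ deg i) := by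
      rw [map_sum]
      refine Finset.sum_congr rfl fun i _ => ?_
      rw [map_mul, map_pow]
      rfl
    rw [h1, mk_eq_mk_iff]
    intro d hd
    rw [coeff_gradedSeries, map_sum]
    have := h.finite_fiber d
    have h2 : ∑ᶠ i : {i // deg i = d}, w i = ∑ᶠ i, if deg i = d then w i else 0 := by
      rw [finsum_eq_finsum_subtype (s := {i | deg i = d})]
      · exact finsum_congr fun i => (if_pos i.2).symm
      · intro i hi
        by_contra h3
        exact hi (if_neg h3)
    rw [h2, finsum_eq_sum_of_support_subset (s := (h K).toFinset)]
    · refine Finset.sum_congr rfl fun i _ => ?_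
      rw [coeff_C_mul, coeff_X_pow]
      simp only [eq_comm, mul_ite, mul_one, mul_zero]
    · intro i hi
      rw [Set.Finite.coe_toFinset]
      by_contra h3
      refine hi (if_neg ?_)
      rintro rfl
      exact h3 hd.le
  · intro i hi
    rw [Set.Finite.coe_toFinset]
    by_contra h3
    refine hi ?_
    simp only
    rw [pow_eq_zero_of_le (le_of_not_ge h3) (truncVar_pow K), mul_zero]

theorem finiteDegree_mul_card {c : ℕ} (hc : 0 < c) :
    FiniteDegree fun lam : YoungDiagram => c * lam.card := fun d =>
  (finite_card_le d).subset fun _ h => (Nat.le_mul_of_pos_left _ hc).trans h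

theorem finiteDegree_mul {c : ℕ} (hc : 0 < c) : FiniteDegree fun k : ℕ => c * k := fun d =>
  (Set.finite_le_nat d).subset fun _ h => (Nat.le_mul_of_pos_left _ hc).trans h

end Graded

/-! ### Expansion of the transfer operator over sequences of partitions -/

/-- Arbitrary sequences of Young diagrams, of the lengths occurring in `PartitionSeq`. -/
abbrev Path (N : ℕ) : Type := (Fin N → YoungDiagram) × (Fin (N + 1) → YoungDiagram)

/-- Extending a path by one step. -/
def pathSnoc (N : ℕ) : Path N × (YoungDiagram × YoungDiagram) ≃ Path (N + 1) where
  toFun p := (Fin.snoc p.1.1 p.2.1, Fin.snoc p.1.2 p.2.2)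
  invFun q := ((Fin.init q.1, Fin.init q.2), (q.1 (Fin.last N), q.2 (Fin.last (N + 1))))
  left_inv p := by simp
  right_inv q := by simp

/-- The product of the weights of the steps of a path. -/
def stepProd {M : Type*} [CommMonoid M] {N : ℕ}
    (f : Fin N → YoungDiagram → YoungDiagram → YoungDiagram → M) (p : Path N) : M :=
  ∏ k, f k (p.1 k) (p.2 k.castSucc) (p.2 k.succ)

theorem stepProd_snoc {M : Type*} [CommMonoid M] {N : ℕ}
    (f : Fin (N + 1) → YoungDiagram → YoungDiagram → YoungDiagram → M) (p : Path N)
    (q : YoungDiagram × YoungDiagram) :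
    stepProd f (pathSnoc N (p, q)) = stepProd (fun k => f k.castSucc) p *
      f (Fin.last N) q.1 (p.2 (Fin.last N)) q.2 := by
  rw [stepProd, Fin.prod_univ_castSucc]
  simp only [pathSnoc, Equiv.coe_fn_mk, Fin.snoc_castSucc, Fin.snoc_last, Fin.succ_castSucc,
    Fin.succ_last, stepProd]

theorem pathSnoc_zero {N : ℕ} (p : Path N) (q : YoungDiagram × YoungDiagram) :
    (pathSnoc N (p, q)).2 0 = p.2 0 := by
  simp only [pathSnoc, Equiv.coe_fn_mk]
  exact Fin.snoc_castSucc (α := fun _ => YoungDiagram) q.2 p.2 0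

theorem pathSnoc_last {N : ℕ} (p : Path N) (q : YoungDiagram × YoungDiagram) :
    (pathSnoc N (p, q)).2 (Fin.last (N + 1)) = q.2 := by
  simp [pathSnoc]

/-- The path underlying a sequence of partitions. -/
def PartitionSeq.toPath {N : ℕ} (S : PartitionSeq N) : Path N := (S.lam, S.mu)

theorem PartitionSeq.toPath_injective {N : ℕ} :
    Function.Injective (PartitionSeq.toPath (N := N)) := by
  rintro ⟨l, m, _, _⟩ ⟨l', m', _, _⟩ h
  simp only [toPath, Prod.mk.injEq] at h
  obtain ⟨rfl, rfl⟩ := h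
  rfl

section Expansion

variable {A : Type*} [CommRing A] [Algebra ℂ A]

/-- The weight of one step of a path. -/
noncomputable def stepWeight {N : ℕ} (Hp Hm : Fin N → ℂ⟦X⟧) (a b : A) (k : Fin N)
    (lam mu nu : YoungDiagram) : A :=
  skTerm (Hp k) a lam mu * skTerm (Hm k) b lam nu

theorem mem_range_toPath {N : ℕ} {Hp Hm : Fin N → ℂ⟦X⟧} {a b : A} {p : Path N}
    (h : stepProd (stepWeight Hp Hm a b) p ≠ 0) : p ∈ Set.range (PartitionSeq.toPath (N := N)) := by
  have h1 : ∀ k, stepWeight Hp Hm a b k (p.1 k) (p.2 k.castSucc) (p.2 k.succ) ≠ 0 := fun k hk =>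
    h (Finset.prod_eq_zero (Finset.mem_univ k) hk)
  refine ⟨⟨p.1, p.2, fun k => ?_, fun k => ?_⟩, rfl⟩
  · by_contra hle
    exact h1 k (by rw [stepWeight, skTerm_of_not hle, zero_mul])
  · by_contra hle
    exact h1 k (by rw [stepWeight, skTerm_of_not hle, mul_zero])

theorem finite_support_step (H H' : ℂ⟦X⟧) {a : A} (b : A) (ha : IsNilpotent a)
    (mu : YoungDiagram) :
    {q : YoungDiagram × YoungDiagram | skTerm H a q.1 mu * skTerm H' b q.1 q.2 ≠ 0}.Finite := by
  refine Set.Finite.subset (Set.Finite.biUnion (colFinite_up H ha mu)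
    fun lam _ => (Set.finite_singleton lam).prod (finite_Iic lam)) ?_
  rintro ⟨lam, nu⟩ h
  rw [Set.mem_iUnion₂]
  refine ⟨lam, fun h0 => h ?_, rfl, ?_⟩
  · simp only at h0
    simp only [h0, zero_mul]
  · by_contra hle
    exact h (by simp only [skTerm_of_not hle, mul_zero])

theorem finite_support_path {N : ℕ} (Hp Hm : Fin N → ℂ⟦X⟧) {u a : A} (b : A) (hu : IsNilpotent u)
    (ha : IsNilpotent a) :
    {p : Path N | u ^ (p.2 0).card * stepProd (stepWeight Hp Hm a b) p ≠ 0}.Finite := by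
  induction N with
  | zero =>
    obtain ⟨K, hK⟩ := hu
    have hfin : (Set.univ.pi fun _ : Fin 1 => {lam : YoungDiagram | lam.card ≤ K}).Finite :=
      Set.Finite.pi fun _ => finite_card_le K
    refine ((Set.finite_univ (α := Fin 0 → YoungDiagram)).prod hfin).subset ?_
    rintro ⟨l, m⟩ h
    refine ⟨Set.mem_univ _, fun i _ => ?_⟩
    obtain rfl := Subsingleton.elim i 0
    by_contra h1
    exact h (by rw [pow_eq_zero_of_le (le_of_not_ge h1) hK, zero_mul])
  | succ N ih =>
    refine Set.Finite.subset (Set.Finite.image (pathSnoc N) (Set.Finite.subset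
      (Set.Finite.biUnion (ih (fun k => Hp k.castSucc) (fun k => Hm k.castSucc)) fun p _ =>
      (Set.finite_singleton p).prod (finite_support_step (Hp (Fin.last N)) (Hm (Fin.last N)) b ha
        (p.2 (Fin.last N)))) (subset_refl _))) ?_
    intro r hr
    obtain ⟨⟨p, q⟩, rfl⟩ := (pathSnoc N).surjective r
    refine ⟨(p, q), ?_, rfl⟩
    rw [Set.mem_ofPred_eq, pathSnoc_zero, stepProd_snoc, ← mul_assoc] at hr
    rw [Set.mem_iUnion₂]
    exact ⟨p, left_ne_zero_of_mul hr, rfl, right_ne_zero_of_mul hr⟩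

/-- Expansion of the transfer operator: a sum over all paths. -/
theorem linearCombination_wordOp {N : ℕ} (Hp Hm : Fin N → ℂ⟦X⟧) {u a : A} (b : A)
    (hu : IsNilpotent u) (ha : IsNilpotent a) (g : YoungDiagram → A) :
    Finsupp.linearCombination A g (wordOp Hp Hm a b (ket u)) =
      ∑ᶠ p : Path N, u ^ (p.2 0).card * stepProd (stepWeight Hp Hm a b) p *
        g (p.2 (Fin.last N)) := by
  induction N generalizing g with
  | zero =>
    rw [wordOp, Module.End.one_apply, Finsupp.linearCombination_apply, Finsupp.sum]
    have e : YoungDiagram ≃ Path 0 :=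
      (Equiv.funUnique (Fin 1) YoungDiagram).symm.trans (Equiv.uniqueProd _ _).symm
    rw [← finsum_eq_sum_of_support_subset (s := (ket u).support)]
    · rw [← finsum_comp_equiv
        ((Equiv.funUnique (Fin 1) YoungDiagram).symm.trans (Equiv.uniqueProd _ _).symm)]
      refine finsum_congr fun lam => ?_
      rw [ket_apply hu]
      simp [stepProd]
    · intro lam h
      rw [Finset.mem_coe, Finsupp.mem_support_iff]
      intro h0
      exact h (by simp only [h0, zero_smul])
  | succ N ih =>
    set Hp' := Hp (Fin.last N)
    set Hm' := Hm (Fin.last N)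
    have hstep : Finsupp.linearCombination A g ∘ₗ (downOp Hm' b * upOp Hp' a) =
        Finsupp.linearCombination A fun mu => ∑ᶠ q : YoungDiagram × YoungDiagram,
          skTerm Hp' a q.1 mu * skTerm Hm' b q.1 q.2 * g q.2 := by
      refine Finsupp.lhom_ext' fun mu => LinearMap.ext_ring ?_
      have hlin : ∀ w : YoungDiagram →₀ A,
          Finsupp.linearCombination A g w = ∑ᶠ nu, w nu * g nu := by
        intro w
        rw [Finsupp.linearCombination_apply, Finsupp.sum,
          finsum_eq_sum_of_support_subset (s := w.support)]
        · rfl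
        · intro nu hnu
          rw [Finset.mem_coe, Finsupp.mem_support_iff]
          intro h
          exact hnu (by simp only [h, zero_mul])
      rw [LinearMap.comp_apply, LinearMap.comp_apply, LinearMap.comp_apply, Finsupp.lsingle_apply,
        Finsupp.linearCombination_single, one_smul, Module.End.mul_apply]
      have hdown : Finsupp.linearCombination A g ∘ₗ downOp Hm' b =
          Finsupp.linearCombination A fun lam => ∑ᶠ nu, skTerm Hm' b lam nu * g nu := by
        refine Finsupp.lhom_ext' fun lam => LinearMap.ext_ring ?_
        rw [LinearMap.comp_apply, LinearMap.comp_apply, LinearMap.comp_apply,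
          Finsupp.lsingle_apply, Finsupp.linearCombination_single, one_smul, hlin]
        exact finsum_congr fun nu => by rw [downOp_single]
      have hdown' := LinearMap.congr_fun hdown (upOp Hp' a (Finsupp.single mu 1))
      rw [LinearMap.comp_apply] at hdown'
      have hfin : (Function.support fun q : YoungDiagram × YoungDiagram =>
          skTerm Hp' a q.1 mu * skTerm Hm' b q.1 q.2 * g q.2).Finite :=
        (finite_support_step Hp' Hm' b ha mu).subset fun q hq => left_ne_zero_of_mul hq
      rw [hdown', finsum_curry _ hfin, Finsupp.linearCombination_apply, Finsupp.sum,
        ← finsum_eq_sum_of_support_subset]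
      · refine finsum_congr fun lam => ?_
        rw [upOp_single Hp' ha, smul_eq_mul, mul_finsum']
        · exact finsum_congr fun nu => (mul_assoc _ _ _).symm
        · refine (finite_Iic lam).subset fun nu hnu => ?_
          by_contra hle
          exact hnu (by simp only [skTerm_of_not hle, zero_mul])
      · intro lam h
        rw [Finset.mem_coe, Finsupp.mem_support_iff]
        intro h0
        exact h (by simp only [h0, zero_smul])
    let F : Path (N + 1) → A := fun p => u ^ (p.2 0).card *
      stepProd (stepWeight Hp Hm a b) p * g (p.2 (Fin.last (N + 1)))
    have hF : (Function.support fun r => F (pathSnoc N r)).Finite :=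
      ((finite_support_path Hp Hm b hu ha).preimage (pathSnoc N).injective.injOn).subset
        fun p hp => left_ne_zero_of_mul hp
    rw [wordOp, Module.End.mul_apply, ← LinearMap.comp_apply, hstep, ih]
    refine Eq.trans ?_ ((finsum_curry _ hF).symm.trans (finsum_comp_equiv (pathSnoc N) (f := F)))
    refine finsum_congr fun p => ?_
    rw [mul_finsum']
    · refine finsum_congr fun q => ?_
      simp only [F]
      rw [pathSnoc_zero, stepProd_snoc, pathSnoc_last, stepWeight]
      simp only [Hp', Hm', mul_assoc]
      rfl
    · exact (finite_support_step Hp' Hm' b ha _).subset fun q hq => left_ne_zero_of_mul hq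

theorem bra_wordOp_ket_eq_finsum {N : ℕ} (Hp Hm : Fin N → ℂ⟦X⟧) {u a : A} (v b : A)
    (hu : IsNilpotent u) (ha : IsNilpotent a) :
    bra v (wordOp Hp Hm a b (ket u)) =
      ∑ᶠ S : PartitionSeq N, u ^ (S.mu 0).card * stepProd (stepWeight Hp Hm a b) S.toPath *
        v ^ (S.mu (Fin.last N)).card := by
  rw [bra, linearCombination_wordOp Hp Hm b hu ha, ← finsum_mem_univ]
  refine Eq.trans ?_ (finsum_mem_range (f := fun p : Path N => u ^ (p.2 0).card *
    stepProd (stepWeight Hp Hm a b) p * v ^ (p.2 (Fin.last N)).card) PartitionSeq.toPath_injective)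
  refine finsum_mem_inter_support_eq' _ _ _ fun p hp => ?_
  simp only [Set.mem_univ, true_iff]
  exact mem_range_toPath (right_ne_zero_of_mul (left_ne_zero_of_mul hp))

end Expansion

end FreeBoundarySchur

/-! ### The partition function as a formal power series -/

namespace FreeBoundarySchur

open PowerSeries

theorem constantCoeff_genFun (ρ : SymSpec) : constantCoeff (genFun ρ) = 1 := by
  rw [← coeff_zero_eq_constantCoeff_apply, genFun, coeff_mk]
  have h : complete 0 = 1 := by
    apply Subtype.ext
    ext m
    classical
    rw [coeff_complete, OneMemClass.coe_one, MvPowerSeries.coeff_one]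
    congr 1
    exact propext (Finsupp.degree_eq_zero_iff m)
  rw [h, map_one]

theorem scaleSpec_apply_skewSchur (s : ℂ) (ρ : SymSpec) {lam mu : YoungDiagram} (h : mu ≤ lam) :
    scaleSpec s ρ (skewSchur lam mu) = s ^ (lam.card - mu.card) * ρ (skewSchur lam mu) := by
  rw [apply_skewSchur, apply_skewSchur, genFun_scaleSpec]
  exact sk_eq_pow_mul _ _ _ h fun m _ => coeff_rescale _ _ _

theorem littlewoodTerm_scaleSpec (s : ℂ) (ρ : SymSpec) (lam : YoungDiagram) :
    littlewoodTerm (scaleSpec s ρ) lam = s ^ lam.card * littlewoodTerm ρ lam := by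
  rw [littlewoodTerm, schur, scaleSpec_apply_skewSchur s ρ bot_le, card_bot, Nat.sub_zero]
  rfl

theorem cauchyTerm_scaleSpec (s s' : ℂ) (ρ ρ' : SymSpec) (lam : YoungDiagram) :
    cauchyTerm (scaleSpec s ρ) (scaleSpec s' ρ') lam =
      (s * s') ^ lam.card * cauchyTerm ρ ρ' lam := by
  have h1 := littlewoodTerm_scaleSpec s ρ lam
  have h2 := littlewoodTerm_scaleSpec s' ρ' lam
  rw [littlewoodTerm, littlewoodTerm] at h1 h2
  rw [cauchyTerm, cauchyTerm, h1, h2, mul_pow]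
  ring

/-- The degree of a sequence of partitions: the sizes of both end points and of all steps. -/
def seqDegree {N : ℕ} (S : PartitionSeq N) : ℕ :=
  (S.mu 0).card + (S.mu (Fin.last N)).card +
    ∑ k : Fin N, (((S.lam k).card - (S.mu k.castSucc).card) +
      ((S.lam k).card - (S.mu k.succ).card))

theorem finiteDegree_seqDegree {N : ℕ} : FiniteDegree (seqDegree (N := N)) := by
  intro d
  set B := (N + 2) * d with hB
  have hfin : {p : Path N | (∀ k, (p.1 k).card ≤ B) ∧ ∀ j, (p.2 j).card ≤ B}.Finite :=
    (Set.Finite.pi' (ι := Fin N) fun _ => finite_card_le B).prod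
      (Set.Finite.pi' (ι := Fin (N + 1)) fun _ => finite_card_le B)
  refine (hfin.preimage PartitionSeq.toPath_injective.injOn).subset fun S hS => ?_
  have hS' : seqDegree S ≤ d := hS
  have hstep : ∀ k, (S.lam k).card ≤ (S.mu k.castSucc).card + d := by
    intro k
    have := Finset.single_le_sum (f := fun k : Fin N =>
      ((S.lam k).card - (S.mu k.castSucc).card) + ((S.lam k).card - (S.mu k.succ).card))
      (fun _ _ => Nat.zero_le _) (Finset.mem_univ k)
    simp only [seqDegree] at hS' this
    omega
  have hmu : ∀ j : Fin (N + 1), (S.mu j).card ≤ ((j : ℕ) + 1) * d := by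
    intro j
    induction j using Fin.induction with
    | zero => simp only [seqDegree, Fin.val_zero] at hS' ⊢; omega
    | succ k ih =>
      have h1 := card_mono (S.right_le k)
      have h2 := hstep k
      simp only [Fin.val_castSucc, Fin.val_succ] at ih ⊢
      rw [add_mul _ 1 d]
      omega
  have hmono : ∀ j : ℕ, j ≤ N + 2 → j * d ≤ B := fun j hj => Nat.mul_le_mul_right d hj
  refine ⟨fun k => ?_, fun j => (hmu j).trans (hmono _ (by have := j.2; omega))⟩
  have h1 := hstep k
  have h2 := hmu k.castSucc
  have h3 := hmono (k + 2) (by have := k.2; omega)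
  change (S.lam k).card ≤ B
  simp only [Fin.val_castSucc] at h2
  rw [add_mul] at h2 h3
  omega

/-- The series `H(ρ;ρ')`, where both specializations are scaled by the variable. -/
noncomputable def pairSeries (ρ ρ' : SymSpec) : ℂ⟦X⟧ :=
  gradedSeries (fun lam => 2 * lam.card) (cauchyTerm ρ ρ')

/-- The `n + 1`-st factor of the infinite product, where the parameters `u`, `v` and both
specializations are scaled by the variable. -/
noncomputable def reflectSeries (u v : ℝ) (ρp ρm : SymSpec) (n : ℕ) : ℂ⟦X⟧ :=
  gradedSeries (fun lam => (2 * (n + 1)) * lam.card)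
      (littlewoodTerm (scaleSpec ((u : ℂ) ^ n * (v : ℂ) ^ (n + 1)) ρp)) *
    gradedSeries (fun lam => (2 * (n + 1)) * lam.card)
      (littlewoodTerm (scaleSpec ((u : ℂ) ^ (n + 1) * (v : ℂ) ^ n) ρm)) *
    gradedSeries (fun lam => (4 * (n + 1) + 2) * lam.card)
      (cauchyTerm (scaleSpec ((u : ℂ) ^ (2 * (n + 1))) ρp)
        (scaleSpec ((v : ℂ) ^ (2 * (n + 1))) ρm)) *
    gradedSeries (fun k => (2 * (n + 1)) * k) (fun k => ((u : ℂ) ^ (n + 1) * (v : ℂ) ^ (n + 1)) ^ k)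

theorem cauchyAt_eq_mk {K : ℕ} (ρ ρ' : SymSpec) (s s' : ℂ) {c : ℕ} (hc : 0 < c) :
    cauchyAt (genFun ρ) (genFun ρ') (algebraMap ℂ (Trunc K) (s * s') * truncVar K ^ c) =
      Ideal.Quotient.mk _ (gradedSeries (fun lam => c * lam.card)
        (cauchyTerm (scaleSpec s ρ) (scaleSpec s' ρ'))) := by
  rw [mk_gradedSeries (finiteDegree_mul_card hc), cauchyAt]
  refine finsum_congr fun lam => ?_
  rw [cauchyTerm_scaleSpec, cauchyTerm, schur, apply_skewSchur, apply_skewSchur, mul_pow, pow_mul,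
    map_mul (algebraMap ℂ (Trunc K)) (_ ^ _), map_pow]
  ring

theorem littlewoodAt_eq_mk {K : ℕ} (ρ : SymSpec) (s : ℂ) {c : ℕ} (hc : 0 < c) :
    littlewoodAt (genFun ρ) (algebraMap ℂ (Trunc K) s * truncVar K ^ c) =
      Ideal.Quotient.mk _ (gradedSeries (fun lam => c * lam.card)
        (littlewoodTerm (scaleSpec s ρ))) := by
  rw [mk_gradedSeries (finiteDegree_mul_card hc), littlewoodAt]
  refine finsum_congr fun lam => ?_
  rw [littlewoodTerm_scaleSpec, littlewoodTerm, schur, apply_skewSchur, mul_pow, pow_mul,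
    map_mul (algebraMap ℂ (Trunc K)) (_ ^ _), map_pow]
  ring

theorem cauchyTerm_scaleSpec_one (ρ ρ' : SymSpec) :
    cauchyTerm (scaleSpec 1 ρ) (scaleSpec 1 ρ') = cauchyTerm ρ ρ' := by
  ext lam
  rw [cauchyTerm_scaleSpec, one_mul, one_pow, one_mul]

/-- The product formula, as an identity of formal power series. -/
theorem coeff_gradedSeries_weight {N : ℕ} (u v : ℝ) (ρp ρm : Fin N → SymSpec) {d K : ℕ}
    (hd : d < K) :
    coeff d (gradedSeries seqDegree (weight u v ρp ρm)) =
      coeff d ((∏ p : Fin N × Fin N with p.1 ≤ p.2, pairSeries (ρp p.1) (ρm p.2)) *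
        ∏ n ∈ Finset.range (2 * K), reflectSeries u v (iUnionSpec ρp) (iUnionSpec ρm) n) := by
  refine mk_eq_mk_iff.1 ?_ d hd
  set t := truncVar K with ht
  set U : Trunc K := algebraMap ℂ (Trunc K) u * t with hU
  set V : Trunc K := algebraMap ℂ (Trunc K) v * t with hV
  have htn : IsNilpotent t := isNilpotent_truncVar K
  have hUn : IsNilpotent U := (Commute.all _ _).isNilpotent_mul_left htn
  have hUV : (U * V) ^ (2 * K) = 0 := by
    rw [hU, hV, show algebraMap ℂ (Trunc K) u * t * (algebraMap ℂ (Trunc K) v * t) =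
      algebraMap ℂ (Trunc K) u * algebraMap ℂ (Trunc K) v * t ^ 2 by ring, mul_pow, ← pow_mul,
      show t ^ (2 * (2 * K)) = 0 from pow_eq_zero_of_le (by omega) (truncVar_pow K), mul_zero]
  have key := (bra_wordOp_ket_eq_finsum (fun k => genFun (ρp k)) (fun k => genFun (ρm k)) V t
    hUn htn).symm.trans (bra_wordOp_ket (fun k => constantCoeff_genFun (ρp k))
      (fun k => constantCoeff_genFun (ρm k)) V hUn htn htn hUV)
  rw [mk_gradedSeries finiteDegree_seqDegree, map_mul, map_prod, map_prod]
  refine Eq.trans (finsum_congr fun S => ?_) (key.trans ?_)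
  · rw [weight, seqDegree, stepProd, hU, hV, mul_pow, mul_pow, map_mul, map_mul, map_pow, map_pow,
      map_prod, pow_add, pow_add, ← Finset.prod_pow_eq_pow_sum]
    have : ∀ k : Fin N, stepWeight (fun k => genFun (ρp k)) (fun k => genFun (ρm k)) t t k
        (S.toPath.1 k) (S.toPath.2 k.castSucc) (S.toPath.2 k.succ) =
        algebraMap ℂ (Trunc K) (ρp k (skewSchur (S.lam k) (S.mu k.castSucc)) *
          ρm k (skewSchur (S.lam k) (S.mu k.succ))) *
          t ^ (((S.lam k).card - (S.mu k.castSucc).card) +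
            ((S.lam k).card - (S.mu k.succ).card)) := by
      intro k
      rw [stepWeight, PartitionSeq.toPath, skTerm_of_le (S.left_le k),
        skTerm_of_le (S.right_le k), apply_skewSchur, apply_skewSchur, map_mul, pow_add]
      ring
    rw [Finset.prod_congr rfl fun k _ => this k, Finset.prod_mul_distrib]
    ring
  · congr 1
    · refine Finset.prod_congr rfl fun p _ => ?_
      rw [pairSeries, ← cauchyTerm_scaleSpec_one, ← cauchyAt_eq_mk _ _ _ _ two_pos]
      congr 1
      rw [mul_one, map_one, one_mul, pow_two]
    · refine Finset.prod_congr rfl fun n _ => ?_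
      rw [reflectSeries, map_mul, map_mul, map_mul, ← littlewoodAt_eq_mk _ _ (by positivity),
        ← littlewoodAt_eq_mk _ _ (by positivity), ← cauchyAt_eq_mk _ _ _ _ (by positivity),
        mk_gradedSeries (finiteDegree_mul (by positivity)), reflectAt, genFun_iUnionSpec,
        genFun_iUnionSpec]
      congr 1
      · congr 1
        · congr 2
          all_goals
            simp only [hU, hV, map_mul, map_pow]
            ring
        · congr 1
          simp only [hU, hV, map_mul, map_pow]
          ring
      · refine finsum_congr fun k => ?_
        simp only [hU, hV, map_mul, map_pow]
        ring

end FreeBoundarySchur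

/-! ### The absolute mass of a power series -/

namespace FreeBoundarySchur

open PowerSeries
open scoped ComplexOrder

theorem enorm_add_of_nonneg {a b : ℂ} (ha : 0 ≤ a) (hb : 0 ≤ b) : ‖a + b‖ₑ = ‖a‖ₑ + ‖b‖ₑ := by
  have h : ‖a + b‖ = ‖a‖ + ‖b‖ := by
    conv_lhs => rw [Complex.eq_coe_norm_of_nonneg ha, Complex.eq_coe_norm_of_nonneg hb,
      ← Complex.ofReal_add]
    exact Complex.norm_of_nonneg (by positivity)
  rw [← ofReal_norm, h, ENNReal.ofReal_add (norm_nonneg _) (norm_nonneg _),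
    ofReal_norm, ofReal_norm]

theorem enorm_sum_of_nonneg {ι : Type*} (s : Finset ι) {f : ι → ℂ} (hf : ∀ i, 0 ≤ f i) :
    ‖∑ i ∈ s, f i‖ₑ = ∑ i ∈ s, ‖f i‖ₑ := by
  classical
  induction s using Finset.induction_on with
  | empty => simp
  | insert i s hi ih =>
    rw [Finset.sum_insert hi, Finset.sum_insert hi, enorm_add_of_nonneg (hf i)
      (Finset.sum_nonneg fun j _ => hf j), ih]

theorem enorm_le_enorm_of_nonneg {a b : ℂ} (ha : 0 ≤ a) (hab : a ≤ b) : ‖a‖ₑ ≤ ‖b‖ₑ := by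
  have h := enorm_add_of_nonneg ha (sub_nonneg.2 hab)
  rw [add_sub_cancel] at h
  rw [h]
  exact le_self_add

/-- The sum of the absolute values of the coefficients. -/
noncomputable def mass (p : ℂ⟦X⟧) : ℝ≥0∞ := ∑' d, ‖coeff d p‖ₑ

/-- The sum of the coefficients, that is, the value at one. -/
noncomputable def evalOne (p : ℂ⟦X⟧) : ℂ := ∑' d, coeff d p

/-- All coefficients are nonnegative real numbers. -/
def NonnegCoeff (p : ℂ⟦X⟧) : Prop := ∀ d, 0 ≤ coeff d p

theorem NonnegCoeff.mul {p q : ℂ⟦X⟧} (hp : NonnegCoeff p) (hq : NonnegCoeff q) :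
    NonnegCoeff (p * q) := fun d => by
  rw [coeff_mul]
  exact Finset.sum_nonneg fun x _ => mul_nonneg (hp _) (hq _)

theorem nonnegCoeff_one : NonnegCoeff 1 := fun d => by
  rw [coeff_one]
  split_ifs
  · exact zero_le_one
  · exact le_rfl

theorem NonnegCoeff.prod {ι : Type*} (s : Finset ι) {p : ι → ℂ⟦X⟧}
    (hp : ∀ i, NonnegCoeff (p i)) : NonnegCoeff (∏ i ∈ s, p i) := by
  classical
  induction s using Finset.induction_on with
  | empty => exact nonnegCoeff_one
  | insert i s hi ih =>
    rw [Finset.prod_insert hi]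
    exact (hp i).mul ih

theorem mass_one : mass 1 = 1 := by
  rw [mass, tsum_eq_single 0]
  · simp
  · intro d hd
    rw [coeff_one, if_neg hd, enorm_zero]

theorem tsum_mul_tsum_eq_tsum_antidiagonal (f g : ℕ → ℝ≥0∞) :
    (∑' i, f i) * ∑' j, g j =
      ∑' d, ∑ x ∈ Finset.HasAntidiagonal.antidiagonal d, f x.1 * g x.2 := by
  rw [← ENNReal.tsum_mul_right]
  simp only [← ENNReal.tsum_mul_left]
  rw [← ENNReal.tsum_prod (f := fun i j => f i * g j),
    ← Finset.HasAntidiagonal.sigmaAntidiagonalEquivProd.tsum_eq, ENNReal.tsum_sigma']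
  refine tsum_congr fun d => ?_
  exact Finset.tsum_subtype (Finset.HasAntidiagonal.antidiagonal d)
    (fun x : ℕ × ℕ => f x.1 * g x.2)

theorem mass_mul_le (p q : ℂ⟦X⟧) : mass (p * q) ≤ mass p * mass q := by
  rw [mass, mass, mass, tsum_mul_tsum_eq_tsum_antidiagonal]
  refine ENNReal.tsum_le_tsum fun d => ?_
  rw [coeff_mul]
  refine (enorm_sum_le _ _).trans (le_of_eq ?_)
  exact Finset.sum_congr rfl fun x _ => enorm_mul _ _

theorem mass_mul {p q : ℂ⟦X⟧} (hp : NonnegCoeff p) (hq : NonnegCoeff q) :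
    mass (p * q) = mass p * mass q := by
  rw [mass, mass, mass, tsum_mul_tsum_eq_tsum_antidiagonal]
  refine tsum_congr fun d => ?_
  rw [coeff_mul, enorm_sum_of_nonneg (f := fun x : ℕ × ℕ => coeff x.1 p * coeff x.2 q) _
    fun x => mul_nonneg (hp x.1) (hq x.2)]
  exact Finset.sum_congr rfl fun x _ => enorm_mul _ _

theorem mass_prod_le {ι : Type*} (s : Finset ι) (p : ι → ℂ⟦X⟧) :
    mass (∏ i ∈ s, p i) ≤ ∏ i ∈ s, mass (p i) := by
  classical
  induction s using Finset.induction_on with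
  | empty => rw [Finset.prod_empty, Finset.prod_empty, mass_one]
  | insert i s hi ih =>
    rw [Finset.prod_insert hi, Finset.prod_insert hi]
    exact (mass_mul_le _ _).trans (mul_le_mul_right ih _)

theorem mass_prod {ι : Type*} (s : Finset ι) {p : ι → ℂ⟦X⟧} (hp : ∀ i, NonnegCoeff (p i)) :
    mass (∏ i ∈ s, p i) = ∏ i ∈ s, mass (p i) := by
  classical
  induction s using Finset.induction_on with
  | empty => rw [Finset.prod_empty, Finset.prod_empty, mass_one]
  | insert i s hi ih =>
    rw [Finset.prod_insert hi, Finset.prod_insert hi, mass_mul (hp i) (NonnegCoeff.prod s hp), ih]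

theorem mass_ne_top_iff {p : ℂ⟦X⟧} : mass p ≠ ∞ ↔ Summable fun d => ‖coeff d p‖ :=
  tsum_enorm_ne_top_iff_summable_norm

theorem evalOne_one : evalOne 1 = 1 := by
  rw [evalOne, tsum_eq_single 0]
  · simp
  · intro d hd
    rw [coeff_one, if_neg hd]

theorem evalOne_mul {p q : ℂ⟦X⟧} (hp : mass p ≠ ∞) (hq : mass q ≠ ∞) :
    evalOne (p * q) = evalOne p * evalOne q := by
  rw [evalOne, evalOne, evalOne, tsum_mul_tsum_eq_tsum_sum_antidiagonal_of_summable_norm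
    (mass_ne_top_iff.1 hp) (mass_ne_top_iff.1 hq)]
  exact tsum_congr fun d => coeff_mul _ _ _

theorem mass_prod_ne_top {ι : Type*} (s : Finset ι) {p : ι → ℂ⟦X⟧} (hp : ∀ i ∈ s, mass (p i) ≠ ∞) :
    mass (∏ i ∈ s, p i) ≠ ∞ :=
  ((mass_prod_le s p).trans_lt (ENNReal.prod_lt_top fun i hi => (hp i hi).lt_top)).ne

theorem evalOne_prod {ι : Type*} (s : Finset ι) {p : ι → ℂ⟦X⟧} (hp : ∀ i ∈ s, mass (p i) ≠ ∞) :
    evalOne (∏ i ∈ s, p i) = ∏ i ∈ s, evalOne (p i) := by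
  classical
  induction s using Finset.induction_on with
  | empty => rw [Finset.prod_empty, Finset.prod_empty, evalOne_one]
  | insert i s hi ih =>
    have hs : ∀ j ∈ s, mass (p j) ≠ ∞ := fun j hj => hp j (Finset.mem_insert_of_mem hj)
    rw [Finset.prod_insert hi, Finset.prod_insert hi,
      evalOne_mul (hp i (Finset.mem_insert_self i s)) (mass_prod_ne_top s hs), ih hs]

section Graded

variable {ι : Type*} {deg : ι → ℕ}

theorem tsum_enorm_fiber (deg : ι → ℕ) (w : ι → ℂ) :
    ∑' i, ‖w i‖ₑ = ∑' d, ∑' i : {i // deg i = d}, ‖w i‖ₑ := by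
  rw [← (Equiv.sigmaFiberEquiv deg).tsum_eq, ENNReal.tsum_sigma']
  rfl

theorem mass_gradedSeries_le (h : FiniteDegree deg) (w : ι → ℂ) :
    mass (gradedSeries deg w) ≤ ∑' i, ‖w i‖ₑ := by
  rw [mass, tsum_enorm_fiber deg]
  refine ENNReal.tsum_le_tsum fun d => ?_
  have := h.finite_fiber d
  have := Fintype.ofFinite {i // deg i = d}
  rw [coeff_gradedSeries, finsum_eq_sum_of_fintype, tsum_fintype]
  exact enorm_sum_le _ _

theorem mass_gradedSeries (h : FiniteDegree deg) {w : ι → ℂ} (hw : ∀ i, 0 ≤ w i) :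
    mass (gradedSeries deg w) = ∑' i, ‖w i‖ₑ := by
  rw [mass, tsum_enorm_fiber deg]
  refine tsum_congr fun d => ?_
  have := h.finite_fiber d
  have := Fintype.ofFinite {i // deg i = d}
  rw [coeff_gradedSeries, finsum_eq_sum_of_fintype, tsum_fintype]
  exact enorm_sum_of_nonneg _ fun i => hw i

theorem nonnegCoeff_gradedSeries {w : ι → ℂ} (hw : ∀ i, 0 ≤ w i) :
    NonnegCoeff (gradedSeries deg w) := fun d => by
  rw [coeff_gradedSeries]
  exact finsum_nonneg fun i => hw i

theorem evalOne_gradedSeries (h : FiniteDegree deg) {w : ι → ℂ} (hw : Summable w) :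
    evalOne (gradedSeries deg w) = ∑' i, w i := by
  have hw' := (Equiv.sigmaFiberEquiv deg).summable_iff.2 hw
  rw [evalOne, ← (Equiv.sigmaFiberEquiv deg).tsum_eq w]
  change _ = ∑' c, (w ∘ Equiv.sigmaFiberEquiv deg) c
  rw [Summable.tsum_sigma' (fun d => hw'.sigma_factor d) hw']
  refine tsum_congr fun d => ?_
  have := h.finite_fiber d
  have := Fintype.ofFinite {i // deg i = d}
  rw [coeff_gradedSeries, finsum_eq_sum_of_fintype, tsum_fintype]
  rfl

theorem mass_gradedSeries_ne_top (h : FiniteDegree deg) {w : ι → ℂ} (hw : Summable w) :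
    mass (gradedSeries deg w) ≠ ∞ :=
  ((mass_gradedSeries_le h w).trans_lt
    (tsum_enorm_ne_top_iff_summable_norm.2 hw.norm).lt_top).ne

/-- A graded series is one plus terms of high order, if only one index has a low degree. -/
theorem X_pow_dvd_gradedSeries_sub_one {w : ι → ℂ} {i₀ : ι} (h₀ : deg i₀ = 0) (hw : w i₀ = 1)
    {n : ℕ} (hn : ∀ i, i ≠ i₀ → n ≤ deg i) : (X : ℂ⟦X⟧) ^ n ∣ gradedSeries deg w - 1 := by
  rw [X_pow_dvd_iff]
  intro d hd
  rw [map_sub, coeff_gradedSeries, coeff_one]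
  split_ifs with h
  · subst h
    rw [finsum_eq_single _ ⟨i₀, h₀⟩, hw, sub_self]
    rintro ⟨i, hi⟩ hne
    have := hn i fun h => hne (Subtype.ext h)
    omega
  · rw [sub_zero]
    have : IsEmpty {i // deg i = d} := ⟨fun ⟨i, hi⟩ => by
      by_cases h1 : i = i₀
      · subst h1
        omega
      · have := hn i h1
        omega⟩
    exact finsum_of_isEmpty _

end Graded

/-! ### Infinite products of power series -/

theorem X_pow_dvd_mul_sub_one {p q : ℂ⟦X⟧} {n : ℕ} (hp : X ^ n ∣ p - 1) (hq : X ^ n ∣ q - 1) :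
    X ^ n ∣ p * q - 1 := by
  rw [show p * q - 1 = (p - 1) * q + (q - 1) by ring]
  exact dvd_add (hp.mul_right q) hq

theorem coeff_le_coeff_mul {p q : ℂ⟦X⟧} (hp : NonnegCoeff p) (hq : NonnegCoeff q)
    (h1 : constantCoeff q = 1) (d : ℕ) : coeff d p ≤ coeff d (p * q) := by
  rw [coeff_mul]
  have := Finset.single_le_sum (f := fun x : ℕ × ℕ => coeff x.1 p * coeff x.2 q)
    (fun x _ => mul_nonneg (hp x.1) (hq x.2))
    (Finset.HasAntidiagonal.mem_antidiagonal.2 (show ((d, 0) : ℕ × ℕ).1 + (d, 0).2 = d from rfl))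
  simpa [h1] using this

theorem coeff_prod_range_mono {p : ℂ⟦X⟧} {q : ℕ → ℂ⟦X⟧} (hp : NonnegCoeff p)
    (hq : ∀ n, NonnegCoeff (q n)) (h1 : ∀ n, constantCoeff (q n) = 1) (d : ℕ) :
    Monotone fun M => coeff d (p * ∏ n ∈ Finset.range M, q n) := by
  refine monotone_nat_of_le_succ fun M => ?_
  rw [Finset.prod_range_succ, ← mul_assoc]
  exact coeff_le_coeff_mul (hp.mul (NonnegCoeff.prod _ hq)) (hq M) (h1 M) d

/-- Monotone convergence: the mass of an infinite product with nonnegative coefficients is the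
supremum of the masses of its partial products. -/
theorem mass_eq_mul_iSup {P p : ℂ⟦X⟧} {q : ℕ → ℂ⟦X⟧} (hp : NonnegCoeff p)
    (hq : ∀ n, NonnegCoeff (q n)) (h1 : ∀ n, constantCoeff (q n) = 1)
    (hP : ∀ d K, d < K → coeff d P = coeff d (p * ∏ n ∈ Finset.range (2 * K), q n)) :
    mass P = mass p * ⨆ M, ∏ n ∈ Finset.range M, mass (q n) := by
  have hmass : ∀ M, mass p * ∏ n ∈ Finset.range M, mass (q n) =
      mass (p * ∏ n ∈ Finset.range M, q n) := fun M => by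
    rw [mass_mul hp (NonnegCoeff.prod _ hq), mass_prod _ hq]
  rw [ENNReal.mul_iSup]
  refine le_antisymm ?_ (iSup_le fun M => ?_)
  · rw [mass, ENNReal.tsum_eq_iSup_nat]
    refine iSup_le fun K => le_trans ?_ (le_iSup _ (2 * K))
    rw [hmass, mass]
    refine le_trans (le_of_eq (Finset.sum_congr rfl fun d hd => ?_))
      (ENNReal.sum_le_tsum (Finset.range K))
    rw [hP d K (Finset.mem_range.1 hd)]
  · rw [hmass, mass, mass]
    refine ENNReal.tsum_le_tsum fun d => ?_
    rw [hP d (max (d + 1) M) (by omega)]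
    refine enorm_le_enorm_of_nonneg (hp.mul (NonnegCoeff.prod _ hq) d) ?_
    exact coeff_prod_range_mono hp hq h1 d (by omega)

/-- The power series of the absolute values of the coefficients. -/
noncomputable def absSeries (p : ℂ⟦X⟧) : ℂ⟦X⟧ := PowerSeries.mk fun d => (‖coeff d p‖ : ℂ)

theorem coeff_absSeries (p : ℂ⟦X⟧) (d : ℕ) : coeff d (absSeries p) = (‖coeff d p‖ : ℂ) :=
  coeff_mk _ _

theorem nonnegCoeff_absSeries (p : ℂ⟦X⟧) : NonnegCoeff (absSeries p) := fun d => by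
  rw [coeff_absSeries]
  exact_mod_cast norm_nonneg _

theorem mass_absSeries (p : ℂ⟦X⟧) : mass (absSeries p) = mass p := by
  refine tsum_congr fun d => ?_
  rw [coeff_absSeries, ← ofReal_norm, ← ofReal_norm,
    Complex.norm_of_nonneg (norm_nonneg _)]

theorem enorm_coeff_mul_le {p q p' q' : ℂ⟦X⟧} (hp : ∀ d, ‖coeff d p‖ₑ ≤ ‖coeff d p'‖ₑ)
    (hq : ∀ d, ‖coeff d q‖ₑ ≤ ‖coeff d q'‖ₑ) (hp' : NonnegCoeff p') (hq' : NonnegCoeff q') (d : ℕ) :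
    ‖coeff d (p * q)‖ₑ ≤ ‖coeff d (p' * q')‖ₑ := by
  rw [coeff_mul, coeff_mul, enorm_sum_of_nonneg
    (f := fun x : ℕ × ℕ => coeff x.1 p' * coeff x.2 q') _
    fun x => mul_nonneg (hp' x.1) (hq' x.2)]
  refine (enorm_sum_le _ _).trans (Finset.sum_le_sum fun x _ => ?_)
  rw [enorm_mul, enorm_mul]
  exact mul_le_mul' (hp _) (hq _)

theorem enorm_coeff_prod_range_le (p : ℂ⟦X⟧) (q : ℕ → ℂ⟦X⟧) (M d : ℕ) :
    ‖coeff d (p * ∏ n ∈ Finset.range M, q n)‖ₑ ≤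
      ‖coeff d (absSeries p * ∏ n ∈ Finset.range M, absSeries (q n))‖ₑ := by
  have habs : ∀ (p : ℂ⟦X⟧) (d : ℕ), ‖coeff d p‖ₑ ≤ ‖coeff d (absSeries p)‖ₑ := fun p d => by
    rw [coeff_absSeries, ← ofReal_norm, ← ofReal_norm,
      Complex.norm_of_nonneg (norm_nonneg _)]
  induction M generalizing d with
  | zero => simpa using habs p d
  | succ M ih =>
    rw [Finset.prod_range_succ, Finset.prod_range_succ, ← mul_assoc, ← mul_assoc]
    exact enorm_coeff_mul_le ih (habs _) ((nonnegCoeff_absSeries p).mul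
      (NonnegCoeff.prod _ fun n => nonnegCoeff_absSeries _)) (nonnegCoeff_absSeries _) d

theorem constantCoeff_eq_one {q : ℂ⟦X⟧} {n : ℕ} (h : X ^ (n + 1) ∣ q - 1) :
    constantCoeff q = 1 := by
  have := X_pow_dvd_iff.1 h 0 (Nat.succ_pos n)
  rw [map_sub, sub_eq_zero] at this
  simpa using this

theorem coeff_prod_range_stable {q : ℕ → ℂ⟦X⟧} (h : ∀ n, X ^ (n + 1) ∣ q n - 1) (p : ℂ⟦X⟧)
    {d M : ℕ} (hM : d ≤ M) :
    coeff d (p * ∏ n ∈ Finset.range M, q n) = coeff d (p * ∏ n ∈ Finset.range d, q n) := by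
  induction M, hM using Nat.le_induction with
  | base => rfl
  | succ M hM ih =>
    rw [← ih, Finset.prod_range_succ, ← sub_eq_zero, ← map_sub]
    refine X_pow_dvd_iff.1 (?_ : X ^ (M + 1) ∣ _) d (by omega)
    rw [show p * ((∏ n ∈ Finset.range M, q n) * q M) - p * ∏ n ∈ Finset.range M, q n =
      p * (∏ n ∈ Finset.range M, q n) * (q M - 1) by ring]
    exact (h M).mul_left _

theorem X_pow_dvd_absSeries_sub_one {q : ℂ⟦X⟧} {n : ℕ} (h : X ^ n ∣ q - 1) :
    X ^ n ∣ absSeries q - 1 := by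
  rw [X_pow_dvd_iff] at h ⊢
  intro d hd
  have h1 := h d hd
  rw [map_sub, sub_eq_zero, coeff_one] at h1
  rw [map_sub, coeff_absSeries, h1, coeff_one]
  split_ifs <;> simp

theorem enorm_evalOne_le (p : ℂ⟦X⟧) : ‖evalOne p‖ₑ ≤ mass p := enorm_tsum_le_tsum_enorm

theorem mass_eq_one_add {q : ℂ⟦X⟧} (h : constantCoeff q = 1) : mass q = 1 + mass (q - 1) := by
  rw [mass, mass, tsum_eq_zero_add' (f := fun d => ‖coeff d q‖ₑ) ENNReal.summable,
    tsum_eq_zero_add' (f := fun d => ‖coeff d (q - 1)‖ₑ) ENNReal.summable]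
  have h0 : coeff 0 q = 1 := by simpa using h
  simp only [map_sub, coeff_one, h0, if_true, sub_self, enorm_zero, zero_add,
    Nat.add_eq_zero_iff, one_ne_zero, and_false, if_false, sub_zero, enorm_one]

/-- Evaluation at one of an infinite product of power series whose masses are controlled. -/
theorem evalOne_eq_mul_tprod {P p : ℂ⟦X⟧} {q : ℕ → ℂ⟦X⟧} {s : ℕ → ℝ} (hs0 : ∀ n, 0 ≤ s n)
    (hs : Summable s) (hq : ∀ n, mass (q n) ≤ ENNReal.ofReal (Real.exp (s n)))
    (hX : ∀ n, X ^ (n + 1) ∣ q n - 1) (hp : mass p ≠ ∞)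
    (hP : ∀ d K, d < K → coeff d P = coeff d (p * ∏ n ∈ Finset.range (2 * K), q n)) :
    (Multipliable fun n => evalOne (q n)) ∧
      evalOne P = evalOne p * ∏' n, evalOne (q n) := by
  have hqtop : ∀ n, mass (q n) ≠ ∞ := fun n => ((hq n).trans_lt ENNReal.ofReal_lt_top).ne
  have hmult : Multipliable fun n => evalOne (q n) := by
    have hbound : ∀ n, ‖evalOne (q n) - 1‖ ≤ s n * Real.exp (∑' n, s n) := by
      intro n
      have h1 : evalOne (q n) - 1 = evalOne (q n - 1) := by
        rw [evalOne, evalOne]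
        conv_lhs => rw [← evalOne_one, evalOne]
        rw [← Summable.tsum_sub]
        · exact tsum_congr fun d => (map_sub _ _ _).symm
        · exact (mass_ne_top_iff.1 (hqtop n)).of_norm
        · exact (mass_ne_top_iff.1 (by rw [mass_one]; exact ENNReal.one_ne_top)).of_norm
      have h2 := mass_eq_one_add (constantCoeff_eq_one (hX n))
      have h3 : mass (q n - 1) ≤ ENNReal.ofReal (Real.exp (s n) - 1) := by
        rw [ENNReal.ofReal_sub _ zero_le_one, ENNReal.ofReal_one]
        refine ENNReal.le_sub_of_add_le_left ENNReal.one_ne_top ?_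
        rw [← h2]
        exact hq n
      have h4 : ‖evalOne (q n) - 1‖ ≤ Real.exp (s n) - 1 := by
        rw [h1]
        refine (ENNReal.ofReal_le_ofReal_iff (sub_nonneg.2 (Real.one_le_exp (hs0 n)))).1 ?_
        rw [ofReal_norm]
        exact (enorm_evalOne_le _).trans h3
      have h5 : Real.exp (s n) - 1 ≤ s n * Real.exp (s n) := by
        have h6 := Real.add_one_le_exp (-(s n))
        have h7 : Real.exp (-(s n)) * Real.exp (s n) = 1 := by
          rw [← Real.exp_add, neg_add_cancel, Real.exp_zero]
        nlinarith [Real.exp_pos (s n)]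
      refine h4.trans (h5.trans (mul_le_mul_of_nonneg_left ?_ (hs0 n)))
      exact Real.exp_le_exp.2 (hs.le_tsum n fun m _ => hs0 m)
    have h := multipliable_one_add_of_summable (f := fun n => evalOne (q n) - 1)
      (Summable.of_nonneg_of_le (fun n => norm_nonneg _) hbound (hs.mul_right _))
    simpa using h
  refine ⟨hmult, ?_⟩
  -- the majorant: the product of the series of absolute values
  set p' := absSeries p
  set q' : ℕ → ℂ⟦X⟧ := fun n => absSeries (q n)
  have hX' : ∀ n, X ^ (n + 1) ∣ q' n - 1 := fun n => X_pow_dvd_absSeries_sub_one (hX n)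
  have h1' : ∀ n, constantCoeff (q' n) = 1 := fun n => constantCoeff_eq_one (hX' n)
  have hp' : NonnegCoeff p' := nonnegCoeff_absSeries p
  have hq' : ∀ n, NonnegCoeff (q' n) := fun n => nonnegCoeff_absSeries _
  set L : ℂ⟦X⟧ := PowerSeries.mk fun d => coeff d (p' * ∏ n ∈ Finset.range d, q' n) with hL
  have hLcoeff : ∀ d M, d ≤ M → coeff d L = coeff d (p' * ∏ n ∈ Finset.range M, q' n) := by
    intro d M hM
    rw [hL, coeff_mk, coeff_prod_range_stable hX' p' hM]
  have hLmass : mass L ≠ ∞ := by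
    rw [mass_eq_mul_iSup hp' hq' h1' fun d K hd => hLcoeff d (2 * K) (by omega)]
    refine ENNReal.mul_ne_top (by rw [mass_absSeries]; exact hp) ?_
    refine ((iSup_le fun M => ?_).trans_lt
      (ENNReal.ofReal_lt_top (r := Real.exp (∑' n, s n)))).ne
    calc ∏ n ∈ Finset.range M, mass (q' n)
        ≤ ∏ n ∈ Finset.range M, ENNReal.ofReal (Real.exp (s n)) :=
          Finset.prod_le_prod' fun n _ => by rw [mass_absSeries]; exact hq n
      _ = ENNReal.ofReal (Real.exp (∑ n ∈ Finset.range M, s n)) := by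
          rw [Real.exp_sum, ENNReal.ofReal_prod_of_nonneg fun n _ => (Real.exp_pos _).le]
      _ ≤ _ := ENNReal.ofReal_le_ofReal
          (Real.exp_le_exp.2 (hs.sum_le_tsum _ fun n _ => hs0 n))
  have hlim : Filter.Tendsto (fun M => evalOne (p * ∏ n ∈ Finset.range M, q n)) Filter.atTop
      (nhds (evalOne P)) := by
    refine tendsto_tsum_of_dominated_convergence (mass_ne_top_iff.1 hLmass) (fun d => ?_)
      (Filter.Eventually.of_forall fun M d => ?_)
    · refine tendsto_const_nhds.congr' ?_
      filter_upwards [Filter.eventually_ge_atTop d] with M hM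
      rw [hP d (d + 1) (by omega), coeff_prod_range_stable hX p hM,
        coeff_prod_range_stable hX p (by omega)]
    · have h1 := enorm_coeff_prod_range_le p q M d
      have h2 : ‖coeff d (p' * ∏ n ∈ Finset.range M, q' n)‖ₑ ≤ ‖coeff d L‖ₑ := by
        rw [hLcoeff d (max d M) (le_max_left _ _)]
        refine enorm_le_enorm_of_nonneg (hp'.mul (NonnegCoeff.prod _ hq') d) ?_
        exact coeff_prod_range_mono hp' hq' h1' d (le_max_right _ _)
      have h3 := h1.trans h2
      rwa [← ofReal_norm, ← ofReal_norm,
        ENNReal.ofReal_le_ofReal_iff (norm_nonneg _)] at h3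
  refine tendsto_nhds_unique hlim ?_
  have heq : ∀ M, evalOne (p * ∏ n ∈ Finset.range M, q n) =
      evalOne p * ∏ n ∈ Finset.range M, evalOne (q n) := fun M => by
    rw [evalOne_mul hp (mass_prod_ne_top _ fun n _ => hqtop n),
      evalOne_prod _ fun n _ => hqtop n]
  simp only [heq]
  exact hmult.hasProd.tendsto_prod_nat.const_mul _

/-- Infinite products of numbers `≥ 1` in `[0,∞]` converge to the supremum of the partial
products. -/
theorem hasProd_iSup_range {f : ℕ → ℝ≥0∞} (hf : ∀ n, 1 ≤ f n) :
    HasProd f (⨆ M, ∏ n ∈ Finset.range M, f n) := by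
  have h : HasProd f (⨆ s : Finset ℕ, ∏ n ∈ s, f n) :=
    hasProd_of_isLUB_of_one_le _ hf isLUB_iSup
  have h2 := h.tendsto_prod_nat
  have h3 : Filter.Tendsto (fun M => ∏ n ∈ Finset.range M, f n) Filter.atTop
      (nhds (⨆ M, ∏ n ∈ Finset.range M, f n)) :=
    tendsto_atTop_iSup (monotone_nat_of_le_succ fun M => by
      rw [Finset.prod_range_succ]
      exact le_mul_of_one_le_right' (hf M))
  rwa [tendsto_nhds_unique h2 h3] at h

end FreeBoundarySchur

/-! ### Nonnegative specializations -/

namespace FreeBoundarySchur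

open PowerSeries
open scoped ComplexOrder

theorem ofReal_re_of_nonneg {w : ℂ} (hw : 0 ≤ w) : ENNReal.ofReal w.re = ‖w‖ₑ := by
  rw [← ofReal_norm]
  congr 1
  conv_lhs => rw [Complex.eq_coe_norm_of_nonneg hw, Complex.ofReal_re]

/-- All the minors which define the skew Schur functions are nonnegative. -/
def NonnegMinors (H : ℂ⟦X⟧) : Prop := ∀ lam mu : YoungDiagram, mu ≤ lam → 0 ≤ sk H lam mu

theorem nonneg_iff_nonnegMinors {ρ : SymSpec} : ρ.Nonneg ↔ NonnegMinors (genFun ρ) := by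
  simp only [SymSpec.Nonneg, NonnegMinors, ← apply_skewSchur, Complex.nonneg_iff, eq_comm]

theorem nonnegMinors_one : NonnegMinors 1 := by
  intro lam mu h
  rcases h.eq_or_lt with rfl | hlt
  · rw [sk_self _ (map_one _)]
    exact zero_le_one
  · rw [sk_eq_pow_mul 1 1 (0 : ℂ) h fun m _ => ?_, zero_pow, zero_mul]
    · have : mu.card < lam.card := Finset.card_lt_card hlt
      omega
    · rw [coeff_one]
      split_ifs with hm
      · rw [hm, pow_zero, one_mul]
      · rw [mul_zero]

theorem NonnegMinors.mul {H H' : ℂ⟦X⟧} (hH : constantCoeff H = 1) (hH' : constantCoeff H' = 1)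
    (h : NonnegMinors H) (h' : NonnegMinors H') : NonnegMinors (H * H') := by
  intro lam mu hle
  rw [sk_mul H H' hH hH' hle]
  refine Finset.sum_nonneg fun nu hnu => ?_
  rw [mem_between] at hnu
  exact mul_nonneg (h _ _ hnu.2) (h' _ _ hnu.1)

theorem NonnegMinors.prod {ι : Type*} (s : Finset ι) {H : ι → ℂ⟦X⟧}
    (hH : ∀ i, constantCoeff (H i) = 1) (h : ∀ i, NonnegMinors (H i)) :
    NonnegMinors (∏ i ∈ s, H i) := by
  classical
  induction s using Finset.induction_on with
  | empty => exact nonnegMinors_one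
  | insert i s hi ih =>
    rw [Finset.prod_insert hi]
    exact (h i).mul (hH i) (constantCoeff_prod_eq_one _ hH) ih

theorem SymSpec.Nonneg.iUnionSpec {N : ℕ} {ρ : Fin N → SymSpec} (h : ∀ k, (ρ k).Nonneg) :
    (iUnionSpec ρ).Nonneg := by
  rw [nonneg_iff_nonnegMinors, genFun_iUnionSpec]
  exact NonnegMinors.prod _ (fun k => constantCoeff_genFun _)
    fun k => nonneg_iff_nonnegMinors.1 (h k)

theorem SymSpec.Nonneg.apply_skewSchur_nonneg {ρ : SymSpec} (h : ρ.Nonneg)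
    {lam mu : YoungDiagram} (hle : mu ≤ lam) : 0 ≤ ρ (skewSchur lam mu) := by
  rw [apply_skewSchur]
  exact nonneg_iff_nonnegMinors.1 h _ _ hle

theorem SymSpec.Nonneg.littlewoodTerm_nonneg {ρ : SymSpec} (h : ρ.Nonneg) (lam : YoungDiagram) :
    0 ≤ littlewoodTerm ρ lam := h.apply_skewSchur_nonneg bot_le

theorem SymSpec.Nonneg.cauchyTerm_nonneg {ρ ρ' : SymSpec} (h : ρ.Nonneg) (h' : ρ'.Nonneg)
    (lam : YoungDiagram) : 0 ≤ cauchyTerm ρ ρ' lam :=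
  mul_nonneg (h.littlewoodTerm_nonneg lam) (h'.littlewoodTerm_nonneg lam)

theorem SymSpec.Nonneg.scaleSpec {ρ : SymSpec} (h : ρ.Nonneg) {s : ℂ} (hs : 0 ≤ s) :
    (scaleSpec s ρ).Nonneg := by
  intro lam mu hle
  have h1 : 0 ≤ FreeBoundarySchur.scaleSpec s ρ (skewSchur lam mu) := by
    rw [scaleSpec_apply_skewSchur s ρ hle]
    exact mul_nonneg (pow_nonneg hs _) (h.apply_skewSchur_nonneg hle)
  rw [Complex.nonneg_iff] at h1
  exact ⟨h1.1, h1.2.symm⟩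

theorem weight_nonneg {N : ℕ} {u v : ℝ} (hu : 0 ≤ u) (hv : 0 ≤ v) {ρp ρm : Fin N → SymSpec}
    (hp : ∀ k, (ρp k).Nonneg) (hm : ∀ k, (ρm k).Nonneg) (S : PartitionSeq N) :
    0 ≤ weight u v ρp ρm S := by
  refine mul_nonneg (mul_nonneg (pow_nonneg (Complex.zero_le_real.2 hu) _)
    (pow_nonneg (Complex.zero_le_real.2 hv) _)) (Finset.prod_nonneg fun k _ => ?_)
  exact mul_nonneg ((hp k).apply_skewSchur_nonneg (S.left_le k))
    ((hm k).apply_skewSchur_nonneg (S.right_le k))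

theorem tsum_enorm_littlewoodTerm {ρ : SymSpec} (h : ρ.Nonneg) :
    ∑' lam, ‖littlewoodTerm ρ lam‖ₑ = littlewoodHInf ρ :=
  tsum_congr fun lam => (ofReal_re_of_nonneg (h.littlewoodTerm_nonneg lam)).symm

theorem tsum_enorm_cauchyTerm {ρ ρ' : SymSpec} (h : ρ.Nonneg) (h' : ρ'.Nonneg) :
    ∑' lam, ‖cauchyTerm ρ ρ' lam‖ₑ = cauchyHInf ρ ρ' :=
  tsum_congr fun lam => (ofReal_re_of_nonneg (h.cauchyTerm_nonneg h' lam)).symm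

theorem mass_pairSeries {ρ ρ' : SymSpec} (h : ρ.Nonneg) (h' : ρ'.Nonneg) :
    mass (pairSeries ρ ρ') = cauchyHInf ρ ρ' := by
  rw [pairSeries, mass_gradedSeries (finiteDegree_mul_card two_pos) (h.cauchyTerm_nonneg h'),
    tsum_enorm_cauchyTerm h h']

/-- The geometric series in `[0,∞]`; both sides are infinite if `1 ≤ q`. -/
theorem tsum_enorm_pow {q : ℂ} (hq : 0 ≤ q) :
    ∑' k : ℕ, ‖q ^ k‖ₑ = (ENNReal.ofReal (1 - q.re))⁻¹ := by
  have h : ∀ k : ℕ, ‖q ^ k‖ₑ = ‖q‖ₑ ^ k := fun k => enorm_pow q k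
  simp only [h]
  rw [ENNReal.tsum_geometric, ENNReal.ofReal_sub _ (Complex.nonneg_iff.1 hq).1,
    ofReal_re_of_nonneg hq, ENNReal.ofReal_one]

section Reflect

variable {u v : ℝ} {ρp ρm : SymSpec}

theorem nonnegCoeff_reflectSeries (hu : 0 ≤ u) (hv : 0 ≤ v) (hp : ρp.Nonneg) (hm : ρm.Nonneg)
    (n : ℕ) : NonnegCoeff (reflectSeries u v ρp ρm n) := by
  have hu' : (0 : ℂ) ≤ u := Complex.zero_le_real.2 hu
  have hv' : (0 : ℂ) ≤ v := Complex.zero_le_real.2 hv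
  refine (((nonnegCoeff_gradedSeries fun lam => ?_).mul
    (nonnegCoeff_gradedSeries fun lam => ?_)).mul
    (nonnegCoeff_gradedSeries fun lam => ?_)).mul (nonnegCoeff_gradedSeries fun k => ?_)
  · exact (hp.scaleSpec (by positivity)).littlewoodTerm_nonneg lam
  · exact (hm.scaleSpec (by positivity)).littlewoodTerm_nonneg lam
  · exact (hp.scaleSpec (by positivity)).cauchyTerm_nonneg (hm.scaleSpec (by positivity)) lam
  · positivity

theorem mass_reflectSeries (hu : 0 ≤ u) (hv : 0 ≤ v) (hp : ρp.Nonneg) (hm : ρm.Nonneg)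
    (n : ℕ) : mass (reflectSeries u v ρp ρm n) = reflectionFactorInf u v ρp ρm (n + 1) := by
  have hu' : (0 : ℂ) ≤ u := Complex.zero_le_real.2 hu
  have hv' : (0 : ℂ) ≤ v := Complex.zero_le_real.2 hv
  have h1 : (FreeBoundarySchur.scaleSpec ((u : ℂ) ^ n * (v : ℂ) ^ (n + 1)) ρp).Nonneg :=
    hp.scaleSpec (by positivity)
  have h2 : (FreeBoundarySchur.scaleSpec ((u : ℂ) ^ (n + 1) * (v : ℂ) ^ n) ρm).Nonneg :=
    hm.scaleSpec (by positivity)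
  have h3 : (FreeBoundarySchur.scaleSpec ((u : ℂ) ^ (2 * (n + 1))) ρp).Nonneg :=
    hp.scaleSpec (by positivity)
  have h4 : (FreeBoundarySchur.scaleSpec ((v : ℂ) ^ (2 * (n + 1))) ρm).Nonneg :=
    hm.scaleSpec (by positivity)
  have hq : (0 : ℂ) ≤ (u : ℂ) ^ (n + 1) * (v : ℂ) ^ (n + 1) := by positivity
  have c1 := nonnegCoeff_gradedSeries (deg := fun lam => (2 * (n + 1)) * lam.card)
    h1.littlewoodTerm_nonneg
  have c2 := nonnegCoeff_gradedSeries (deg := fun lam => (2 * (n + 1)) * lam.card)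
    h2.littlewoodTerm_nonneg
  have c3 := nonnegCoeff_gradedSeries (deg := fun lam => (4 * (n + 1) + 2) * lam.card)
    (h3.cauchyTerm_nonneg h4)
  have c4 := nonnegCoeff_gradedSeries (deg := fun k => (2 * (n + 1)) * k)
    fun k => pow_nonneg hq k
  rw [reflectSeries, mass_mul ((c1.mul c2).mul c3) c4, mass_mul (c1.mul c2) c3, mass_mul c1 c2,
    mass_gradedSeries (finiteDegree_mul_card (by positivity)) h1.littlewoodTerm_nonneg,
    mass_gradedSeries (finiteDegree_mul_card (by positivity)) h2.littlewoodTerm_nonneg,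
    mass_gradedSeries (finiteDegree_mul_card (by positivity)) (h3.cauchyTerm_nonneg h4),
    mass_gradedSeries (finiteDegree_mul (by positivity)) fun k => pow_nonneg hq k,
    tsum_enorm_littlewoodTerm h1, tsum_enorm_littlewoodTerm h2, tsum_enorm_cauchyTerm h3 h4,
    tsum_enorm_pow hq, reflectionFactorInf, Nat.add_sub_cancel, div_eq_mul_inv]
  congr 4
  rw [← Complex.ofReal_pow, ← Complex.ofReal_pow, ← Complex.ofReal_mul, Complex.ofReal_re]

theorem X_pow_dvd_reflectSeries_sub_one (u v : ℝ) (ρp ρm : SymSpec) (n : ℕ) :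
    X ^ (n + 1) ∣ reflectSeries u v ρp ρm n - 1 := by
  have hbot : ∀ ρ : SymSpec, littlewoodTerm ρ ⊥ = 1 := fun ρ => by
    rw [littlewoodTerm, schur, apply_skewSchur, sk_self _ (constantCoeff_genFun ρ)]
  have hcard : ∀ {c : ℕ}, n + 1 ≤ c → ∀ lam : YoungDiagram, lam ≠ ⊥ → n + 1 ≤ c * lam.card := by
    intro c hc lam hlam
    have := Nat.pos_of_ne_zero (mt card_eq_zero_iff.1 hlam)
    exact hc.trans (Nat.le_mul_of_pos_right c this)
  refine X_pow_dvd_mul_sub_one (X_pow_dvd_mul_sub_one (X_pow_dvd_mul_sub_one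
    (X_pow_dvd_gradedSeries_sub_one (i₀ := ⊥) ?_ (hbot _) (hcard (by omega)))
    (X_pow_dvd_gradedSeries_sub_one (i₀ := ⊥) ?_ (hbot _) (hcard (by omega))))
    (X_pow_dvd_gradedSeries_sub_one (i₀ := ⊥) ?_ ?_ (hcard (by omega))))
    (X_pow_dvd_gradedSeries_sub_one (i₀ := 0) (mul_zero _) (pow_zero _) fun k hk => ?_)
  · rw [card_bot, mul_zero]
  · rw [card_bot, mul_zero]
  · rw [card_bot, mul_zero]
  · exact (congrArg₂ (· * ·) (hbot _) (hbot _)).trans (one_mul 1)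
  · exact le_trans (by omega) (Nat.le_mul_of_pos_right (2 * (n + 1)) (Nat.pos_of_ne_zero hk))

theorem one_le_mass {q : ℂ⟦X⟧} (h : constantCoeff q = 1) : 1 ≤ mass q := by
  rw [mass_eq_one_add h]
  exact le_self_add

end Reflect

/-- The product formula for nonnegative specializations, by monotone convergence. -/
theorem partitionFunctionInf_eq {N : ℕ} {u v : ℝ} (hu : 0 ≤ u) (hv : 0 ≤ v)
    {ρp ρm : Fin N → SymSpec} (hp : ∀ k, (ρp k).Nonneg) (hm : ∀ k, (ρm k).Nonneg) :
    Multipliable (fun n : ℕ+ => reflectionFactorInf u v (iUnionSpec ρp) (iUnionSpec ρm) n) ∧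
      partitionFunctionInf u v ρp ρm =
        (∏ p : Fin N × Fin N with p.1 ≤ p.2, cauchyHInf (ρp p.1) (ρm p.2)) *
          ∏' n : ℕ+, reflectionFactorInf u v (iUnionSpec ρp) (iUnionSpec ρm) n := by
  have hP := SymSpec.Nonneg.iUnionSpec hp
  have hM := SymSpec.Nonneg.iUnionSpec hm
  have hw := weight_nonneg hu hv hp hm
  have hpair : ∀ p : Fin N × Fin N, NonnegCoeff (pairSeries (ρp p.1) (ρm p.2)) := fun p =>
    nonnegCoeff_gradedSeries ((hp p.1).cauchyTerm_nonneg (hm p.2))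
  have h1 : ∀ n, constantCoeff (reflectSeries u v (iUnionSpec ρp) (iUnionSpec ρm) n) = 1 :=
    fun n => constantCoeff_eq_one (X_pow_dvd_reflectSeries_sub_one u v _ _ n)
  have hprod := hasProd_iSup_range fun n => one_le_mass (h1 n)
  have key := mass_eq_mul_iSup (NonnegCoeff.prod _ hpair)
    (nonnegCoeff_reflectSeries hu hv hP hM) h1
    fun d K hd => coeff_gradedSeries_weight u v ρp ρm hd
  rw [← hprod.tprod_eq, mass_gradedSeries finiteDegree_seqDegree hw, mass_prod _ hpair] at key
  simp only [mass_reflectSeries hu hv hP hM] at key hprod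
  refine ⟨?_, ?_⟩
  · exact (multipliable_pnat_iff_multipliable_succ
      (f := fun n => reflectionFactorInf u v (iUnionSpec ρp) (iUnionSpec ρm) n)).2
      hprod.multipliable
  · rw [tprod_pnat_eq_tprod_succ
      (f := fun n => reflectionFactorInf u v (iUnionSpec ρp) (iUnionSpec ρm) n), partitionFunctionInf,
      tsum_congr fun S => ofReal_re_of_nonneg (hw S), key]
    congr 1
    exact Finset.prod_congr rfl fun p _ => mass_pairSeries (hp p.1) (hm p.2)

end FreeBoundarySchur

/-! ### Consequences of absolute convergence -/

namespace FreeBoundarySchur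

open PowerSeries

theorem enorm_finsum_le {ι : Type*} (f : ι → ℂ) : ‖∑ᶠ i, f i‖ₑ ≤ ∑' i, ‖f i‖ₑ := by
  by_cases h : (Function.support f).Finite
  · rw [finsum_eq_sum_of_support_subset f (s := h.toFinset) (by simp)]
    exact (enorm_sum_le _ _).trans (ENNReal.sum_le_tsum _)
  · rw [finsum_of_infinite_support h, enorm_zero]
    exact zero_le

theorem stepProd_enorm {N : ℕ} (f : Fin N → YoungDiagram → YoungDiagram → YoungDiagram → ℂ)
    (p : Path N) : ‖stepProd f p‖ₑ = stepProd (fun k lam mu nu => ‖f k lam mu nu‖ₑ) p := by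
  rw [stepProd, stepProd, ← ofReal_norm, norm_prod,
    ENNReal.ofReal_prod_of_nonneg fun _ _ => norm_nonneg _]
  simp only [ofReal_norm]

/-- If the kernel `T (H k)` is dominated by the `k`-th step of a path, summed over its upper
diagram, and `T` is submultiplicative, then the kernel of the product of all `H k` is dominated by
the sum over all paths. -/
theorem le_tsum_stepProd {N : ℕ} {f : Fin N → YoungDiagram → YoungDiagram → YoungDiagram → ℝ≥0∞}
    {T : ℂ⟦X⟧ → YoungDiagram → YoungDiagram → ℝ≥0∞} {H : Fin N → ℂ⟦X⟧}
    (hH : ∀ k, constantCoeff (H k) = 1)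
    (hT_one : ∀ (b : YoungDiagram → ℝ≥0∞) (mu : YoungDiagram), ∑' nu, T 1 mu nu * b nu ≤ b mu)
    (hT_mul : ∀ {H H' : ℂ⟦X⟧}, constantCoeff H = 1 → constantCoeff H' = 1 →
      ∀ lam nu, T (H * H') lam nu ≤ ∑' mu, T H lam mu * T H' mu nu)
    (hf : ∀ k mu nu, T (H k) mu nu ≤ ∑' lam, f k lam mu nu) (a b : YoungDiagram → ℝ≥0∞) :
    ∑' lam, a lam * ∑' nu, T (∏ k, H k) lam nu * b nu ≤
      ∑' p : Path N, a (p.2 0) * stepProd f p * b (p.2 (Fin.last N)) := by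
  induction N generalizing b with
  | zero =>
    rw [← ((Equiv.funUnique (Fin 1) YoungDiagram).symm.trans (Equiv.uniqueProd _ _).symm).tsum_eq]
    refine ENNReal.tsum_le_tsum fun lam => ?_
    rw [Finset.univ_eq_empty, Finset.prod_empty]
    refine (mul_le_mul_right (hT_one b lam) (a lam)).trans (le_of_eq ?_)
    simp [stepProd]
  | succ N ih =>
    have h1 : ∀ lam, ∑' nu, T (∏ k, H k) lam nu * b nu ≤
        ∑' mu, T (∏ k : Fin N, H k.castSucc) lam mu * ∑' nu, T (H (Fin.last N)) mu nu * b nu := by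
      intro lam
      simp only [← ENNReal.tsum_mul_left]
      rw [ENNReal.tsum_comm]
      refine ENNReal.tsum_le_tsum fun nu => ?_
      rw [Fin.prod_univ_castSucc]
      refine (mul_le_mul_left (hT_mul (constantCoeff_prod_eq_one _ fun k => hH _) (hH _) lam nu)
        (b nu)).trans (le_of_eq ?_)
      rw [← ENNReal.tsum_mul_right]
      exact tsum_congr fun mu => mul_assoc _ _ _
    refine (ENNReal.tsum_le_tsum fun lam => mul_le_mul_right (h1 lam) (a lam)).trans ?_
    refine (ih (f := fun k => f k.castSucc) (fun k => hH _) (fun k => hf _) _).trans ?_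
    refine le_of_le_of_eq ?_ ((pathSnoc N).tsum_eq _)
    refine le_of_le_of_eq ?_ ENNReal.tsum_prod'.symm
    refine ENNReal.tsum_le_tsum fun p => ?_
    simp only [pathSnoc_zero, pathSnoc_last, stepProd_snoc]
    rw [← ENNReal.tsum_mul_left, ENNReal.tsum_prod', ENNReal.tsum_comm]
    refine ENNReal.tsum_le_tsum fun nu => ?_
    refine (mul_le_mul_right (mul_le_mul_left (hf (Fin.last N) (p.2 (Fin.last N)) nu) (b nu))
      _).trans (le_of_eq ?_)
    rw [← ENNReal.tsum_mul_right, ← ENNReal.tsum_mul_left]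
    exact tsum_congr fun lam => by ring

section

variable {N : ℕ} {u v : ℝ} {ρp ρm : Fin N → SymSpec}

theorem enorm_weight (u v : ℝ) (ρp ρm : Fin N → SymSpec) (S : PartitionSeq N) :
    ‖weight u v ρp ρm S‖ₑ = ‖(u : ℂ)‖ₑ ^ (S.toPath.2 0).card *
      stepProd (fun k lam mu nu => ‖stepWeight (A := ℂ) (fun k => genFun (ρp k))
        (fun k => genFun (ρm k)) 1 1 k lam mu nu‖ₑ) S.toPath *
      ‖(v : ℂ)‖ₑ ^ (S.toPath.2 (Fin.last N)).card := by
  have h : ∀ k : Fin N, stepWeight (A := ℂ) (fun k => genFun (ρp k)) (fun k => genFun (ρm k)) 1 1 k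
      (S.toPath.1 k) (S.toPath.2 k.castSucc) (S.toPath.2 k.succ) =
      ρp k (skewSchur (S.lam k) (S.mu k.castSucc)) *
        ρm k (skewSchur (S.lam k) (S.mu k.succ)) := by
    intro k
    rw [stepWeight, PartitionSeq.toPath, skTerm_of_le (S.left_le k), skTerm_of_le (S.right_le k),
      apply_skewSchur, apply_skewSchur, one_pow, one_pow, mul_one, mul_one]
    rfl
  rw [weight, enorm_mul, enorm_mul, enorm_pow, enorm_pow, ← stepProd_enorm, stepProd,
    Finset.prod_congr rfl fun k _ => h k]
  simp only [PartitionSeq.toPath]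
  ring

theorem tsum_enorm_weight (u v : ℝ) (ρp ρm : Fin N → SymSpec) :
    ∑' S, ‖weight u v ρp ρm S‖ₑ = ∑' p : Path N, ‖(u : ℂ)‖ₑ ^ (p.2 0).card *
      stepProd (fun k lam mu nu => ‖stepWeight (A := ℂ) (fun k => genFun (ρp k))
        (fun k => genFun (ρm k)) 1 1 k lam mu nu‖ₑ) p *
      ‖(v : ℂ)‖ₑ ^ (p.2 (Fin.last N)).card := by
  simp only [enorm_weight]
  refine PartitionSeq.toPath_injective.tsum_eq (f := fun p : Path N => ‖(u : ℂ)‖ₑ ^ (p.2 0).card *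
      stepProd (fun k lam mu nu => ‖stepWeight (A := ℂ) (fun k => genFun (ρp k))
        (fun k => genFun (ρm k)) 1 1 k lam mu nu‖ₑ) p *
      ‖(v : ℂ)‖ₑ ^ (p.2 (Fin.last N)).card) fun p hp => ?_
  have h := right_ne_zero_of_mul (left_ne_zero_of_mul hp)
  rw [← stepProd_enorm] at h
  exact mem_range_toPath (enorm_ne_zero.1 h)

/-- The lower bound from the steps `mu ≤ nu ≥ nu`: the second half of such a step has weight one,
and the first halves combine to a skew Schur function of the union. -/
theorem tsum_up_le (u v : ℝ) (ρp ρm : Fin N → SymSpec) :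
    ∑' lam : YoungDiagram, ‖(u : ℂ)‖ₑ ^ lam.card *
      ∑' nu : YoungDiagram, ‖skTerm (genFun (iUnionSpec ρp)) (1 : ℂ) nu lam‖ₑ *
        ‖(v : ℂ)‖ₑ ^ nu.card ≤ ∑' S, ‖weight u v ρp ρm S‖ₑ := by
  classical
  rw [tsum_enorm_weight, genFun_iUnionSpec]
  refine le_tsum_stepProd (T := fun H mu nu => ‖skTerm H (1 : ℂ) nu mu‖ₑ)
    (fun k => constantCoeff_genFun (ρp k)) (fun b mu => le_of_eq ?_) (fun {H H'} hH hH' lam nu => ?_)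
    (fun k mu nu => ?_) _ _
  · rw [tsum_eq_single mu]
    · simp [skTerm_one]
    · intro nu hne
      simp [skTerm_one, hne]
  · rw [mul_comm, ← skTerm_mul hH' hH]
    refine (enorm_finsum_le _).trans (le_of_eq (tsum_congr fun mu => ?_))
    rw [enorm_mul, mul_comm]
  · refine le_trans (le_of_eq ?_) (ENNReal.le_tsum nu)
    rw [stepWeight, skTerm_self (constantCoeff_genFun _), mul_one]

/-- The lower bound from the steps `mu ≤ mu ≥ nu`, where only the second half of a step
contributes. -/
theorem tsum_down_le (u v : ℝ) (ρp ρm : Fin N → SymSpec) :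
    ∑' lam : YoungDiagram, ‖(u : ℂ)‖ₑ ^ lam.card *
      ∑' nu : YoungDiagram, ‖skTerm (genFun (iUnionSpec ρm)) (1 : ℂ) lam nu‖ₑ *
        ‖(v : ℂ)‖ₑ ^ nu.card ≤ ∑' S, ‖weight u v ρp ρm S‖ₑ := by
  classical
  rw [tsum_enorm_weight, genFun_iUnionSpec]
  refine le_tsum_stepProd (T := fun H mu nu => ‖skTerm H (1 : ℂ) mu nu‖ₑ)
    (fun k => constantCoeff_genFun (ρm k)) (fun b mu => le_of_eq ?_) (fun {H H'} hH hH' lam nu => ?_)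
    (fun k mu nu => ?_) _ _
  · rw [tsum_eq_single mu]
    · simp [skTerm_one]
    · intro nu hne
      simp [skTerm_one, hne.symm]
  · rw [← skTerm_mul hH hH']
    refine (enorm_finsum_le _).trans (le_of_eq (tsum_congr fun mu => ?_))
    rw [enorm_mul]
  · refine le_trans (le_of_eq ?_) (ENNReal.le_tsum mu)
    rw [stepWeight, skTerm_self (constantCoeff_genFun _), one_mul]

theorem enorm_littlewoodTerm_scaleSpec (s : ℂ) (ρ : SymSpec) (lam : YoungDiagram) :
    ‖littlewoodTerm (scaleSpec s ρ) lam‖ₑ =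
      ‖skTerm (genFun ρ) (1 : ℂ) lam ⊥‖ₑ * ‖s‖ₑ ^ lam.card := by
  rw [littlewoodTerm_scaleSpec, enorm_mul, enorm_pow, mul_comm, skTerm_bot, one_pow, mul_one,
    littlewoodTerm, schur, apply_skewSchur]
  rfl

theorem summable_of_tsum_enorm_le {ι κ : Type*} {f : ι → ℂ} {g : κ → ℂ} (hg : Summable g)
    (h : ∑' i, ‖f i‖ₑ ≤ ∑' j, ‖g j‖ₑ) : Summable f :=
  (tsum_enorm_ne_top_iff_summable_norm.1
    (h.trans_lt (tsum_enorm_ne_top_iff_summable_norm.2 hg.norm).lt_top).ne).of_norm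

theorem summable_littlewoodTerm_up (h : Summable (weight u v ρp ρm)) :
    Summable (littlewoodTerm (scaleSpec v (iUnionSpec ρp))) := by
  refine summable_of_tsum_enorm_le h (le_trans ?_ (tsum_up_le u v ρp ρm))
  refine le_trans (le_of_eq ?_) (ENNReal.le_tsum ⊥)
  rw [card_bot, pow_zero, one_mul]
  exact tsum_congr fun lam => enorm_littlewoodTerm_scaleSpec _ _ _

theorem summable_littlewoodTerm_down (h : Summable (weight u v ρp ρm)) :
    Summable (littlewoodTerm (scaleSpec u (iUnionSpec ρm))) := by
  refine summable_of_tsum_enorm_le h (le_trans ?_ (tsum_down_le u v ρp ρm))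
  refine ENNReal.tsum_le_tsum fun lam => ?_
  rw [enorm_littlewoodTerm_scaleSpec, mul_comm]
  refine mul_le_mul_right (le_trans (le_of_eq ?_) (ENNReal.le_tsum ⊥)) _
  rw [card_bot, pow_zero, mul_one]

theorem infinite_youngDiagram : Infinite YoungDiagram := by
  let row : ℕ → YoungDiagram := fun n => ofRows (fun i => if i = 0 then n else 0)
    (antitone_nat_of_succ_le fun i => by simp) 1 rfl
  refine Infinite.of_injective row fun m n h => ?_
  have h1 := congrArg (fun lam : YoungDiagram => lam.rowLen 0) h
  simpa only [row, rowLen_ofRows, if_true] using h1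

/-- The steps may all be trivial, hence `∑ lam, (u * v) ^ |lam|` is dominated by the partition
function. -/
theorem mul_lt_one_of_summable_weight (h : Summable (weight u v ρp ρm)) : u * v < 1 := by
  have hsum : Summable fun lam : YoungDiagram => ((u * v : ℝ) : ℂ) ^ lam.card := by
    refine summable_of_tsum_enorm_le h (le_trans ?_ (tsum_up_le u v ρp ρm))
    refine ENNReal.tsum_le_tsum fun lam => ?_
    rw [enorm_pow, Complex.ofReal_mul, enorm_mul, mul_pow]
    refine mul_le_mul_right (le_trans (le_of_eq ?_) (ENNReal.le_tsum lam)) _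
    rw [skTerm_self (constantCoeff_genFun _), enorm_one, one_mul]
  by_contra hge
  have := infinite_youngDiagram
  have h0 := hsum.tendsto_cofinite_zero.norm.eventually_lt_const (u := 1) (by simp)
  obtain ⟨lam, hlam⟩ := h0.exists
  rw [norm_pow, Complex.norm_real, Real.norm_eq_abs] at hlam
  exact absurd hlam (not_lt.2 (one_le_pow₀ ((not_lt.1 hge).trans (le_abs_self _))))

open Classical in
/-- The sequence which is equal to `lam` between the `k`-th and the `l`-th step, and empty
elsewhere. -/
noncomputable def plateau (k l : Fin N) (lam : YoungDiagram) : PartitionSeq N where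
  lam j := if k ≤ j ∧ j ≤ l then lam else ⊥
  mu j := if (k : ℕ) < j ∧ (j : ℕ) ≤ l then lam else ⊥
  left_le j := by
    split_ifs with h1 h2
    · exact le_rfl
    · exact absurd ⟨Fin.le_def.2 h1.1.le, Fin.le_def.2 h1.2⟩ h2
    · exact bot_le
    · exact le_rfl
  right_le j := by
    split_ifs with h1 h2
    · exact le_rfl
    · rw [Fin.val_succ] at h1
      exact absurd ⟨Fin.le_def.2 (by omega), Fin.le_def.2 (by omega)⟩ h2
    · exact bot_le
    · exact le_rfl

theorem apply_skewSchur_self (ρ : SymSpec) (lam : YoungDiagram) : ρ (skewSchur lam lam) = 1 := by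
  rw [apply_skewSchur, sk_self _ (constantCoeff_genFun ρ)]

theorem weight_plateau {k l : Fin N} (hkl : k ≤ l) (lam : YoungDiagram) :
    weight u v ρp ρm (plateau k l lam) = cauchyTerm (ρp k) (ρm l) lam := by
  have hkl' : (k : ℕ) ≤ l := hkl
  have h0 : (plateau k l lam).mu 0 = ⊥ := by simp [plateau]
  have hN : (plateau k l lam).mu (Fin.last N) = ⊥ := by simp [plateau]
  rw [weight, h0, hN, card_bot, pow_zero, pow_zero, one_mul, one_mul, Finset.prod_mul_distrib]
  congr 1
  · rw [Finset.prod_eq_single k]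
    · have h1 : (plateau k l lam).lam k = lam := if_pos ⟨le_rfl, hkl⟩
      have h2 : (plateau k l lam).mu k.castSucc = ⊥ := if_neg fun h => lt_irrefl _ h.1
      rw [h1, h2, schur]
    · intro j _ hj
      have hj' : (j : ℕ) ≠ k := fun h => hj (Fin.ext h)
      have : (plateau k l lam).mu j.castSucc = (plateau k l lam).lam j := by
        simp only [plateau, Fin.le_def, Fin.val_castSucc]
        refine if_congr ?_ rfl rfl
        omega
      rw [this, apply_skewSchur_self]
    · exact fun h => absurd (Finset.mem_univ k) h
  · rw [Finset.prod_eq_single l]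
    · have h1 : (plateau k l lam).lam l = lam := if_pos ⟨hkl, le_rfl⟩
      have h2 : (plateau k l lam).mu l.succ = ⊥ := if_neg fun h => absurd h.2 (by simp)
      rw [h1, h2, schur]
    · intro j _ hj
      have hj' : (j : ℕ) ≠ l := fun h => hj (Fin.ext h)
      have : (plateau k l lam).mu j.succ = (plateau k l lam).lam j := by
        simp only [plateau, Fin.le_def, Fin.val_succ]
        refine if_congr ?_ rfl rfl
        omega
      rw [this, apply_skewSchur_self]
    · exact fun h => absurd (Finset.mem_univ l) h

theorem summable_cauchyTerm_pair (h : Summable (weight u v ρp ρm)) {k l : Fin N} (hkl : k ≤ l) :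
    Summable (cauchyTerm (ρp k) (ρm l)) := by
  have hinj : Function.Injective (plateau k l) := fun lam mu hlm => by
    have := congrArg (fun S : PartitionSeq N => S.lam k) hlm
    simpa [plateau, hkl] using this
  refine (h.comp_injective hinj).congr fun lam => ?_
  exact weight_plateau hkl lam

end

end FreeBoundarySchur

/-! ### Evaluation of the product formula -/

namespace FreeBoundarySchur

open PowerSeries

section Damped

variable {ι : Type*} {deg : ι → ℕ} {w w' : ι → ℂ} {r : ℝ}

theorem norm_damped_le (hw' : ∀ i, w' i = (r : ℂ) ^ deg i * w i) (hr0 : 0 ≤ r) (hr1 : r ≤ 1)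
    (i : ι) : ‖w' i‖ ≤ ‖w i‖ := by
  rw [hw', norm_mul, norm_pow, Complex.norm_of_nonneg hr0]
  exact mul_le_of_le_one_left (norm_nonneg _) (pow_le_one₀ hr0 hr1)

theorem summable_damped (hw : Summable w) (hw' : ∀ i, w' i = (r : ℂ) ^ deg i * w i)
    (hr0 : 0 ≤ r) (hr1 : r ≤ 1) : Summable w' :=
  (Summable.of_nonneg_of_le (fun _ => norm_nonneg _) (norm_damped_le hw' hr0 hr1) hw.norm).of_norm

/-- Damping all terms of positive degree by a factor `r` makes the sum of a series close to its
term of degree zero. -/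
theorem tsum_enorm_damped_le (hw : Summable w) (hw' : ∀ i, w' i = (r : ℂ) ^ deg i * w i)
    (hr0 : 0 ≤ r) (hr1 : r ≤ 1) {i₀ : ι} (h₀ : w' i₀ = 1) (hdeg : ∀ i, i ≠ i₀ → deg i ≠ 0) :
    ∑' i, ‖w' i‖ₑ ≤ ENNReal.ofReal (Real.exp (r * ∑' i, ‖w i‖)) := by
  classical
  calc ∑' i, ‖w' i‖ₑ ≤ ∑' i, ((if i = i₀ then 1 else 0) + ENNReal.ofReal (r * ‖w i‖)) := by
        refine ENNReal.tsum_le_tsum fun i => ?_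
        split_ifs with h
        · rw [h, h₀, enorm_one]
          exact le_self_add
        · rw [zero_add, ← ofReal_norm, hw', norm_mul, norm_pow, Complex.norm_of_nonneg hr0]
          exact ENNReal.ofReal_le_ofReal (mul_le_mul_of_nonneg_right
            (pow_le_of_le_one hr0 hr1 (hdeg i h)) (norm_nonneg _))
    _ = ENNReal.ofReal (1 + r * ∑' i, ‖w i‖) := by
        rw [ENNReal.tsum_add, tsum_ite_eq, ← ENNReal.ofReal_tsum_of_nonneg
          (fun i => mul_nonneg hr0 (norm_nonneg _)) (hw.norm.mul_left r), tsum_mul_left,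
          ENNReal.ofReal_add zero_le_one (mul_nonneg hr0 (tsum_nonneg fun i => norm_nonneg _)),
          ENNReal.ofReal_one]
    _ ≤ _ := ENNReal.ofReal_le_ofReal (by
        rw [add_comm]
        exact Real.add_one_le_exp _)

end Damped

theorem littlewoodTerm_bot (ρ : SymSpec) : littlewoodTerm ρ ⊥ = 1 := apply_skewSchur_self ρ ⊥

theorem cauchyTerm_bot (ρ ρ' : SymSpec) : cauchyTerm ρ ρ' ⊥ = 1 :=
  (congrArg₂ (· * ·) (littlewoodTerm_bot ρ) (littlewoodTerm_bot ρ')).trans (one_mul 1)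

section Reflect

variable {u v : ℝ} {ρp ρm : SymSpec}

theorem littlewoodTerm_up_eq (u v : ℝ) (ρ : SymSpec) (n : ℕ) (lam : YoungDiagram) :
    littlewoodTerm (scaleSpec ((u : ℂ) ^ n * (v : ℂ) ^ (n + 1)) ρ) lam =
      (((u * v) ^ n : ℝ) : ℂ) ^ lam.card * littlewoodTerm (scaleSpec v ρ) lam := by
  rw [littlewoodTerm_scaleSpec, littlewoodTerm_scaleSpec]
  push_cast
  ring

theorem littlewoodTerm_down_eq (u v : ℝ) (ρ : SymSpec) (n : ℕ) (lam : YoungDiagram) :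
    littlewoodTerm (scaleSpec ((u : ℂ) ^ (n + 1) * (v : ℂ) ^ n) ρ) lam =
      (((u * v) ^ n : ℝ) : ℂ) ^ lam.card * littlewoodTerm (scaleSpec u ρ) lam := by
  rw [littlewoodTerm_scaleSpec, littlewoodTerm_scaleSpec]
  push_cast
  ring

/-- The exponent is `2 * n + 1` instead of `2 * n + 2`, because the scalings by `v` and `u` of the
two specializations use one factor `u * v`. -/
theorem cauchyTerm_reflect_eq (u v : ℝ) (ρ ρ' : SymSpec) (n : ℕ) (lam : YoungDiagram) :
    cauchyTerm (scaleSpec ((u : ℂ) ^ (2 * (n + 1))) ρ) (scaleSpec ((v : ℂ) ^ (2 * (n + 1))) ρ') lam =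
      (((u * v) ^ (2 * n + 1) : ℝ) : ℂ) ^ lam.card *
        (littlewoodTerm (scaleSpec v ρ) lam * littlewoodTerm (scaleSpec u ρ') lam) := by
  rw [cauchyTerm_scaleSpec, littlewoodTerm_scaleSpec, littlewoodTerm_scaleSpec, cauchyTerm,
    littlewoodTerm, littlewoodTerm]
  push_cast
  ring

/-- The conditions under which the infinite product is absolutely convergent; they follow from
absolute convergence of the partition function. -/
structure Admissible (u v : ℝ) (ρp ρm : SymSpec) : Prop where
  u_nonneg : 0 ≤ u
  v_nonneg : 0 ≤ v
  mul_lt_one : u * v < 1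
  summable_up : Summable (littlewoodTerm (scaleSpec v ρp))
  summable_down : Summable (littlewoodTerm (scaleSpec u ρm))

namespace Admissible

variable (h : Admissible u v ρp ρm)
include h

theorem mul_nonneg : 0 ≤ u * v := _root_.mul_nonneg h.u_nonneg h.v_nonneg

theorem pow_nonneg (n : ℕ) : 0 ≤ (u * v) ^ n := _root_.pow_nonneg h.mul_nonneg n

theorem pow_le_one (n : ℕ) : (u * v) ^ n ≤ 1 := pow_le_one₀ h.mul_nonneg h.mul_lt_one.le

theorem summable_mul : Summable fun lam =>
    littlewoodTerm (scaleSpec v ρp) lam * littlewoodTerm (scaleSpec u ρm) lam :=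
  (summable_mul_of_summable_norm h.summable_up.norm h.summable_down.norm).comp_injective
    (i := fun lam => (lam, lam)) fun _ _ h => congrArg Prod.fst h

theorem summable_littlewoodTerm_up (n : ℕ) :
    Summable (littlewoodTerm (scaleSpec ((u : ℂ) ^ n * (v : ℂ) ^ (n + 1)) ρp)) :=
  summable_damped h.summable_up (littlewoodTerm_up_eq u v ρp n) (h.pow_nonneg n) (h.pow_le_one n)

theorem summable_littlewoodTerm_down (n : ℕ) :
    Summable (littlewoodTerm (scaleSpec ((u : ℂ) ^ (n + 1) * (v : ℂ) ^ n) ρm)) :=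
  summable_damped h.summable_down (littlewoodTerm_down_eq u v ρm n) (h.pow_nonneg n)
    (h.pow_le_one n)

theorem summable_cauchyTerm (n : ℕ) :
    Summable (cauchyTerm (scaleSpec ((u : ℂ) ^ (2 * (n + 1))) ρp)
      (scaleSpec ((v : ℂ) ^ (2 * (n + 1))) ρm)) :=
  summable_damped h.summable_mul (cauchyTerm_reflect_eq u v ρp ρm n) (h.pow_nonneg _)
    (h.pow_le_one _)

theorem norm_lt_one (n : ℕ) : ‖(u : ℂ) ^ (n + 1) * (v : ℂ) ^ (n + 1)‖ < 1 := by
  rw [← mul_pow, norm_pow, ← Complex.ofReal_mul, Complex.norm_of_nonneg h.mul_nonneg]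
  exact pow_lt_one₀ h.mul_nonneg h.mul_lt_one n.succ_ne_zero

theorem evalOne_reflectSeries (n : ℕ) :
    evalOne (reflectSeries u v ρp ρm n) = reflectionFactor u v ρp ρm (n + 1) := by
  have f1 : FiniteDegree fun lam : YoungDiagram => (2 * (n + 1)) * lam.card :=
    finiteDegree_mul_card (by positivity)
  have f2 : FiniteDegree fun lam : YoungDiagram => (4 * (n + 1) + 2) * lam.card :=
    finiteDegree_mul_card (by positivity)
  have f3 : FiniteDegree fun k : ℕ => (2 * (n + 1)) * k := finiteDegree_mul (by positivity)
  have s1 := h.summable_littlewoodTerm_up n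
  have s2 := h.summable_littlewoodTerm_down n
  have s3 := h.summable_cauchyTerm n
  have s4 := summable_geometric_of_norm_lt_one (h.norm_lt_one n)
  have m1 := mass_gradedSeries_ne_top f1 s1
  have m2 := mass_gradedSeries_ne_top f1 s2
  have m3 := mass_gradedSeries_ne_top f2 s3
  have m4 := mass_gradedSeries_ne_top f3 s4
  have m12 := ((mass_mul_le _ _).trans_lt (ENNReal.mul_lt_top m1.lt_top m2.lt_top)).ne
  have m123 := ((mass_mul_le _ _).trans_lt (ENNReal.mul_lt_top m12.lt_top m3.lt_top)).ne
  rw [reflectSeries, evalOne_mul m123 m4, evalOne_mul m12 m3, evalOne_mul m1 m2,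
    evalOne_gradedSeries f1 s1, evalOne_gradedSeries f1 s2, evalOne_gradedSeries f2 s3,
    evalOne_gradedSeries f3 s4, tsum_geometric_of_norm_lt_one (h.norm_lt_one n),
    reflectionFactor, Nat.add_sub_cancel, div_eq_mul_inv]
  rfl

/-- The logarithm of the mass of the `n + 1`-st factor is `O((u * v) ^ n)`. -/
theorem exists_mass_reflectSeries_le : ∃ C : ℝ, 0 ≤ C ∧
    ∀ n, mass (reflectSeries u v ρp ρm n) ≤ ENNReal.ofReal (Real.exp ((u * v) ^ n * C)) := by
  have hgeo : Summable fun k : ℕ => ((u * v : ℝ) : ℂ) ^ k := by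
    refine summable_geometric_of_norm_lt_one ?_
    rw [Complex.norm_of_nonneg h.mul_nonneg]
    exact h.mul_lt_one
  set C1 := ∑' lam, ‖littlewoodTerm (scaleSpec v ρp) lam‖
  set C2 := ∑' lam, ‖littlewoodTerm (scaleSpec u ρm) lam‖
  set C3 := ∑' lam, ‖littlewoodTerm (scaleSpec v ρp) lam * littlewoodTerm (scaleSpec u ρm) lam‖
  set C4 := ∑' k : ℕ, ‖((u * v : ℝ) : ℂ) ^ k‖
  have h1 : 0 ≤ C1 := tsum_nonneg fun _ => norm_nonneg _
  have h2 : 0 ≤ C2 := tsum_nonneg fun _ => norm_nonneg _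
  have h3 : 0 ≤ C3 := tsum_nonneg fun _ => norm_nonneg _
  have h4 : 0 ≤ C4 := tsum_nonneg fun _ => norm_nonneg _
  refine ⟨C1 + C2 + C3 + C4, by positivity, fun n => ?_⟩
  have hcard : ∀ lam : YoungDiagram, lam ≠ ⊥ → lam.card ≠ 0 := fun lam => mt card_eq_zero_iff.1
  have b1 := (mass_gradedSeries_le (finiteDegree_mul_card (c := 2 * (n + 1)) (by positivity))
    _).trans (tsum_enorm_damped_le h.summable_up (littlewoodTerm_up_eq u v ρp n) (h.pow_nonneg n)
    (h.pow_le_one n) (littlewoodTerm_bot _) hcard)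
  have b2 := (mass_gradedSeries_le (finiteDegree_mul_card (c := 2 * (n + 1)) (by positivity))
    _).trans (tsum_enorm_damped_le h.summable_down (littlewoodTerm_down_eq u v ρm n)
    (h.pow_nonneg n) (h.pow_le_one n) (littlewoodTerm_bot _) hcard)
  have b3 := (mass_gradedSeries_le (finiteDegree_mul_card (c := 4 * (n + 1) + 2) (by positivity))
    _).trans (tsum_enorm_damped_le h.summable_mul (cauchyTerm_reflect_eq u v ρp ρm n)
    (h.pow_nonneg _) (h.pow_le_one _) (cauchyTerm_bot _ _) hcard)
  have b4 := (mass_gradedSeries_le (finiteDegree_mul (c := 2 * (n + 1)) (by positivity))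
    _).trans (tsum_enorm_damped_le (w' := fun k => ((u : ℂ) ^ (n + 1) * (v : ℂ) ^ (n + 1)) ^ k)
    (r := (u * v) ^ n) (deg := fun k => k) hgeo
    (fun k => by push_cast; ring) (h.pow_nonneg _) (h.pow_le_one _) (i₀ := 0)
    (pow_zero _) fun k hk => hk)
  refine (mass_mul_le _ _).trans ((mul_le_mul' ((mass_mul_le _ _).trans (mul_le_mul'
    ((mass_mul_le _ _).trans (mul_le_mul' b1 b2)) b3)) b4).trans ?_)
  rw [← ENNReal.ofReal_mul (Real.exp_pos _).le, ← ENNReal.ofReal_mul (by positivity),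
    ← ENNReal.ofReal_mul (by positivity), ← Real.exp_add, ← Real.exp_add, ← Real.exp_add]
  refine ENNReal.ofReal_le_ofReal (Real.exp_le_exp.2 ?_)
  have hpow : (u * v) ^ (2 * n + 1) * C3 ≤ (u * v) ^ n * C3 :=
    mul_le_mul_of_nonneg_right (pow_le_pow_of_le_one h.mul_nonneg h.mul_lt_one.le (by omega)) h3
  linarith

end Admissible

end Reflect

/-- The product formula for an absolutely convergent partition function, by dominated
convergence. -/
theorem partitionFunction_eq {N : ℕ} {u v : ℝ} {ρp ρm : Fin N → SymSpec}
    (hw : Summable (weight u v ρp ρm)) (h : Admissible u v (iUnionSpec ρp) (iUnionSpec ρm)) :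
    Multipliable (fun n : ℕ+ => reflectionFactor u v (iUnionSpec ρp) (iUnionSpec ρm) n) ∧
      partitionFunction u v ρp ρm =
        (∏ p : Fin N × Fin N with p.1 ≤ p.2, cauchyH (ρp p.1) (ρm p.2)) *
          ∏' n : ℕ+, reflectionFactor u v (iUnionSpec ρp) (iUnionSpec ρm) n := by
  obtain ⟨C, hC0, hC⟩ := h.exists_mass_reflectSeries_le
  have hpair : ∀ p ∈ Finset.univ.filter fun p : Fin N × Fin N => p.1 ≤ p.2,
      Summable (cauchyTerm (ρp p.1) (ρm p.2)) := fun p hp =>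
    summable_cauchyTerm_pair hw (Finset.mem_filter.1 hp).2
  have hmass : ∀ p ∈ Finset.univ.filter fun p : Fin N × Fin N => p.1 ≤ p.2,
      mass (pairSeries (ρp p.1) (ρm p.2)) ≠ ∞ := fun p hp =>
    mass_gradedSeries_ne_top (finiteDegree_mul_card two_pos) (hpair p hp)
  have hs : Summable fun n => (u * v) ^ n * C :=
    (summable_geometric_of_lt_one h.mul_nonneg h.mul_lt_one).mul_right C
  have key := evalOne_eq_mul_tprod (fun n => mul_nonneg (h.pow_nonneg n) hC0) hs hC
    (X_pow_dvd_reflectSeries_sub_one u v (iUnionSpec ρp) (iUnionSpec ρm))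
    (mass_prod_ne_top _ hmass) fun d K hd => coeff_gradedSeries_weight u v ρp ρm hd
  rw [evalOne_gradedSeries finiteDegree_seqDegree hw, evalOne_prod _ hmass] at key
  simp only [h.evalOne_reflectSeries] at key
  refine ⟨?_, ?_⟩
  · exact (multipliable_pnat_iff_multipliable_succ
      (f := fun n => reflectionFactor u v (iUnionSpec ρp) (iUnionSpec ρm) n)).2 key.1
  · rw [tprod_pnat_eq_tprod_succ
      (f := fun n => reflectionFactor u v (iUnionSpec ρp) (iUnionSpec ρm) n), partitionFunction,
      key.2]
    congr 1
    refine Finset.prod_congr rfl fun p hp => ?_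
    rw [pairSeries, evalOne_gradedSeries (finiteDegree_mul_card two_pos) (hpair p hp), cauchyH]

end FreeBoundarySchur

theorem mainTheorem4 (N : ℕ) (u v : ℝ) (hu : 0 ≤ u) (hv : 0 ≤ v)
    (ρp ρm : Fin N → SymSpec) :
    ((∀ k, (ρp k).Nonneg) → (∀ k, (ρm k).Nonneg) → u * v < 1 →
      Multipliable (fun n : ℕ+ => reflectionFactorInf u v (iUnionSpec ρp) (iUnionSpec ρm) n) ∧
      partitionFunctionInf u v ρp ρm =
        (∏ p : Fin N × Fin N with p.1 ≤ p.2, cauchyHInf (ρp p.1) (ρm p.2)) *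
          ∏' n : ℕ+, reflectionFactorInf u v (iUnionSpec ρp) (iUnionSpec ρm) n) ∧
    (Summable (weight u v ρp ρm) →
      u * v < 1 ∧
      (∀ k l : Fin N, k ≤ l → Summable (cauchyTerm (ρp k) (ρm l))) ∧
      (∀ n : ℕ+,
        Summable (littlewoodTerm
          (scaleSpec ((u : ℂ) ^ ((n : ℕ) - 1) * (v : ℂ) ^ (n : ℕ)) (iUnionSpec ρp))) ∧
        Summable (littlewoodTerm
          (scaleSpec ((u : ℂ) ^ (n : ℕ) * (v : ℂ) ^ ((n : ℕ) - 1)) (iUnionSpec ρm))) ∧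
        Summable (cauchyTerm (scaleSpec ((u : ℂ) ^ (2 * (n : ℕ))) (iUnionSpec ρp))
          (scaleSpec ((v : ℂ) ^ (2 * (n : ℕ))) (iUnionSpec ρm)))) ∧
      Multipliable (fun n : ℕ+ => reflectionFactor u v (iUnionSpec ρp) (iUnionSpec ρm) n) ∧
      partitionFunction u v ρp ρm =
        (∏ p : Fin N × Fin N with p.1 ≤ p.2, cauchyH (ρp p.1) (ρm p.2)) *
          ∏' n : ℕ+, reflectionFactor u v (iUnionSpec ρp) (iUnionSpec ρm) n) := by
  refine ⟨fun hp hm _ => partitionFunctionInf_eq hu hv hp hm, fun hw => ?_⟩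
  have h : Admissible u v (iUnionSpec ρp) (iUnionSpec ρm) :=
    ⟨hu, hv, mul_lt_one_of_summable_weight hw, summable_littlewoodTerm_up hw,
      summable_littlewoodTerm_down hw⟩
  refine ⟨h.mul_lt_one, fun k l hkl => summable_cauchyTerm_pair hw hkl, fun n => ?_,
    partitionFunction_eq hw h⟩
  obtain ⟨m, hm⟩ : ∃ m, (n : ℕ) = m + 1 := ⟨n - 1, (Nat.succ_pred_eq_of_pos n.pos).symm⟩
  rw [hm, Nat.add_sub_cancel]
  exact ⟨h.summable_littlewoodTerm_up m, h.summable_littlewoodTerm_down m, h.summable_cauchyTerm m⟩
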